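/- Let $f:\mathbb R^d\to\mathbb R$ ($d\ge 1$) be twice differentiable with, for all $x,y$, $|f(x)-f(y)|\le f_{\max}$, $\|\nabla f(x)-\nabla f(y)\|\le L\|x-y\|$ and $\|\nabla^2 f(x)-\nabla^2 f(y)\|\le\rho\|x-y\|$, where $L,\rho>0$. Let $G(x,\theta)$, $\theta\sim\mathcal D$, be a stochastic gradient: $\mathbb E_\theta G(x,\theta)=\nabla f(x)$ and $\mathbb E_\theta\|G(x,\theta)-\nabla f(x)\|^2\le\sigma^2$ for all $x$. Let either $\alpha=1$ and assume in addition $\|G(x,\theta)-G(y,\theta)\|\le\ell\|x-y\|$ for all $x,y,\theta$, or let $\alpha=d$ without this assumption (and put $\ell=0$ below). Let $0<\varepsilon\le 1$ and $k=\lceil d\varepsilon^{3/4}/\sqrt\alpha\,\rceil$. Compressed SGD with RandomK, step size $\eta$ and noise level $r$ starts with $x_0\in\mathbb R^d$ arbitrary and $e_0=0$; at every iteration $t$ it independently samples $\xi_t\sim\mathcal N(0,\tfrac{r^2}{d}I)$, $\theta_t\sim\mathcal D$ and a uniformly random $k$-element set $S_t$ of coordinates, and sets $$v_t=e_t+G(x_t,\theta_t)+\xi_t,\qquad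 g_t=(v_t)_{S_t},\qquad x_{t+1}=x_t-\eta g_t,\qquad e_{t+1}=v_t-g_t,$$ where $(v)_S$ keeps the coordinates of $v$ in $S$ and replaces the others by $0$. A worker communicates in iteration $t$ the $k$ coordinates in $S_t$: it sends its own and receives the averaged ones, $2k$ real numbers in total. A point $x$ is an $\varepsilon$-SOSP if $\|\nabla f(x)\|\le\varepsilon$ and $\lambda_{\min}(\nabla^2 f(x))\ge-\sqrt{\rho\varepsilon}$. Then for every $\delta\in(0,\tfrac12]$ there are constants $A>0$ and $p\in\mathbb N$ depending only on $\delta$ such that, with $$\Lambda=A\,\bigl(1+f_{\max}+L+\rho+\rho^{-1}+\sigma+\ell\bigr)^p\,\log^p\!\left(2+\tfrac d\varepsilon\right),$$ there are $\eta>0$, $r>0$ and an integer $T\ge 1$, depending only on $\delta,d,\varepsilon,f_{\max},L,\rho,\sigma,\ell,\alpha$, with $$T\le\Lambda\cdot\frac{\alpha}{\varepsilon^4},$$ such that for all $f$, $G$, $\mathcal D$, $x_0$ as above, with probability at least $1-\delta$, at least $(1-\delta)T$ (in particular at least half) of the points $x_0,\dots,x_{T-1}$ are $\varepsilon$-SOSPs.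 Moreover, if $d\varepsilon^{3/4}/\sqrt\alpha\ge 1$, the total communication per worker in these $T$ iterations is almost surely at most $$\Lambda\cdot\frac{d\sqrt\alpha}{\varepsilon^{3+1/4}}.$$ -/

import Mathlib

open MeasureTheory ProbabilityTheory
open scoped Gradient ENNReal

universe u v

noncomputable section

/-- The parameter space `ℝ^d` with the Euclidean norm. -/
abbrev Vec (d : ℕ) := EuclideanSpace ℝ (Fin d)

/-- The objective is twice differentiable, `fmax`-bounded, `L`-smooth and has `ρ`-Lipschitz
Hessian (in operator norm); the Hessian at `x` is the operator `fderiv ℝ (∇ f) x`. -/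
structure SmoothObjective {d : ℕ} (f : Vec d → ℝ) (fmax L ρ : ℝ) : Prop where
  differentiable : Differentiable ℝ f
  differentiable_gradient : Differentiable ℝ (∇ f)
  bounded : ∀ x y, |f x - f y| ≤ fmax
  smooth : ∀ x y, ‖∇ f x - ∇ f y‖ ≤ L * ‖x - y‖
  hessian_lipschitz : ∀ x y, ‖fderiv ℝ (∇ f) x - fderiv ℝ (∇ f) y‖ ≤ ρ * ‖x - y‖

/-- `G x θ`, with `θ ∼ D`, is an unbiased stochastic gradient of `f` with variance at most `σ²`. -/
structure StochasticGradient {d : ℕ} {Θ : Type u} [MeasurableSpace Θ] (D : Measure Θ)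
    (f : Vec d → ℝ) (G : Vec d → Θ → Vec d) (σ : ℝ) : Prop where
  measurable : Measurable (Function.uncurry G)
  integrable : ∀ x, Integrable (G x) D
  unbiased : ∀ x, ∫ θ, G x θ ∂D = ∇ f x
  integrable_sq : ∀ x, Integrable (fun θ => ‖G x θ - ∇ f x‖ ^ 2) D
  variance_le : ∀ x, ∫ θ, ‖G x θ - ∇ f x‖ ^ 2 ∂D ≤ σ ^ 2

/-- The stochastic gradient is `ℓ`-Lipschitz; the value `ℓ = ∞` imposes no condition. -/
def LipschitzStochasticGradient {d : ℕ} {Θ : Type u} (G : Vec d → Θ → Vec d) (ℓ : ℝ≥0∞) : Prop :=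
  ∀ x y θ, edist (G x θ) (G y θ) ≤ ℓ * edist x y

/-- `α = 1` if the stochastic gradient is assumed Lipschitz, and `α = d` otherwise. -/
def alphaParam (d : ℕ) (ℓ : ℝ≥0∞) : ℝ :=
  open Classical in if ℓ = ∞ then (d : ℝ) else 1

/-- `x` is an `ε`-second-order stationary point of a function with `ρ`-Lipschitz Hessian: the
gradient has norm at most `ε` and all eigenvalues of the Hessian are at least `-√(ρ ε)`. -/
def IsSOSP {d : ℕ} (f : Vec d → ℝ) (ρ ε : ℝ) (x : Vec d) : Prop :=
  ‖∇ f x‖ ≤ ε ∧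
    ∀ lam : ℝ, Module.End.HasEigenvalue (fderiv ℝ (∇ f) x : Vec d →ₗ[ℝ] Vec d) lam →
      -√(ρ * ε) ≤ lam

/-- The number of `ε`-SOSPs among the first `T` points `x 0, …, x (T - 1)`. -/
def sospCount {d : ℕ} (f : Vec d → ℝ) (ρ ε : ℝ) (x : ℕ → Vec d) (T : ℕ) : ℕ :=
  {t : ℕ | t < T ∧ IsSOSP f ρ ε (x t)}.ncard

/-- The compressor that keeps the coordinates in `S` and sets the others to zero. -/
def keepCoords {d : ℕ} (v : Vec d) (S : Finset (Fin d)) : Vec d :=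
  WithLp.toLp 2 (fun i => if i ∈ S then v i else 0)

/-- The randomness of the RandomK compressor: a uniformly random `k`-element set of coordinates. -/
def randomKLaw (d k : ℕ) : Measure (Finset (Fin d)) :=
  uniformOn {S : Finset (Fin d) | S.card = k}

/-- The number of coordinates `k = d ε^{3/4} / √α`, rounded up to an integer. -/
def randomKSize (d : ℕ) (ε α : ℝ) : ℕ := ⌈d * ε ^ (3 / 4 : ℝ) / √α⌉₊

/-- The centred isotropic Gaussian law on `ℝ^d` with total variance `r²`, i.e. with covariance
matrix `(r² / d) I`. -/
def noiseLaw (d : ℕ) (r : ℝ) : Measure (Vec d) :=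
  (stdGaussian (Vec d)).map (fun z => (r / √d) • z)

/-- Compressed SGD with error feedback and without error resets. The state after `t` iterations is
the pair `(x_t, e_t)` of the iterate and the accumulated compression error; `C` is the compressor,
`G` the stochastic gradient, `η` the step size, `x₀` the starting point, `ξ` the artificial noise,
and `θ`, `κ` are the random seeds of the stochastic gradient and of the compressor. -/
def compressedSGD {d : ℕ} {Θ : Type u} {K : Type v} (C : Vec d → K → Vec d)
    (G : Vec d → Θ → Vec d) (η : ℝ) (x₀ : Vec d) (ξ : ℕ → Vec d) (θ : ℕ → Θ) (κ : ℕ → K) :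
    ℕ → Vec d × Vec d
  | 0 => (x₀, 0)
  | t + 1 =>
    let s := compressedSGD C G η x₀ ξ θ κ t
    let v := s.2 + G s.1 (θ t) + ξ t
    let g := C v (κ t)
    (s.1 - η • g, v - g)

/-- On the probability space `(Ω, P)`, at every iteration `t` the noise `ξ t`, the gradient seed
`θ t ∼ D` and the coordinate set `S t` are sampled independently of each other and of all other
iterations. -/
structure IsSampling {d : ℕ} {Θ : Type u} [MeasurableSpace Θ] {Ω : Type v} [MeasurableSpace Ω]
    (P : Measure Ω) (D : Measure Θ) (k : ℕ) (r : ℝ)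
    (ξ : ℕ → Ω → Vec d) (θ : ℕ → Ω → Θ) (S : ℕ → Ω → Finset (Fin d)) : Prop where
  measurable_noise : ∀ t, Measurable (ξ t)
  measurable_seed : ∀ t, Measurable (θ t)
  measurable_coords : ∀ t, Measurable (S t)
  indep : iIndepFun (fun t ω => (ξ t ω, θ t ω, S t ω)) P
  law : ∀ t, P.map (fun ω => (ξ t ω, θ t ω, S t ω)) =
    (noiseLaw d r).prod (D.prod (randomKLaw d k))

/-- The total communication of one worker in `T` iterations, in transmitted real numbers: with
shared randomness for the coordinate sets `S t`, at iteration `t` the worker sends the coordinates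
in `S t` of its vector and receives the coordinates in `S t` of the average. -/
def commPerWorker {d : ℕ} (S : ℕ → Finset (Fin d)) (T : ℕ) : ℕ :=
  ∑ t ∈ Finset.range T, 2 * (S t).card

/-- The quantity in which the constants hidden by `Õ` are polynomial. -/
def problemSize (fmax L ρ σ : ℝ) (ℓ : ℝ≥0∞) : ℝ := 1 + fmax + L + ρ + ρ⁻¹ + σ + ℓ.toReal

/-- The factor hidden by `Õ`: polynomial in the problem constants, polylogarithmic in `d / ε`. -/
def hiddenFactor (A : ℝ) (p d : ℕ) (ε fmax L ρ σ : ℝ) (ℓ : ℝ≥0∞) : ℝ :=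
  A * problemSize fmax L ρ σ ℓ ^ p * Real.log (2 + d / ε) ^ p

end

/-! Write μ = k/d and let y = x - η e be the iterate corrected by the compression error
(`corrected`). The compressor cancels in y: each iteration moves y by -η (G(x, θ) + ξ), whatever S
is (`corrected_sgdStep`). Compression is felt only through the gap x - y = η e between the point
where the gradient is taken and the point that moves, and RandomK contracts the mean of ‖e‖² at rate
1 - μ. All expectations are iterates of a Markov operator on `ℝ≥0∞`-valued functions of the state.

Energy. f(y) plus a multiple of ‖e‖² decreases in the mean by η/4 ‖∇f(x)‖² + η³L²/2 ‖e‖², up to an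
additive L η² (σ² + r²) (`StochasticGradient.markovOp_objective_le`). Summed over time, this bounds
the squared gradients and errors along the run, hence the number of points with a large gradient. It
also bounds the mean squared displacement over blocks of I iterations, summed over all starting
times (`StochasticGradient.blockDisplacement_le`, `StochasticGradient.sum_blockBound_le`).

Escape. From a state whose Hessian has an eigenvalue below -√(ρε), the displacement over a block
cannot be small (`StochasticGradient.le_blockDisplacement`). A second copy starts from the same
state with the same θ and S, but with ξ reflected in the hyperplane orthogonal to a bottom
eigenvector v. The Gaussian law is invariant under the reflection, so each copy has the law of
compressed SGD, while the noise in their difference is 2⟨v, ξ⟩v. Along v the difference is compared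
with the scalar recursion b ↦ (1 + ηγ) b - 2η⟨v, ξ⟩, which is exactly Gaussian with exponentially
growing variance. The injected noise cancels in the deviation from this model. What remains is due
to the variance of gradient differences, to compression, and to the variation of the Hessian, which
is controlled by the distance travelled. No stopping time is needed for the last effect: the weight
exp(-C q), with q the accumulated squared distance of both copies, absorbs it (`coupledPotential`).
So the copies travel far, or they separate, or b is atypically small, or the weighted deviation is
large (`one_le_escape_alternatives`). The last two are unlikely, and the first two force
displacement.

Conclusion. Every visited point that is not an ε-SOSP contributes at least 1 to a sum of rescaled
squared gradients and block bounds. With the parameters of `exists_parameters` the mean of this sum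
is at most δ²T, and Markov's inequality finishes the proof. The number α enters through r²: in every
direction the noise variance r²/d has to dominate the part of the variance of gradient differences
that does not vanish with the distance. -/

/-! ### Markov operators and Lyapunov recursions. -/

/-- The Markov operator of the chain `s ↦ Φ s z` with innovations `z ∼ ν`. -/
noncomputable def markovOp {S Z : Type*} [MeasurableSpace Z] (ν : Measure Z) (Φ : S → Z → S)
    (h : S → ℝ≥0∞) : S → ℝ≥0∞ :=
  fun s => ∫⁻ z, h (Φ s z) ∂ν

section MarkovOp

variable {S Z : Type*} [MeasurableSpace S] [MeasurableSpace Z] {ν : Measure Z} {Φ : S → Z → S}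

theorem measurable_markovOp [SFinite ν] (hΦ : Measurable (Function.uncurry Φ)) {h : S → ℝ≥0∞}
    (hh : Measurable h) : Measurable (markovOp ν Φ h) :=
  Measurable.lintegral_prod_right' (f := fun p : S × Z => h (Function.uncurry Φ p))
    (hh.comp hΦ)

theorem measurable_markovOp_iterate [SFinite ν] (hΦ : Measurable (Function.uncurry Φ))
    {h : S → ℝ≥0∞} (hh : Measurable h) (n : ℕ) : Measurable ((markovOp ν Φ)^[n] h) := by
  induction n generalizing h with
  | zero => exact hh
  | succ n ih => exact ih (measurable_markovOp hΦ hh)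

omit [MeasurableSpace S] in
theorem markovOp_iterate_mono {h h' : S → ℝ≥0∞} (hle : ∀ s, h s ≤ h' s) (n : ℕ) (s : S) :
    (markovOp ν Φ)^[n] h s ≤ (markovOp ν Φ)^[n] h' s := by
  induction n generalizing h h' with
  | zero => exact hle s
  | succ n ih => exact ih fun s => lintegral_mono fun z => hle _

theorem markovOp_iterate_add [SFinite ν] (hΦ : Measurable (Function.uncurry Φ))
    {h h' : S → ℝ≥0∞} (hh : Measurable h) (n : ℕ) (s : S) :
    (markovOp ν Φ)^[n] (fun s => h s + h' s) s =
      (markovOp ν Φ)^[n] h s + (markovOp ν Φ)^[n] h' s := by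
  induction n generalizing h h' with
  | zero => rfl
  | succ n ih =>
    simp only [Function.iterate_succ, Function.comp_apply]
    rw [← ih (measurable_markovOp hΦ hh)]
    refine congrFun (congrArg _ (funext fun s => ?_)) _
    exact lintegral_add_left (hh.comp (hΦ.comp measurable_prodMk_left)) _

theorem markovOp_iterate_sum [SFinite ν] (hΦ : Measurable (Function.uncurry Φ)) {ι : Type*}
    (F : Finset ι) {h : ι → S → ℝ≥0∞} (hh : ∀ i, Measurable (h i)) (n : ℕ) (s : S) :
    (markovOp ν Φ)^[n] (fun s => ∑ i ∈ F, h i s) s = ∑ i ∈ F, (markovOp ν Φ)^[n] (h i) s := by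
  classical
  induction F using Finset.induction_on with
  | empty =>
    simp only [Finset.sum_empty]
    induction n with
    | zero => rfl
    | succ n ih =>
      simp only [Function.iterate_succ, Function.comp_apply]
      have h0 : markovOp ν Φ (fun _ => 0) = fun _ => 0 := by
        funext s; simp [markovOp]
      rw [h0, ih]
  | insert i F hi ih =>
    simp only [Finset.sum_insert hi]
    rw [markovOp_iterate_add hΦ (hh i), ih]

theorem markovOp_iterate_const_mul [SFinite ν] (hΦ : Measurable (Function.uncurry Φ))
    {h : S → ℝ≥0∞} (hh : Measurable h) (c : ℝ≥0∞) (n : ℕ) (s : S) :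
    (markovOp ν Φ)^[n] (fun s => c * h s) s = c * (markovOp ν Φ)^[n] h s := by
  induction n generalizing h with
  | zero => rfl
  | succ n ih =>
    simp only [Function.iterate_succ, Function.comp_apply]
    rw [← ih (measurable_markovOp hΦ hh)]
    refine congrFun (congrArg _ (funext fun s => ?_)) _
    exact lintegral_const_mul _ (hh.comp (hΦ.comp measurable_prodMk_left))

omit [MeasurableSpace S] in
theorem markovOp_iterate_const [IsProbabilityMeasure ν] (c : ℝ≥0∞) (n : ℕ) (s : S) :
    (markovOp ν Φ)^[n] (fun _ => c) s = c := by
  induction n with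
  | zero => rfl
  | succ n ih =>
    simp only [Function.iterate_succ, Function.comp_apply]
    have : markovOp ν Φ (fun _ => c) = fun _ => c := by
      funext s; simp [markovOp]
    rw [this, ih]

/-- Markov operators commute with a factor map of the chain. -/
theorem markovOp_iterate_comp [SFinite ν] {S' : Type*} {Φ' : S' → Z → S'}
    (hΦ : Measurable (Function.uncurry Φ)) {pr : S' → S} {τ : Z → Z}
    (hτ : MeasurePreserving τ ν ν)
    (hpr : ∀ s' z, pr (Φ' s' z) = Φ (pr s') (τ z)) {h : S → ℝ≥0∞} (hh : Measurable h) (n : ℕ)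
    (s' : S') : (markovOp ν Φ')^[n] (fun s' => h (pr s')) s' = (markovOp ν Φ)^[n] h (pr s') := by
  induction n generalizing h with
  | zero => rfl
  | succ n ih =>
    simp only [Function.iterate_succ, Function.comp_apply]
    rw [← ih (measurable_markovOp hΦ hh)]
    refine congrFun (congrArg _ (funext fun s' => ?_)) _
    simp only [markovOp, hpr]
    exact hτ.lintegral_comp (hh.comp (hΦ.comp measurable_prodMk_left))

/-- One step of a Lyapunov recursion with multiplicative growth. -/
theorem markovOp_iterate_succ_le [SFinite ν] (hΦ : Measurable (Function.uncurry Φ))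
    {V c : S → ℝ≥0∞} (hV : Measurable V) {a : ℝ≥0∞}
    (hle : ∀ s, markovOp ν Φ V s ≤ a * V s + c s) (n : ℕ) (s : S) :
    (markovOp ν Φ)^[n + 1] V s ≤ a * (markovOp ν Φ)^[n] V s + (markovOp ν Φ)^[n] c s := by
  rw [Function.iterate_succ_apply, ← markovOp_iterate_const_mul hΦ hV,
    ← markovOp_iterate_add hΦ (hV.const_mul a)]
  exact markovOp_iterate_mono hle n s

/-- Summing the decrease of a Lyapunov function. -/
theorem sum_markovOp_iterate_le [IsProbabilityMeasure ν] (hΦ : Measurable (Function.uncurry Φ))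
    {V c : S → ℝ≥0∞} (hV : Measurable V) {b : ℝ≥0∞}
    (hle : ∀ s, markovOp ν Φ V s + c s ≤ V s + b) (n : ℕ) (s : S) :
    ∑ t ∈ Finset.range n, (markovOp ν Φ)^[t] c s + (markovOp ν Φ)^[n] V s ≤ V s + n * b := by
  induction n with
  | zero => simp
  | succ n ih =>
    have h1 := markovOp_iterate_mono (ν := ν) (Φ := Φ) hle n s
    rw [markovOp_iterate_add hΦ (measurable_markovOp hΦ hV), markovOp_iterate_add hΦ hV,
      markovOp_iterate_const, ← Function.iterate_succ_apply] at h1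
    calc ∑ t ∈ Finset.range (n + 1), (markovOp ν Φ)^[t] c s + (markovOp ν Φ)^[n + 1] V s
        = ∑ t ∈ Finset.range n, (markovOp ν Φ)^[t] c s +
          ((markovOp ν Φ)^[n + 1] V s + (markovOp ν Φ)^[n] c s) := by
          rw [Finset.sum_range_succ]; ring
      _ ≤ ∑ t ∈ Finset.range n, (markovOp ν Φ)^[t] c s + ((markovOp ν Φ)^[n] V s + b) := by gcongr
      _ ≤ V s + n * b + b := by rw [← add_assoc]; gcongr
      _ = V s + ((n + 1 : ℕ) : ℝ≥0∞) * b := by push_cast; ring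

/-- The expectation along a chain driven by independent innovations is an iterate of the
Markov operator. -/
theorem lintegral_chain_eq [IsProbabilityMeasure ν] (hΦ : Measurable (Function.uncurry Φ))
    {Ω : Type*} [MeasurableSpace Ω] {P : Measure Ω} [IsProbabilityMeasure P] {z : ℕ → Ω → Z}
    (hz : ∀ t, Measurable (z t)) (hind : iIndepFun z P) (hlaw : ∀ t, P.map (z t) = ν)
    {x : ℕ → Ω → S} {s₀ : S} (hx0 : ∀ ω, x 0 ω = s₀)
    (hx : ∀ t ω, x (t + 1) ω = Φ (x t ω) (z t ω)) {h : S → ℝ≥0∞} (hh : Measurable h) (t : ℕ) :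
    Measurable (x t) ∧ ∫⁻ ω, h (x t ω) ∂P = (markovOp ν Φ)^[t] h s₀ := by
  -- The state at time t depends only on the innovations before t, hence is independent of `z t`.
  have key : ∀ t, ∃ F : (Finset.range t → Z) → S, Measurable F ∧
      ∀ ω, x t ω = F (fun i => z i ω) := by
    intro t
    induction t with
    | zero => exact ⟨fun _ => s₀, measurable_const, hx0⟩
    | succ t ih =>
      obtain ⟨F, hF, hFx⟩ := ih
      refine ⟨fun y => Φ (F fun i => y ⟨i, Finset.mem_range.2 (by
        have := Finset.mem_range.1 i.2; omega)⟩) (y ⟨t, Finset.self_mem_range_succ t⟩),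
        ?_, fun ω => by rw [hx, hFx]⟩
      refine hΦ.comp (Measurable.prodMk (hF.comp ?_) (measurable_pi_apply _))
      exact measurable_pi_lambda _ fun i => measurable_pi_apply _
  have hxm : ∀ t, Measurable (x t) := by
    intro t
    obtain ⟨F, hF, hFx⟩ := key t
    have : x t = fun ω => F (fun i => z i ω) := funext hFx
    rw [this]
    exact hF.comp (measurable_pi_lambda _ fun i => hz _)
  refine ⟨hxm t, ?_⟩
  induction t generalizing h with
  | zero => simp [hx0]
  | succ t ih =>
    rw [Function.iterate_succ_apply, ← ih (measurable_markovOp hΦ hh)]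
    have hi : IndepFun (x t) (z t) P := by
      obtain ⟨F, hF, hFx⟩ := key t
      have h1 := hind.indepFun_finset (Finset.range t) {t} (by simp) hz
      have h2 := h1.comp hF (measurable_pi_apply (⟨t, Finset.mem_singleton_self t⟩ : ({t} : Finset ℕ)))
      have : x t = F ∘ fun ω (i : Finset.range t) => z i ω := funext hFx
      rw [this]
      exact h2
    have hm := (indepFun_iff_map_prod_eq_prod_map_map (hxm t).aemeasurable
      (hz t).aemeasurable).1 hi
    rw [hlaw] at hm
    have hh' : Measurable fun p : S × Z => h (Φ p.1 p.2) := hh.comp hΦ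
    calc ∫⁻ ω, h (x (t + 1) ω) ∂P
        = ∫⁻ p, h (Φ p.1 p.2) ∂(P.map fun ω => (x t ω, z t ω)) := by
          rw [lintegral_map hh' ((hxm t).prodMk (hz t))]
          simp only [hx]
      _ = ∫⁻ s, ∫⁻ y, h (Φ s y) ∂ν ∂(P.map (x t)) := by
          rw [hm, lintegral_prod _ hh'.aemeasurable]
      _ = ∫⁻ ω, markovOp ν Φ h (x t ω) ∂P :=
          lintegral_map (measurable_markovOp hΦ hh) (hxm t)

end MarkovOp

/-! ### Second moments of translated random vectors. -/

section SecondMoment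

variable {Z : Type*} [MeasurableSpace Z] {E : Type*} [NormedAddCommGroup E]
  [InnerProductSpace ℝ E] [CompleteSpace E]

/-- The second moment of a translated square integrable random vector. -/
theorem integral_norm_const_add_sq {μ : Measure Z} [IsProbabilityMeasure μ] {X : Z → E}
    (hX : MemLp X 2 μ) {m : E} (hm : ∫ z, X z ∂μ = m) (A : E) :
    Integrable (fun z => ‖A + X z‖ ^ 2) μ ∧
      ∫ z, ‖A + X z‖ ^ 2 ∂μ = ‖A + m‖ ^ 2 + ∫ z, ‖X z - m‖ ^ 2 ∂μ := by
  have hint : Integrable X μ := hX.integrable one_le_two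
  have h1 : MemLp (fun z => X z - m) 2 μ := hX.sub (memLp_const m)
  have h2 : Integrable (fun z => ‖X z - m‖ ^ 2) μ := h1.integrable_norm_pow two_ne_zero
  have h3 : Integrable (fun z => inner ℝ (A + m) (X z - m)) μ :=
    (hint.sub (integrable_const m)).const_inner _
  have hmean : ∫ z, inner ℝ (A + m) (X z - m) ∂μ = 0 := by
    have h4 : Integrable (fun z => X z - m) μ := hint.sub (integrable_const m)
    rw [integral_inner h4, integral_sub hint (integrable_const m), hm]
    simp
  have heq : ∀ z, ‖A + X z‖ ^ 2 =
      ‖A + m‖ ^ 2 + (2 * inner ℝ (A + m) (X z - m) + ‖X z - m‖ ^ 2) := by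
    intro z
    have : A + X z = (A + m) + (X z - m) := by abel
    rw [this, norm_add_sq_real]
    ring
  simp only [heq]
  have h5 : Integrable (fun z => 2 * inner ℝ (A + m) (X z - m) + ‖X z - m‖ ^ 2) μ :=
    (h3.const_mul 2).add h2
  refine ⟨(integrable_const _).add h5, ?_⟩
  rw [integral_add (integrable_const _) h5, integral_add (h3.const_mul 2) h2, integral_const_mul, hmean]
  simp

theorem lintegral_norm_const_add_sq {μ : Measure Z} [IsProbabilityMeasure μ] {X : Z → E}
    (hX : MemLp X 2 μ) {m : E} (hm : ∫ z, X z ∂μ = m) (A : E) {c : ℝ} (hc : 0 ≤ c) :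
    ∫⁻ z, ENNReal.ofReal (‖A + X z‖ ^ 2 + c) ∂μ =
      ENNReal.ofReal (‖A + m‖ ^ 2 + ∫ z, ‖X z - m‖ ^ 2 ∂μ + c) := by
  obtain ⟨h1, h2⟩ := integral_norm_const_add_sq hX hm A
  have h3 : Integrable (fun z => ‖A + X z‖ ^ 2 + c) μ := h1.add (integrable_const c)
  rw [← ofReal_integral_eq_lintegral_ofReal h3 (Filter.Eventually.of_forall fun z => by positivity),
    integral_add h1 (integrable_const c), h2]
  simp

/-- The second moment of a sum of a constant and two independent square integrable vectors,
the first of which is centred. -/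
theorem lintegral_lintegral_norm_add_sq {Z' : Type*} [MeasurableSpace Z'] {μ : Measure Z}
    {μ' : Measure Z'} [IsProbabilityMeasure μ] [IsProbabilityMeasure μ'] {X : Z → E} {Y : Z' → E}
    (hX : MemLp X 2 μ) (hX0 : ∫ z, X z ∂μ = 0) (hY : MemLp Y 2 μ') {m : E}
    (hm : ∫ z, Y z ∂μ' = m) (A : E) :
    ∫⁻ z, ∫⁻ z', ENNReal.ofReal (‖A + X z + Y z'‖ ^ 2) ∂μ' ∂μ =
      ENNReal.ofReal (‖A + m‖ ^ 2 + ∫ z, ‖X z‖ ^ 2 ∂μ + ∫ z', ‖Y z' - m‖ ^ 2 ∂μ') := by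
  have h1 : ∀ z, ∫⁻ z', ENNReal.ofReal (‖A + X z + Y z'‖ ^ 2) ∂μ' =
      ENNReal.ofReal (‖(A + m) + X z‖ ^ 2 + ∫ z', ‖Y z' - m‖ ^ 2 ∂μ') := by
    intro z
    have := lintegral_norm_const_add_sq hY hm (A + X z) le_rfl
    simp only [add_zero] at this
    rw [this]
    congr 4
    abel
  simp only [h1]
  rw [lintegral_norm_const_add_sq hX hX0 (A + m) (by positivity)]
  simp

end SecondMoment

/-! ### The RandomK compressor. -/

section RandomK

variable {d k : ℕ}

theorem setOf_card_eq_coe (d k : ℕ) :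
    {S : Finset (Fin d) | S.card = k} = ↑(Finset.powersetCard k (Finset.univ : Finset (Fin d))) := by
  ext S
  simp [Finset.mem_powersetCard]

theorem isProbabilityMeasure_randomKLaw (hk : k ≤ d) : IsProbabilityMeasure (randomKLaw d k) := by
  refine isProbabilityMeasure_uniformOn (Set.toFinite _) ?_
  obtain ⟨S, -, hS⟩ := Finset.exists_subset_card_eq (s := (Finset.univ : Finset (Fin d))) (n := k)
    (by simpa using hk)
  exact ⟨S, hS⟩

theorem ae_card_eq_of_randomKLaw (hk : k ≤ d) : ∀ᵐ S ∂randomKLaw d k, S.card = k := by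
  have := isProbabilityMeasure_randomKLaw hk
  have hne : {S : Finset (Fin d) | S.card = k}.Nonempty := by
    obtain ⟨S, -, hS⟩ := Finset.exists_subset_card_eq (s := (Finset.univ : Finset (Fin d))) (n := k)
      (by simpa using hk)
    exact ⟨S, hS⟩
  have h1 : randomKLaw d k {S : Finset (Fin d) | S.card = k} = 1 :=
    uniformOn_self (Set.toFinite _) hne
  exact (prob_compl_eq_zero_iff (Set.toFinite _).measurableSet).2 h1

/-- A given coordinate is dropped with probability `1 - k / d`. -/
theorem randomKLaw_notMem (hd : 1 ≤ d) (hk : k ≤ d) (i : Fin d) :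
    randomKLaw d k {S | i ∉ S} = ENNReal.ofReal (1 - k / d) := by
  classical
  have h1 : {S : Finset (Fin d) | S.card = k} ∩ {S | i ∉ S} =
      ↑(Finset.powersetCard k ((Finset.univ : Finset (Fin d)).erase i)) := by
    ext S
    simp [Finset.mem_powersetCard, Finset.subset_erase, and_comm]
  obtain ⟨n, rfl⟩ : ∃ n, d = n + 1 := ⟨d - 1, by omega⟩
  rw [randomKLaw, ← uniformOn_inter_self (Set.toFinite _), h1, setOf_card_eq_coe,
    uniformOn_apply_finset, Finset.inter_eq_right.2
      (Finset.powersetCard_mono (Finset.erase_subset _ _)), Finset.card_powersetCard,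
    Finset.card_powersetCard, Finset.card_erase_of_mem (Finset.mem_univ _), Finset.card_univ,
    Fintype.card_fin, Nat.add_sub_cancel]
  -- Among the `(n + 1).choose k` sets exactly `n.choose k` avoid i; this identity turns the ratio
  -- into 1 - k/(n + 1).
  have h2 := Nat.choose_mul_succ_eq n k
  have h3 : (0 : ℝ) < (n + 1).choose k := by exact_mod_cast Nat.choose_pos hk
  have h4 : ((n.choose k : ℕ) : ℝ) * (n + 1) = (n + 1).choose k * ((n + 1) - k) := by
    have := congrArg (Nat.cast (R := ℝ)) h2
    push_cast [Nat.cast_sub hk] at this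
    exact this
  have h5 : (1 - (k : ℝ) / ((n + 1 : ℕ) : ℝ)) = (n.choose k : ℝ) / (n + 1).choose k := by
    push_cast
    field_simp
    linarith
  rw [h5, ENNReal.ofReal_div_of_pos h3, ENNReal.ofReal_natCast, ENNReal.ofReal_natCast]

theorem measurable_keepCoords :
    Measurable fun p : Vec d × Finset (Fin d) => keepCoords p.1 p.2 := by
  unfold keepCoords
  refine (EuclideanSpace.volume_preserving_symm_measurableEquiv_toLp (Fin d)).symm.measurable.comp
    (measurable_pi_lambda _ fun i => ?_)
  refine Measurable.ite (measurable_snd (measurableSet_mem_finset i)) ?_ measurable_const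
  fun_prop

/-- The mean squared compression error of RandomK. -/
theorem lintegral_norm_sub_keepCoords_sq (hd : 1 ≤ d) (hk : k ≤ d) (v : Vec d) :
    ∫⁻ S, ENNReal.ofReal (‖v - keepCoords v S‖ ^ 2) ∂randomKLaw d k =
      ENNReal.ofReal ((1 - k / d) * ‖v‖ ^ 2) := by
  have hk' : (0 : ℝ) ≤ 1 - k / d := by
    rw [sub_nonneg, div_le_one (by positivity)]
    exact_mod_cast hk
  have h1 : ∀ S, ENNReal.ofReal (‖v - keepCoords v S‖ ^ 2) =
      ∑ i, Set.indicator {S : Finset (Fin d) | i ∉ S} (fun _ => ENNReal.ofReal (v i ^ 2)) S := by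
    intro S
    rw [EuclideanSpace.norm_sq_eq, ENNReal.ofReal_sum_of_nonneg fun i _ => by positivity]
    refine Finset.sum_congr rfl fun i _ => ?_
    by_cases hi : i ∈ S <;> simp [keepCoords, hi]
  simp only [h1]
  rw [lintegral_finsetSum _ fun i _ =>
    measurable_const.indicator (measurableSet_notMem_finset i)]
  simp only [lintegral_indicator_const (measurableSet_notMem_finset _), randomKLaw_notMem hd hk]
  rw [← Finset.sum_mul, ← ENNReal.ofReal_sum_of_nonneg fun i _ => by positivity,
    ← ENNReal.ofReal_mul (by positivity), mul_comm, EuclideanSpace.norm_sq_eq]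
  simp

end RandomK

/-! ### The isotropic Gaussian noise. -/

section NoiseLaw

variable {d : ℕ}

instance isProbabilityMeasure_noiseLaw (r : ℝ) : IsProbabilityMeasure (noiseLaw d r) := by
  unfold noiseLaw
  exact Measure.isProbabilityMeasure_map (by fun_prop)

instance isGaussian_noiseLaw (r : ℝ) : IsGaussian (noiseLaw d r) := by
  unfold noiseLaw
  exact isGaussian_map ((r / √d) • ContinuousLinearMap.id ℝ (Vec d))

theorem memLp_noiseLaw (r : ℝ) : MemLp (fun ξ : Vec d => ξ) 2 (noiseLaw d r) :=
  IsGaussian.memLp_two_id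

theorem integral_noiseLaw (r : ℝ) : ∫ ξ : Vec d, ξ ∂noiseLaw d r = 0 := by
  rw [noiseLaw, integral_map (by fun_prop) (by fun_prop), integral_smul, integral_id_stdGaussian,
    smul_zero]

/-- The noise is Gaussian with variance `r² / d` in every direction. -/
theorem map_inner_noiseLaw (r : ℝ) {w : Vec d} (hw : ‖w‖ = 1) :
    (noiseLaw d r).map (fun ξ => inner ℝ w ξ) = gaussianReal 0 (Real.toNNReal (r ^ 2 / d)) := by
  have h1 : (stdGaussian (Vec d)).map (fun ξ => inner ℝ w ξ) = gaussianReal 0 1 := by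
    have := IsGaussian.map_eq_gaussianReal (μ := stdGaussian (Vec d)) (innerSL ℝ w)
    rw [integral_strongDual_stdGaussian, variance_dual_stdGaussian, innerSL_apply_norm, hw] at this
    simpa using this
  rw [noiseLaw, Measure.map_map (by fun_prop) (by fun_prop)]
  have h2 : (fun ξ : Vec d => inner ℝ w ξ) ∘ (fun z => (r / √d) • z) =
      (fun x : ℝ => (r / √d) * x) ∘ fun ξ => inner ℝ w ξ := by
    funext z
    simp [inner_smul_right]
  rw [h2, ← Measure.map_map (by fun_prop) (by fun_prop), h1, gaussianReal_map_const_mul]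
  congr 1
  · simp
  · ext
    simp only [mul_one, NNReal.coe_mk]
    rw [Real.coe_toNNReal _ (by positivity), div_pow, Real.sq_sqrt (by positivity)]

theorem integral_inner_sq_noiseLaw (r : ℝ) {w : Vec d} (hw : ‖w‖ = 1) :
    ∫ ξ, (inner ℝ w ξ) ^ 2 ∂noiseLaw d r = r ^ 2 / d := by
  have h1 : ∫ ξ, (inner ℝ w ξ) ^ 2 ∂noiseLaw d r =
      ∫ x, x ^ 2 ∂((noiseLaw d r).map fun ξ => inner ℝ w ξ) := by
    rw [integral_map (by fun_prop) (by fun_prop)]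
  rw [h1, map_inner_noiseLaw r hw]
  have h2 := variance_fun_id_gaussianReal (μ := 0) (v := Real.toNNReal (r ^ 2 / d))
  rw [variance_of_integral_eq_zero (by fun_prop) (by simp)] at h2
  rw [h2, Real.coe_toNNReal _ (by positivity)]

theorem integral_norm_sq_noiseLaw (hd : 1 ≤ d) (r : ℝ) :
    ∫ ξ : Vec d, ‖ξ‖ ^ 2 ∂noiseLaw d r = r ^ 2 := by
  have h1 : ∀ ξ : Vec d, ‖ξ‖ ^ 2 = ∑ i, (inner ℝ (EuclideanSpace.single i (1 : ℝ)) ξ) ^ 2 := by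
    intro ξ
    rw [EuclideanSpace.norm_sq_eq]
    simp [EuclideanSpace.inner_single_left]
  simp only [h1]
  rw [integral_finsetSum]
  · simp only [integral_inner_sq_noiseLaw r (w := EuclideanSpace.single _ (1 : ℝ)) (by simp)]
    simp
    field_simp
  · intro i _
    exact ((memLp_noiseLaw r).const_inner _).integrable_sq

/-- The reflection of the noise in a hyperplane has the same law. -/
theorem measurePreserving_reflection_noiseLaw (r : ℝ) (K : Submodule ℝ (Vec d))
    [K.HasOrthogonalProjection] :
    MeasurePreserving K.reflection (noiseLaw d r) (noiseLaw d r) := by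
  refine ⟨K.reflection.continuous.measurable, ?_⟩
  have h := stdGaussian_map K.reflection
  rw [noiseLaw, Measure.map_map K.reflection.continuous.measurable (by fun_prop)]
  conv_rhs => rw [← h]
  rw [Measure.map_map (by fun_prop) K.reflection.continuous.measurable]
  congr 1
  funext z
  simp

end NoiseLaw

/-! ### Consequences of a Lipschitz gradient. -/

section SmoothObjective

variable {d : ℕ} {f : Vec d → ℝ} {fmax L ρ : ℝ}

/-- The quadratic upper bound for a function with Lipschitz gradient. -/
theorem SmoothObjective.le_quadratic (hf : SmoothObjective f fmax L ρ) (y z : Vec d) :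
    f z ≤ f y + inner ℝ (∇ f y) (z - y) + L / 2 * ‖z - y‖ ^ 2 := by
  set h := z - y with hh
  -- Along the segment, φ is f minus its quadratic upper model, up to a constant. The Lipschitz
  -- bound makes its derivative nonpositive, so φ 1 ≤ φ 0.
  let φ : ℝ → ℝ := fun t => f (y + t • h) - t * inner ℝ (∇ f y) h - L / 2 * t ^ 2 * ‖h‖ ^ 2
  have hline : ∀ t : ℝ, HasDerivAt (fun t : ℝ => y + t • h) h t := fun t => by
    simpa using ((hasDerivAt_id t).smul_const h).const_add y
  have hd : ∀ t : ℝ, HasDerivAt φ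
      (inner ℝ (∇ f (y + t • h)) h - inner ℝ (∇ f y) h - L * t * ‖h‖ ^ 2) t := by
    intro t
    have h1 := (hf.differentiable (y + t • h)).hasGradientAt.hasFDerivAt.comp_hasDerivAt t (hline t)
    have h2 : HasDerivAt (fun t : ℝ => t * inner ℝ (∇ f y) h) (inner ℝ (∇ f y) h) t := by
      simpa using (hasDerivAt_id t).mul_const (inner ℝ (∇ f y) h)
    have h3 : HasDerivAt (fun t : ℝ => L / 2 * t ^ 2 * ‖h‖ ^ 2) (L * t * ‖h‖ ^ 2) t := by
      have := (((hasDerivAt_id t).pow 2).const_mul (L / 2)).mul_const (‖h‖ ^ 2)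
      refine this.congr_deriv ?_
      simp only [Nat.cast_ofNat, id_eq]
      ring
    refine ((h1.sub h2).sub h3).congr_deriv ?_
    simp
  have hanti : AntitoneOn φ (Set.Icc 0 1) := by
    refine antitoneOn_of_deriv_nonpos (convex_Icc 0 1)
      (fun t _ => (hd t).continuousAt.continuousWithinAt)
      (fun t _ => (hd t).differentiableAt.differentiableWithinAt) fun t ht => ?_
    rw [interior_Icc] at ht
    rw [(hd t).deriv, ← inner_sub_left]
    have h1 := real_inner_le_norm (∇ f (y + t • h) - ∇ f y) h
    have h2 := hf.smooth (y + t • h) y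
    rw [add_sub_cancel_left, norm_smul, Real.norm_of_nonneg ht.1.le] at h2
    nlinarith [mul_le_mul_of_nonneg_right h2 (norm_nonneg h)]
  have := hanti (Set.left_mem_Icc.2 zero_le_one) (Set.right_mem_Icc.2 zero_le_one) zero_le_one
  simp only [φ, one_smul, zero_smul, hh, add_sub_cancel, add_zero] at this
  rw [hh]
  nlinarith

/-- A gradient step of length 1/L lowers f by at least this amount, and the value reached is still
at least m. -/
theorem SmoothObjective.norm_gradient_sq_le (hf : SmoothObjective f fmax L ρ) (hL : 0 < L) {m : ℝ}
    (hm : ∀ x, m ≤ f x) (y : Vec d) : ‖∇ f y‖ ^ 2 / (2 * L) ≤ f y - m := by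
  have h1 := hf.le_quadratic y (y - (1 / L) • ∇ f y)
  have h2 := hm (y - (1 / L) • ∇ f y)
  rw [sub_sub_cancel_left, inner_neg_right, norm_neg, inner_smul_right, norm_smul,
    real_inner_self_eq_norm_sq, Real.norm_of_nonneg (by positivity)] at h1
  have h3 : ‖∇ f y‖ ^ 2 / (2 * L) =
      1 / L * ‖∇ f y‖ ^ 2 - L / 2 * (1 / L * ‖∇ f y‖) ^ 2 := by
    field_simp
    ring
  linarith

theorem SmoothObjective.continuous_gradient (hf : SmoothObjective f fmax L ρ) :
    Continuous (∇ f) := hf.differentiable_gradient.continuous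

end SmoothObjective

/-- Young's inequality that spends half of the contraction 1 - μ on the cross term. With a the
compression error and b the new gradient, it shows that errors stay of order ‖∇f‖/μ. -/
theorem one_sub_mul_add_sq_le {μ : ℝ} (hμ0 : 0 < μ) (hμ1 : μ ≤ 1) (a b : ℝ) :
    (1 - μ) * (a + b) ^ 2 ≤ (1 - μ / 2) * a ^ 2 + 2 / μ * b ^ 2 := by
  obtain ⟨b', rfl⟩ : ∃ b', b = μ * b' := ⟨b / μ, by field_simp⟩
  have h1 : 2 / μ * (μ * b') ^ 2 = 2 * μ * b' ^ 2 := by field_simp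
  have h2 := mul_nonneg (mul_nonneg (sub_nonneg.2 hμ1) hμ0.le) (sq_nonneg (a - 2 * b'))
  have h3 : 0 ≤ μ ^ 2 * a ^ 2 := by positivity
  have h4 : 0 ≤ μ ^ 2 * b' ^ 2 := by positivity
  have h5 : 0 ≤ μ * (μ ^ 2 * b' ^ 2) := by positivity
  rw [h1]
  nlinarith

/-! ### One iteration of compressed SGD and the decrease of the energy. -/

section Step

variable {d k : ℕ} {Θ : Type u} [MeasurableSpace Θ]

/-- One iteration of compressed SGD with the RandomK compressor, as a function of the state
`(x, e)` and of the innovation `(ξ, θ, S)`. -/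
def sgdStep (G : Vec d → Θ → Vec d) (η : ℝ) (s : Vec d × Vec d)
    (z : Vec d × Θ × Finset (Fin d)) : Vec d × Vec d :=
  (s.1 - η • keepCoords (s.2 + G s.1 z.2.1 + z.1) z.2.2,
    s.2 + G s.1 z.2.1 + z.1 - keepCoords (s.2 + G s.1 z.2.1 + z.1) z.2.2)

/-- The law of the innovations. -/
noncomputable def innovationLaw (d k : ℕ) (D : Measure Θ) (r : ℝ) :
    Measure (Vec d × Θ × Finset (Fin d)) :=
  (noiseLaw d r).prod (D.prod (randomKLaw d k))

/-- The iterate corrected by the accumulated compression error. -/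
def corrected (η : ℝ) (s : Vec d × Vec d) : Vec d := s.1 - η • s.2

omit [MeasurableSpace Θ] in
-- What is not sent stays in e, so the kept and dropped parts of v recombine and the compressor
-- disappears.
theorem corrected_sgdStep (G : Vec d → Θ → Vec d) (η : ℝ) (s : Vec d × Vec d)
    (z : Vec d × Θ × Finset (Fin d)) :
    corrected η (sgdStep G η s z) = corrected η s - η • (G s.1 z.2.1 + z.1) := by
  simp only [corrected, sgdStep]
  module

theorem measurable_corrected (η : ℝ) : Measurable (corrected (d := d) η) := by
  unfold corrected
  fun_prop

theorem measurable_sgdStep {G : Vec d → Θ → Vec d} (hG : Measurable (Function.uncurry G)) (η : ℝ) :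
    Measurable (Function.uncurry (sgdStep G η)) := by
  have h1 : Measurable fun p : (Vec d × Vec d) × (Vec d × Θ × Finset (Fin d)) =>
      p.1.2 + G p.1.1 p.2.2.1 + p.2.1 := by
    have : Measurable fun p : (Vec d × Vec d) × (Vec d × Θ × Finset (Fin d)) =>
      G p.1.1 p.2.2.1 := hG.comp (by fun_prop : Measurable
        fun p : (Vec d × Vec d) × (Vec d × Θ × Finset (Fin d)) => (p.1.1, p.2.2.1))
    fun_prop
  have h2 : Measurable fun p : (Vec d × Vec d) × (Vec d × Θ × Finset (Fin d)) =>
      keepCoords (p.1.2 + G p.1.1 p.2.2.1 + p.2.1) p.2.2.2 :=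
    measurable_keepCoords.comp (h1.prodMk (by fun_prop))
  exact (Measurable.sub (by fun_prop) (h2.const_smul η)).prodMk (h1.sub h2)

theorem isProbabilityMeasure_innovationLaw (hk : k ≤ d) (D : Measure Θ) [IsProbabilityMeasure D]
    (r : ℝ) : IsProbabilityMeasure (innovationLaw d k D r) := by
  have := isProbabilityMeasure_randomKLaw hk
  unfold innovationLaw
  infer_instance

theorem lintegral_innovationLaw (hk : k ≤ d) (D : Measure Θ) [IsProbabilityMeasure D] (r : ℝ)
    {h : Vec d × Θ × Finset (Fin d) → ℝ≥0∞} (hh : Measurable h) :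
    ∫⁻ z, h z ∂innovationLaw d k D r =
      ∫⁻ ξ, ∫⁻ θ, ∫⁻ S, h (ξ, θ, S) ∂randomKLaw d k ∂D ∂noiseLaw d r := by
  have := isProbabilityMeasure_randomKLaw hk
  rw [innovationLaw, lintegral_prod _ hh.aemeasurable]
  refine lintegral_congr fun ξ => ?_
  rw [lintegral_prod]
  exact (hh.comp measurable_prodMk_left).aemeasurable

variable {D : Measure Θ} [IsProbabilityMeasure D] {f : Vec d → ℝ} {G : Vec d → Θ → Vec d} {σ : ℝ}

omit [IsProbabilityMeasure D] in
theorem StochasticGradient.measurable_apply (hG : StochasticGradient D f G σ) (x : Vec d) :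
    Measurable (G x) := hG.measurable.comp measurable_prodMk_left

theorem StochasticGradient.memLp (hG : StochasticGradient D f G σ) (x : Vec d) :
    MemLp (G x) 2 D := by
  have h1 : MemLp (fun θ => G x θ - ∇ f x) 2 D :=
    (memLp_two_iff_integrable_sq_norm (by
      have := hG.measurable_apply x
      fun_prop)).2 (hG.integrable_sq x)
  have h2 : MemLp (fun θ => (G x θ - ∇ f x) + ∇ f x) 2 D := h1.add (memLp_const (∇ f x))
  simpa using h2

/-- The second moment of a vector after a noisy gradient step. -/
theorem StochasticGradient.lintegral_norm_sub_smul_sq_le (hG : StochasticGradient D f G σ)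
    (hd : 1 ≤ d) (r η : ℝ) (x A : Vec d) :
    ∫⁻ ξ, ∫⁻ θ, ENNReal.ofReal (‖A - η • (G x θ + ξ)‖ ^ 2) ∂D ∂noiseLaw d r ≤
      ENNReal.ofReal (‖A - η • ∇ f x‖ ^ 2 + η ^ 2 * (σ ^ 2 + r ^ 2)) := by
  have h1 : ∀ ξ θ, A - η • (G x θ + ξ) = A + (-η) • ξ + (-η) • G x θ := fun ξ θ => by module
  simp only [h1]
  rw [lintegral_lintegral_norm_add_sq (X := fun ξ : Vec d => (-η) • ξ)
    (Y := fun θ => (-η) • G x θ) ((memLp_noiseLaw r).const_smul (-η))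
    (by rw [integral_smul, integral_noiseLaw, smul_zero]) ((hG.memLp x).const_smul (-η))
    (m := (-η) • ∇ f x) (by rw [integral_smul, hG.unbiased])]
  refine ENNReal.ofReal_le_ofReal ?_
  simp only [← smul_sub, norm_smul, mul_pow, norm_neg, Real.norm_eq_abs, sq_abs]
  rw [integral_const_mul, integral_const_mul, integral_norm_sq_noiseLaw hd]
  have := mul_le_mul_of_nonneg_left (hG.variance_le x) (sq_nonneg η)
  rw [neg_smul, ← sub_eq_add_neg]
  linarith

/-- The second moment of the compression error after one iteration. -/
theorem StochasticGradient.lintegral_norm_error_sq_le (hG : StochasticGradient D f G σ)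
    (hd : 1 ≤ d) (hk : k ≤ d) (r η : ℝ) (s : Vec d × Vec d) :
    ∫⁻ z, ENNReal.ofReal (‖(sgdStep G η s z).2‖ ^ 2) ∂innovationLaw d k D r ≤
      ENNReal.ofReal ((1 - k / d) * (‖s.2 + ∇ f s.1‖ ^ 2 + (σ ^ 2 + r ^ 2))) := by
  have hk' : (0 : ℝ) ≤ 1 - k / d := by
    rw [sub_nonneg, div_le_one (by positivity)]
    exact_mod_cast hk
  have hm : Measurable fun z => sgdStep G η s z :=
    (measurable_sgdStep hG.measurable η).comp measurable_prodMk_left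
  have hm' : Measurable fun z => ENNReal.ofReal (‖(sgdStep G η s z).2‖ ^ 2) :=
    hm.snd.norm.pow_const 2 |>.ennreal_ofReal
  rw [lintegral_innovationLaw hk D r hm']
  simp only [sgdStep, lintegral_norm_sub_keepCoords_sq hd hk, ENNReal.ofReal_mul hk']
  have h2 := hG.lintegral_norm_sub_smul_sq_le hd r (-1) s.1 s.2
  simp only [neg_smul, one_smul, sub_neg_eq_add, ← add_assoc] at h2
  have hGm := hG.measurable_apply s.1
  have h3 : Measurable fun p : Vec d × Θ => ENNReal.ofReal (‖s.2 + G s.1 p.2 + p.1‖ ^ 2) := by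
    fun_prop
  calc ∫⁻ ξ, ∫⁻ θ, ENNReal.ofReal (1 - k / d) * ENNReal.ofReal (‖s.2 + G s.1 θ + ξ‖ ^ 2) ∂D
        ∂noiseLaw d r
      = ENNReal.ofReal (1 - k / d) *
        ∫⁻ ξ, ∫⁻ θ, ENNReal.ofReal (‖s.2 + G s.1 θ + ξ‖ ^ 2) ∂D ∂noiseLaw d r := by
        have h4 : Measurable fun ξ : Vec d =>
            ∫⁻ θ, ENNReal.ofReal (‖s.2 + G s.1 θ + ξ‖ ^ 2) ∂D := h3.lintegral_prod_right'
        rw [← lintegral_const_mul _ h4]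
        refine lintegral_congr fun ξ => ?_
        have h5 : Measurable fun θ => ENNReal.ofReal (‖s.2 + G s.1 θ + ξ‖ ^ 2) := by fun_prop
        rw [lintegral_const_mul _ h5]
    _ ≤ _ := by
        gcongr
        refine h2.trans (le_of_eq ?_)
        congr 1
        ring

/-- Integrating a function of the corrected iterate after one iteration. -/
theorem StochasticGradient.lintegral_corrected (hG : StochasticGradient D f G σ) (hk : k ≤ d)
    (r η : ℝ) (s : Vec d × Vec d) {h : Vec d → ℝ≥0∞} (hh : Measurable h) :
    ∫⁻ z, h (corrected η (sgdStep G η s z)) ∂innovationLaw d k D r =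
      ∫⁻ ξ, ∫⁻ θ, h (corrected η s - η • (G s.1 θ + ξ)) ∂D ∂noiseLaw d r := by
  have := isProbabilityMeasure_randomKLaw hk
  have hm : Measurable fun z => sgdStep G η s z :=
    (measurable_sgdStep hG.measurable η).comp measurable_prodMk_left
  have hm' : Measurable fun z => h (corrected η (sgdStep G η s z)) :=
    hh.comp ((measurable_corrected η).comp hm)
  rw [lintegral_innovationLaw hk D r hm']
  simp [corrected_sgdStep]

/-- The expected decrease of the objective at the corrected iterate. -/
theorem StochasticGradient.lintegral_objective_le (hG : StochasticGradient D f G σ)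
    {fmax L ρ : ℝ} (hf : SmoothObjective f fmax L ρ) (hL : 0 < L) (hd : 1 ≤ d) (hk : k ≤ d)
    {m : ℝ} (hm : ∀ x, m ≤ f x) (r η : ℝ) (s : Vec d × Vec d) :
    ∫⁻ z, ENNReal.ofReal (f (corrected η (sgdStep G η s z)) - m) ∂innovationLaw d k D r ≤
      ENNReal.ofReal (f (corrected η s) - m - η * inner ℝ (∇ f (corrected η s)) (∇ f s.1) +
        L / 2 * η ^ 2 * (‖∇ f s.1‖ ^ 2 + (σ ^ 2 + r ^ 2))) := by
  have hfm : Measurable f := hf.differentiable.continuous.measurable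
  rw [hG.lintegral_corrected hk r η s (h := fun y => ENNReal.ofReal (f y - m)) (by fun_prop)]
  set y := corrected η s
  set c : ℝ := f y - m - ‖∇ f y‖ ^ 2 / (2 * L) with hc
  have hc0 : 0 ≤ c := sub_nonneg.2 (hf.norm_gradient_sq_le hL hm y)
  have h1 : ∀ g : Vec d, ENNReal.ofReal (f (y - η • g) - m) ≤
      ENNReal.ofReal (L / 2) * ENNReal.ofReal (‖(1 / L) • ∇ f y - η • g‖ ^ 2) +
        ENNReal.ofReal c := by
    intro g
    rw [← ENNReal.ofReal_mul (by positivity), ← ENNReal.ofReal_add (by positivity) hc0]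
    refine ENNReal.ofReal_le_ofReal ?_
    have h2 := hf.le_quadratic y (y - η • g)
    rw [sub_sub_cancel_left, inner_neg_right, norm_neg] at h2
    rw [norm_sub_sq_real, norm_smul, Real.norm_of_nonneg (by positivity), inner_smul_left]
    have h3 : L / 2 * ((1 / L * ‖∇ f y‖) ^ 2 - 2 * ((starRingEnd ℝ) (1 / L) *
        inner ℝ (∇ f y) (η • g)) + ‖η • g‖ ^ 2) + c = f y - m - inner ℝ (∇ f y) (η • g) +
        L / 2 * ‖η • g‖ ^ 2 := by
      simp only [hc, conj_trivial]
      field_simp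
      ring
    linarith
  have hGm := hG.measurable_apply s.1
  have h4 : Measurable fun p : Vec d × Θ =>
      ENNReal.ofReal (‖(1 / L) • ∇ f y - η • (G s.1 p.2 + p.1)‖ ^ 2) := by fun_prop
  calc ∫⁻ ξ, ∫⁻ θ, ENNReal.ofReal (f (y - η • (G s.1 θ + ξ)) - m) ∂D ∂noiseLaw d r
      ≤ ∫⁻ ξ, ∫⁻ θ, (ENNReal.ofReal (L / 2) *
          ENNReal.ofReal (‖(1 / L) • ∇ f y - η • (G s.1 θ + ξ)‖ ^ 2) + ENNReal.ofReal c) ∂D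
          ∂noiseLaw d r := lintegral_mono fun ξ => lintegral_mono fun θ => h1 _
    _ = ENNReal.ofReal (L / 2) * ∫⁻ ξ, ∫⁻ θ,
          ENNReal.ofReal (‖(1 / L) • ∇ f y - η • (G s.1 θ + ξ)‖ ^ 2) ∂D ∂noiseLaw d r +
          ENNReal.ofReal c := by
        have h7 : Measurable fun ξ : Vec d => ∫⁻ θ,
            ENNReal.ofReal (‖(1 / L) • ∇ f y - η • (G s.1 θ + ξ)‖ ^ 2) ∂D :=
          h4.lintegral_prod_right'
        rw [← lintegral_const_mul _ h7]
        have h5 : ∀ ξ, ∫⁻ θ, (ENNReal.ofReal (L / 2) *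
            ENNReal.ofReal (‖(1 / L) • ∇ f y - η • (G s.1 θ + ξ)‖ ^ 2) + ENNReal.ofReal c) ∂D =
            ENNReal.ofReal (L / 2) * ∫⁻ θ,
              ENNReal.ofReal (‖(1 / L) • ∇ f y - η • (G s.1 θ + ξ)‖ ^ 2) ∂D +
              ENNReal.ofReal c := fun ξ => by
          have h6 : Measurable fun θ =>
            ENNReal.ofReal (‖(1 / L) • ∇ f y - η • (G s.1 θ + ξ)‖ ^ 2) := by fun_prop
          rw [lintegral_add_right _ measurable_const, lintegral_const_mul _ h6]
          simp
        simp only [h5]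
        rw [lintegral_add_right _ measurable_const]
        simp
    _ ≤ ENNReal.ofReal (L / 2) * ENNReal.ofReal (‖(1 / L) • ∇ f y - η • ∇ f s.1‖ ^ 2 +
          η ^ 2 * (σ ^ 2 + r ^ 2)) + ENNReal.ofReal c := by
        gcongr
        exact hG.lintegral_norm_sub_smul_sq_le hd r η s.1 _
    _ = _ := by
        rw [← ENNReal.ofReal_mul (by positivity), ← ENNReal.ofReal_add (by positivity) hc0]
        congr 1
        rw [norm_sub_sq_real, norm_smul, Real.norm_of_nonneg (by positivity), inner_smul_left,
          inner_smul_right, norm_smul, mul_pow ‖η‖, Real.norm_eq_abs, sq_abs]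
        simp only [hc, conj_trivial]
        field_simp
        ring

/-- The Lyapunov inequality for the objective and the compression error. -/
theorem StochasticGradient.markovOp_objective_le (hG : StochasticGradient D f G σ)
    {fmax L ρ : ℝ} (hf : SmoothObjective f fmax L ρ) (hL : 0 < L) (hd : 1 ≤ d) (hk : k ≤ d)
    {m : ℝ} (hm : ∀ x, m ≤ f x) (r : ℝ) {η μ : ℝ} (hη : 0 < η) (hμ : μ = k / d) (hμ0 : 0 < μ)
    (hημ : η * L ≤ μ / 8) (s : Vec d × Vec d) :
    markovOp (innovationLaw d k D r) (sgdStep G η)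
        (fun s => ENNReal.ofReal (f (corrected η s) - m) +
          ENNReal.ofReal (2 * η ^ 3 * L ^ 2 / μ) * ENNReal.ofReal (‖s.2‖ ^ 2)) s +
      ENNReal.ofReal (η / 4 * ‖∇ f s.1‖ ^ 2 + η ^ 3 * L ^ 2 / 2 * ‖s.2‖ ^ 2) ≤
      (ENNReal.ofReal (f (corrected η s) - m) +
          ENNReal.ofReal (2 * η ^ 3 * L ^ 2 / μ) * ENNReal.ofReal (‖s.2‖ ^ 2)) +
        ENNReal.ofReal (L * η ^ 2 * (σ ^ 2 + r ^ 2)) := by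
  have hμ1 : μ ≤ 1 := by
    rw [hμ, div_le_one (by positivity)]
    exact_mod_cast hk
  have hstep : Measurable fun z => sgdStep G η s z :=
    (measurable_sgdStep hG.measurable η).comp measurable_prodMk_left
  have hfm : Measurable f := hf.differentiable.continuous.measurable
  have hstep1 : Measurable fun z => ENNReal.ofReal (f (corrected η (sgdStep G η s z)) - m) :=
    ((hfm.comp ((measurable_corrected η).comp hstep)).sub_const m).ennreal_ofReal
  have hstep2 : Measurable fun z => ENNReal.ofReal (‖(sgdStep G η s z).2‖ ^ 2) :=
    (hstep.snd.norm.pow_const 2).ennreal_ofReal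
  -- The weight is chosen so that c μ/2 = η³L². One half of this pays for the gap between the
  -- gradients at x and at y = x - ηe, the other half is the claimed decrease in ‖e‖².
  set c : ℝ := 2 * η ^ 3 * L ^ 2 / μ with hc
  have hc0 : 0 ≤ c := by positivity
  unfold markovOp
  rw [lintegral_add_left hstep1, lintegral_const_mul _ hstep2]
  have h1 := hG.lintegral_objective_le hf hL hd hk hm r η s
  have h2 := hG.lintegral_norm_error_sq_le hd hk r η s
  rw [← hμ] at h2
  set y := corrected η s with hy
  set n := σ ^ 2 + r ^ 2 with hn
  have hn0 : 0 ≤ n := by positivity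
  refine (add_le_add_left (add_le_add h1 (mul_le_mul_right h2 _)) _).trans ?_
  have hin : 2 * inner ℝ (∇ f y) (∇ f s.1) = ‖∇ f y‖ ^ 2 + ‖∇ f s.1‖ ^ 2 -
      ‖∇ f s.1 - ∇ f y‖ ^ 2 := by
    rw [norm_sub_sq_real, real_inner_comm]
    ring
  have hgap : ‖∇ f s.1 - ∇ f y‖ ^ 2 ≤ L ^ 2 * η ^ 2 * ‖s.2‖ ^ 2 := by
    have h3 := hf.smooth s.1 y
    have h4 : s.1 - y = η • s.2 := by simp [hy, corrected]
    rw [h4, norm_smul, Real.norm_of_nonneg hη.le] at h3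
    calc ‖∇ f s.1 - ∇ f y‖ ^ 2 ≤ (L * (η * ‖s.2‖)) ^ 2 := by gcongr
      _ = _ := by ring
  have hquad : (1 - μ) * ‖s.2 + ∇ f s.1‖ ^ 2 ≤
      (1 - μ / 2) * ‖s.2‖ ^ 2 + 2 / μ * ‖∇ f s.1‖ ^ 2 := by
    have h5 : ‖s.2 + ∇ f s.1‖ ^ 2 ≤ (‖s.2‖ + ‖∇ f s.1‖) ^ 2 := by
      gcongr
      exact norm_add_le _ _
    exact (mul_le_mul_of_nonneg_left h5 (sub_nonneg.2 hμ1)).trans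
      (one_sub_mul_add_sq_le hμ0 hμ1 _ _)
  have hcn : c ≤ L * η ^ 2 / 2 := by
    rw [hc, div_le_iff₀ hμ0]
    have h8 := mul_le_mul_of_nonneg_left hημ (by positivity : 0 ≤ η ^ 2 * L)
    have h9 : 0 ≤ η ^ 2 * L * μ := by positivity
    linarith
  have hcμ : c * (μ / 2) = η ^ 3 * L ^ 2 := by
    rw [hc]
    field_simp
  have hcg : c * (2 / μ) ≤ η / 16 := by
    have h9 : c * (2 / μ) = 4 * η * (η * L / μ) ^ 2 := by
      rw [hc]
      field_simp
      ring
    have h10 : η * L / μ ≤ 1 / 8 := by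
      rw [div_le_iff₀ hμ0]
      linarith
    have h11 : (η * L / μ) ^ 2 ≤ (1 / 8) ^ 2 := by gcongr
    rw [h9]
    nlinarith
  have hηL : L * η ^ 2 ≤ η / 8 := by nlinarith
  have hfy := hf.norm_gradient_sq_le hL hm y
  have hfy0 : 0 ≤ f y - m := sub_nonneg.2 (hm y)
  have key : f y - m - η * inner ℝ (∇ f y) (∇ f s.1) + L / 2 * η ^ 2 * (‖∇ f s.1‖ ^ 2 + n) +
      c * ((1 - μ) * (‖s.2 + ∇ f s.1‖ ^ 2 + n)) +
      (η / 4 * ‖∇ f s.1‖ ^ 2 + η ^ 3 * L ^ 2 / 2 * ‖s.2‖ ^ 2) ≤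
      f y - m + c * ‖s.2‖ ^ 2 + L * η ^ 2 * n := by
    have k1 := mul_le_mul_of_nonneg_left hquad hc0
    have k2 : c * (1 - μ) * n ≤ L * η ^ 2 / 2 * n := by
      gcongr
      nlinarith
    have k3 : η / 2 * ‖∇ f s.1 - ∇ f y‖ ^ 2 ≤ η / 2 * (L ^ 2 * η ^ 2 * ‖s.2‖ ^ 2) := by gcongr
    have k4 := mul_le_mul_of_nonneg_right hcg (sq_nonneg ‖∇ f s.1‖)
    have k5 := mul_le_mul_of_nonneg_right hηL (sq_nonneg ‖∇ f s.1‖)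
    have k6 : c * (μ / 2) * ‖s.2‖ ^ 2 = η ^ 3 * L ^ 2 * ‖s.2‖ ^ 2 := by rw [hcμ]
    have k7 : 0 ≤ η * ‖∇ f y‖ ^ 2 := by positivity
    have k8 : 0 ≤ η * ‖∇ f s.1‖ ^ 2 := by positivity
    have k9 : η * inner ℝ (∇ f y) (∇ f s.1) = η / 2 * (‖∇ f y‖ ^ 2 + ‖∇ f s.1‖ ^ 2 -
      ‖∇ f s.1 - ∇ f y‖ ^ 2) := by rw [← hin]; ring
    rw [k9]
    linarith
  -- Terms under `ENNReal.ofReal` can be merged only if they are nonnegative. Here the square is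
  -- completed again, using the bound `hfy` for the squared gradient at y.
  have hA : 0 ≤ f y - m - η * inner ℝ (∇ f y) (∇ f s.1) +
      L / 2 * η ^ 2 * (‖∇ f s.1‖ ^ 2 + n) := by
    have h12 : ‖∇ f y‖ ^ 2 / (2 * L) - η * inner ℝ (∇ f y) (∇ f s.1) +
        L / 2 * η ^ 2 * ‖∇ f s.1‖ ^ 2 = L / 2 * ‖(1 / L) • ∇ f y - η • ∇ f s.1‖ ^ 2 := by
      rw [norm_sub_sq_real, norm_smul, Real.norm_of_nonneg (by positivity), inner_smul_left,
        inner_smul_right, norm_smul, mul_pow ‖η‖, Real.norm_eq_abs, sq_abs]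
      simp only [conj_trivial]
      field_simp
    have h13 : 0 ≤ L / 2 * ‖(1 / L) • ∇ f y - η • ∇ f s.1‖ ^ 2 := by positivity
    have h14 : 0 ≤ L / 2 * η ^ 2 * n := by positivity
    linarith
  have hB : 0 ≤ (1 - μ) * (‖s.2 + ∇ f s.1‖ ^ 2 + n) :=
    mul_nonneg (sub_nonneg.2 hμ1) (by positivity)
  rw [← ENNReal.ofReal_mul hc0, ← ENNReal.ofReal_mul hc0,
    ← ENNReal.ofReal_add hA (mul_nonneg hc0 hB),
    ← ENNReal.ofReal_add (add_nonneg hA (mul_nonneg hc0 hB)) (by positivity),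
    ← ENNReal.ofReal_add hfy0 (by positivity), ← ENNReal.ofReal_add (by positivity) (by positivity)]
  exact ENNReal.ofReal_le_ofReal key

/-- The sum of the squared gradients and compression errors along compressed SGD. -/
theorem StochasticGradient.sum_gradient_sq_add_error_sq_le (hG : StochasticGradient D f G σ)
    {fmax L ρ : ℝ} (hf : SmoothObjective f fmax L ρ) (hL : 0 < L) (hd : 1 ≤ d) (hk : k ≤ d)
    (r : ℝ) {η μ : ℝ} (hη : 0 < η) (hμ : μ = k / d) (hμ0 : 0 < μ)
    (hημ : η * L ≤ μ / 8) (x₀ : Vec d) (n : ℕ) :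
    ∑ t ∈ Finset.range n, (markovOp (innovationLaw d k D r) (sgdStep G η))^[t]
        (fun s => ENNReal.ofReal (η / 4 * ‖∇ f s.1‖ ^ 2 + η ^ 3 * L ^ 2 / 2 * ‖s.2‖ ^ 2)) (x₀, 0) ≤
      ENNReal.ofReal (fmax + n * (L * η ^ 2 * (σ ^ 2 + r ^ 2))) := by
  have := isProbabilityMeasure_innovationLaw hk D r
  have hfm : Measurable f := hf.differentiable.continuous.measurable
  -- With this lower bound and e₀ = 0 the Lyapunov function starts exactly at `fmax`.
  have hm : ∀ x, f x₀ - fmax ≤ f x := fun x => by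
    have := (abs_le.1 (hf.bounded x₀ x)).2
    linarith
  have hV : Measurable fun s : Vec d × Vec d =>
      ENNReal.ofReal (f (corrected η s) - (f x₀ - fmax)) +
          ENNReal.ofReal (2 * η ^ 3 * L ^ 2 / μ) * ENNReal.ofReal (‖s.2‖ ^ 2) := by
    have h1 := hfm.comp (measurable_corrected (d := d) η)
    exact ((h1.sub_const _).ennreal_ofReal).add
      ((measurable_snd.norm.pow_const 2).ennreal_ofReal.const_mul _)
  have h1 := sum_markovOp_iterate_le (measurable_sgdStep hG.measurable η) hV
    (hG.markovOp_objective_le hf hL hd hk hm r hη hμ hμ0 hημ) n (x₀, 0)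
  refine (le_self_add.trans h1).trans (le_of_eq ?_)
  have hfmax : 0 ≤ fmax := (abs_nonneg _).trans (hf.bounded x₀ x₀)
  rw [ENNReal.ofReal_add hfmax (by positivity), ENNReal.ofReal_mul (Nat.cast_nonneg n),
    ENNReal.ofReal_natCast]
  simp [corrected]

end Step

/-! ### Upper bounds for the displacement over a block. -/

section Displacement

variable {d k : ℕ} {Θ : Type u} [MeasurableSpace Θ] {D : Measure Θ} [IsProbabilityMeasure D]
  {f : Vec d → ℝ} {G : Vec d → Θ → Vec d} {σ : ℝ}

/-- Young's inequality with weight 1/I can be applied at each of the I steps of a block at the cost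
of a constant factor. -/
theorem one_add_inv_pow_le_three {I i : ℕ} (hI : 1 ≤ I) (hi : i ≤ I) :
    (1 + 1 / (I : ℝ)) ^ i ≤ 3 := by
  have hI' : (0 : ℝ) < I := by exact_mod_cast hI
  calc (1 + 1 / (I : ℝ)) ^ i ≤ (Real.exp (1 / I)) ^ i := by
        gcongr
        rw [add_comm]
        exact Real.add_one_le_exp _
    _ = Real.exp (i / I) := by rw [← Real.exp_nat_mul]; congr 1; ring
    _ ≤ Real.exp 1 := by
        gcongr
        rw [div_le_one hI']
        exact_mod_cast hi
    _ ≤ 3 := Real.exp_one_lt_three.le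

/-- The mean squared displacement of compressed SGD over a block of `I` iterations started
at `s`: the average over the block for the iterate, and the final value for the corrected
iterate. -/
noncomputable def blockDisplacement (ν : Measure (Vec d × Θ × Finset (Fin d)))
    (G : Vec d → Θ → Vec d) (η : ℝ) (I : ℕ) (s : Vec d × Vec d) : ℝ≥0∞ :=
  (I : ℝ≥0∞)⁻¹ * ∑ i ∈ Finset.range I,
      (markovOp ν (sgdStep G η))^[i] (fun s' => ENNReal.ofReal (‖s'.1 - s.1‖ ^ 2)) s +
    (markovOp ν (sgdStep G η))^[I]
      (fun s' => ENNReal.ofReal (‖corrected η s' - corrected η s‖ ^ 2)) s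

/-- An upper bound for the mean squared displacement over a block, in terms of gradients and
compression errors. -/
noncomputable def blockBound (ν : Measure (Vec d × Θ × Finset (Fin d))) (f : Vec d → ℝ)
    (G : Vec d → Θ → Vec d) (η n : ℝ) (I : ℕ) (s : Vec d × Vec d) : ℝ≥0∞ :=
  ∑ j ∈ Finset.range I, (markovOp ν (sgdStep G η))^[j] (fun s' =>
      ENNReal.ofReal (3 / I * η ^ 2 * ‖s'.2‖ ^ 2 + 12 * (1 + I) * η ^ 2 * ‖∇ f s'.1‖ ^ 2)) s +
    (ENNReal.ofReal (3 * η ^ 2 * ‖s.2‖ ^ 2) + ENNReal.ofReal (12 * I * η ^ 2 * n))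

/-- The centred noise only adds its variance at each step. The drift η∇f(x) is split off by Young's
inequality with weight 1/I, whose accumulated factor is at most 3. -/
theorem StochasticGradient.displacement_le (hG : StochasticGradient D f G σ)
    (hd : 1 ≤ d) (hk : k ≤ d) (r η : ℝ) {I i : ℕ} (hI : 1 ≤ I)
    (hi : i ≤ I) (s : Vec d × Vec d) :
    (markovOp (innovationLaw d k D r) (sgdStep G η))^[i]
        (fun s' => ENNReal.ofReal (‖corrected η s' - corrected η s‖ ^ 2)) s ≤
      3 * ∑ j ∈ Finset.range I, (markovOp (innovationLaw d k D r) (sgdStep G η))^[j]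
        (fun s' => ENNReal.ofReal ((1 + I) * η ^ 2 * ‖∇ f s'.1‖ ^ 2 +
          η ^ 2 * (σ ^ 2 + r ^ 2))) s := by
  have := isProbabilityMeasure_innovationLaw hk D r
  have hI' : (0 : ℝ) < I := by exact_mod_cast hI
  set n := σ ^ 2 + r ^ 2 with hn
  set y₀ := corrected η s with hy₀
  set V : Vec d × Vec d → ℝ≥0∞ := fun s' => ENNReal.ofReal (‖corrected η s' - y₀‖ ^ 2) with hV
  set c : Vec d × Vec d → ℝ≥0∞ := fun s' =>
    ENNReal.ofReal ((1 + I) * η ^ 2 * ‖∇ f s'.1‖ ^ 2 + η ^ 2 * n) with hc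
  set a : ℝ≥0∞ := ENNReal.ofReal (1 + 1 / I) with ha
  have hVm : Measurable V := by
    have := measurable_corrected (d := d) η
    fun_prop
  have hstep : ∀ s', markovOp (innovationLaw d k D r) (sgdStep G η) V s' ≤ a * V s' + c s' := by
    intro s'
    unfold markovOp
    rw [hG.lintegral_corrected hk r η s' (h := fun y => ENNReal.ofReal (‖y - y₀‖ ^ 2))
      (by fun_prop)]
    have h1 := hG.lintegral_norm_sub_smul_sq_le hd r η s'.1 (corrected η s' - y₀)
    have h2 : ∀ ξ θ, corrected η s' - η • (G s'.1 θ + ξ) - y₀ =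
        corrected η s' - y₀ - η • (G s'.1 θ + ξ) := fun ξ θ => by abel
    simp only [h2]
    refine h1.trans ?_
    rw [ha, hV, hc, ← ENNReal.ofReal_mul (by positivity),
      ← ENNReal.ofReal_add (by positivity) (by positivity)]
    refine ENNReal.ofReal_le_ofReal ?_
    set p := corrected η s' - y₀
    have h3 : ‖p - η • ∇ f s'.1‖ ^ 2 ≤ (‖p‖ + |η| * ‖∇ f s'.1‖) ^ 2 := by
      gcongr
      refine (norm_sub_le _ _).trans ?_
      rw [norm_smul, Real.norm_eq_abs]
    have h4 : (‖p‖ + |η| * ‖∇ f s'.1‖) ^ 2 ≤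
        (1 + 1 / I) * ‖p‖ ^ 2 + (1 + I) * η ^ 2 * ‖∇ f s'.1‖ ^ 2 := by
      have h5 : 0 ≤ I * (|η| * ‖∇ f s'.1‖ - ‖p‖ / I) ^ 2 := by positivity
      have h6 : I * (|η| * ‖∇ f s'.1‖ - ‖p‖ / I) ^ 2 = I * η ^ 2 * ‖∇ f s'.1‖ ^ 2 -
          2 * (|η| * ‖∇ f s'.1‖ * ‖p‖) + 1 / I * ‖p‖ ^ 2 := by
        rw [← sq_abs η]
        field_simp
        ring
      have h7 := sq_abs η
      have h8 : (|η| * ‖∇ f s'.1‖) ^ 2 = η ^ 2 * ‖∇ f s'.1‖ ^ 2 := by rw [mul_pow, h7]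
      nlinarith
    linarith
  have hind : ∀ m, (markovOp (innovationLaw d k D r) (sgdStep G η))^[m] V s ≤
      a ^ m * ∑ j ∈ Finset.range m, (markovOp (innovationLaw d k D r) (sgdStep G η))^[j] c s := by
    intro m
    induction m with
    | zero => simp [hV, hy₀]
    | succ m ih =>
      have ha1 : 1 ≤ a ^ (m + 1) := by
        refine one_le_pow₀ ?_
        rw [ha, ← ENNReal.ofReal_one]
        exact ENNReal.ofReal_le_ofReal (by linarith [one_div_pos.2 hI'])
      refine (markovOp_iterate_succ_le (measurable_sgdStep hG.measurable η) hVm hstep m s).trans ?_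
      rw [Finset.sum_range_succ, mul_add, pow_succ' a, mul_assoc a, ← pow_succ' a]
      refine add_le_add (mul_le_mul_right ih a) ?_
      exact le_mul_of_one_le_left' ha1
  refine (hind i).trans (mul_le_mul' ?_ ?_)
  · rw [ha, ← ENNReal.ofReal_pow (by positivity)]
    exact (ENNReal.ofReal_le_ofReal (one_add_inv_pow_le_three hI hi)).trans (by simp)
  · exact Finset.sum_le_sum_of_subset (Finset.range_mono hi)

/-- The displacement of x is that of y plus ηe' - ηe, with e' and e the current and initial errors;
squaring the three terms costs a factor 3. With the factor 3 of `displacement_le`, the average over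
the block contributes 9 and the final value 3, whence the constant 12. -/
theorem StochasticGradient.blockDisplacement_le (hG : StochasticGradient D f G σ)
    (hf : Measurable (∇ f)) (hd : 1 ≤ d) (hk : k ≤ d) (r η : ℝ) {I : ℕ} (hI : 1 ≤ I)
    (s : Vec d × Vec d) :
    blockDisplacement (innovationLaw d k D r) G η I s ≤
      blockBound (innovationLaw d k D r) f G η (σ ^ 2 + r ^ 2) I s := by
  have := isProbabilityMeasure_innovationLaw hk D r
  have hI' : (0 : ℝ) < I := by exact_mod_cast hI
  have hI0 : (I : ℝ≥0∞) ≠ 0 := by exact_mod_cast (by omega : I ≠ 0)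
  have hΦ := measurable_sgdStep hG.measurable η
  set n := σ ^ 2 + r ^ 2 with hn
  set Q := markovOp (innovationLaw d k D r) (sgdStep G η) with hQ
  set C : ℝ≥0∞ := ∑ j ∈ Finset.range I, Q^[j]
        (fun s' => ENNReal.ofReal ((1 + I) * η ^ 2 * ‖∇ f s'.1‖ ^ 2 + η ^ 2 * n)) s with hC
  have hm1 : Measurable fun s' : Vec d × Vec d =>
      ENNReal.ofReal (‖corrected η s' - corrected η s‖ ^ 2) := by
    have := measurable_corrected (d := d) η
    fun_prop
  have hm2 : Measurable fun s' : Vec d × Vec d => ENNReal.ofReal (η ^ 2 * ‖s'.2‖ ^ 2) := by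
    fun_prop
  have hm3 : Measurable fun s' : Vec d × Vec d => ENNReal.ofReal (‖∇ f s'.1‖ ^ 2) := by
    fun_prop
  have hpt : ∀ i ∈ Finset.range I, Q^[i] (fun s' => ENNReal.ofReal (‖s'.1 - s.1‖ ^ 2)) s ≤
      3 * (3 * C) + (3 * Q^[i] (fun s' => ENNReal.ofReal (η ^ 2 * ‖s'.2‖ ^ 2)) s +
        ENNReal.ofReal (3 * η ^ 2 * ‖s.2‖ ^ 2)) := by
    intro i hi
    have h1 : ∀ s' : Vec d × Vec d, ENNReal.ofReal (‖s'.1 - s.1‖ ^ 2) ≤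
        3 * ENNReal.ofReal (‖corrected η s' - corrected η s‖ ^ 2) +
          (3 * ENNReal.ofReal (η ^ 2 * ‖s'.2‖ ^ 2) + ENNReal.ofReal (3 * η ^ 2 * ‖s.2‖ ^ 2)) := by
      intro s'
      have h3 : (3 : ℝ≥0∞) = ENNReal.ofReal 3 := by simp
      rw [h3, ← ENNReal.ofReal_mul (by positivity), ← ENNReal.ofReal_mul (by positivity),
        ← ENNReal.ofReal_add (by positivity) (by positivity),
        ← ENNReal.ofReal_add (by positivity) (by positivity)]
      refine ENNReal.ofReal_le_ofReal ?_
      have h4 : s'.1 - s.1 = (corrected η s' - corrected η s) + η • s'.2 - η • s.2 := by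
        simp only [corrected]
        module
      have h5 : ‖s'.1 - s.1‖ ≤ ‖corrected η s' - corrected η s‖ + |η| * ‖s'.2‖ + |η| * ‖s.2‖ := by
        rw [h4]
        refine (norm_sub_le _ _).trans ?_
        rw [norm_smul η s.2, Real.norm_eq_abs]
        gcongr
        refine (norm_add_le _ _).trans ?_
        rw [norm_smul, Real.norm_eq_abs]
      have h6 : ‖s'.1 - s.1‖ ^ 2 ≤
          (‖corrected η s' - corrected η s‖ + |η| * ‖s'.2‖ + |η| * ‖s.2‖) ^ 2 := by gcongr
      rw [← sq_abs η]
      set p := ‖corrected η s' - corrected η s‖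
      set q := |η| * ‖s'.2‖ with hq
      set w := |η| * ‖s.2‖ with hw
      have h7 : |η| ^ 2 * ‖s'.2‖ ^ 2 = q ^ 2 := by rw [hq]; ring
      have h8 : 3 * |η| ^ 2 * ‖s.2‖ ^ 2 = 3 * w ^ 2 := by rw [hw]; ring
      rw [h7, h8]
      linarith [sq_nonneg (p - q), sq_nonneg (p - w), sq_nonneg (q - w)]
    refine (markovOp_iterate_mono h1 i s).trans ?_
    rw [markovOp_iterate_add hΦ (hm1.const_mul 3), markovOp_iterate_add hΦ (hm2.const_mul 3),
      markovOp_iterate_const, markovOp_iterate_const_mul hΦ hm1,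
      markovOp_iterate_const_mul hΦ hm2]
    gcongr
    exact hG.displacement_le hd hk r η hI (Finset.mem_range.1 hi).le s
  have hfin := hG.displacement_le hd hk r η hI le_rfl s
  rw [← hn, ← hC] at hfin
  have hC' : C = ∑ j ∈ Finset.range I, ENNReal.ofReal ((1 + I) * η ^ 2) *
      Q^[j] (fun s' => ENNReal.ofReal (‖∇ f s'.1‖ ^ 2)) s + ENNReal.ofReal (I * η ^ 2 * n) := by
    have h9 : ∀ j, Q^[j]
        (fun s' => ENNReal.ofReal ((1 + I) * η ^ 2 * ‖∇ f s'.1‖ ^ 2 + η ^ 2 * n)) s =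
        ENNReal.ofReal ((1 + I) * η ^ 2) * Q^[j] (fun s' => ENNReal.ofReal (‖∇ f s'.1‖ ^ 2)) s +
        ENNReal.ofReal (η ^ 2 * n) := by
      intro j
      rw [← markovOp_iterate_const_mul hΦ hm3]
      conv_rhs => rw [← markovOp_iterate_const (ν := innovationLaw d k D r) (Φ := sgdStep G η)
        (ENNReal.ofReal (η ^ 2 * n)) j s]
      rw [← markovOp_iterate_add hΦ (hm3.const_mul _)]
      refine congrFun (congrArg _ (funext fun s' => ?_)) _
      rw [← ENNReal.ofReal_mul (by positivity),
        ← ENNReal.ofReal_add (by positivity) (by positivity)]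
    rw [hC]
    simp only [h9]
    rw [Finset.sum_add_distrib, Finset.sum_const, Finset.card_range, nsmul_eq_mul,
      ← ENNReal.ofReal_natCast, ← ENNReal.ofReal_mul (by positivity), mul_assoc]
  clear_value C
  have h10 : ∀ j, Q^[j] (fun s' =>
      ENNReal.ofReal (3 / I * η ^ 2 * ‖s'.2‖ ^ 2 + 12 * (1 + I) * η ^ 2 * ‖∇ f s'.1‖ ^ 2)) s =
      (I : ℝ≥0∞)⁻¹ * (3 * Q^[j] (fun s' => ENNReal.ofReal (η ^ 2 * ‖s'.2‖ ^ 2)) s) +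
      12 * (ENNReal.ofReal ((1 + I) * η ^ 2) *
        Q^[j] (fun s' => ENNReal.ofReal (‖∇ f s'.1‖ ^ 2)) s) := by
    intro j
    rw [← markovOp_iterate_const_mul hΦ hm3, ← markovOp_iterate_const_mul hΦ hm2,
      ← markovOp_iterate_const_mul hΦ (hm3.const_mul _),
      ← markovOp_iterate_const_mul hΦ (hm2.const_mul _),
      ← markovOp_iterate_add hΦ ((hm2.const_mul _).const_mul _)]
    refine congrFun (congrArg _ (funext fun s' => ?_)) _
    have h3 : (3 : ℝ≥0∞) = ENNReal.ofReal 3 := by simp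
    have h12 : (12 : ℝ≥0∞) = ENNReal.ofReal 12 := by simp
    rw [h3, h12, ← ENNReal.ofReal_natCast I, ← ENNReal.ofReal_inv_of_pos hI',
      ← ENNReal.ofReal_mul (by positivity), ← ENNReal.ofReal_mul (by positivity),
      ← ENNReal.ofReal_mul (by positivity), ← ENNReal.ofReal_mul (by positivity),
      ← ENNReal.ofReal_add (by positivity) (by positivity)]
    congr 1
    field_simp
  unfold blockDisplacement blockBound
  simp only [← hQ, h10]
  have h11 : (I : ℝ≥0∞)⁻¹ * ∑ i ∈ Finset.range I,
      Q^[i] (fun s' => ENNReal.ofReal (‖s'.1 - s.1‖ ^ 2)) s ≤ 9 * C +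
      (∑ i ∈ Finset.range I, (I : ℝ≥0∞)⁻¹ *
        (3 * Q^[i] (fun s' => ENNReal.ofReal (η ^ 2 * ‖s'.2‖ ^ 2)) s) +
        ENNReal.ofReal (3 * η ^ 2 * ‖s.2‖ ^ 2)) := by
    refine (mul_le_mul_right (Finset.sum_le_sum hpt) _).trans (le_of_eq ?_)
    rw [Finset.sum_add_distrib, Finset.sum_add_distrib, Finset.sum_const, Finset.sum_const,
      Finset.card_range, nsmul_eq_mul, nsmul_eq_mul, mul_add, mul_add, ← mul_assoc,
      ENNReal.inv_mul_cancel hI0 (ENNReal.natCast_ne_top I), one_mul, ← mul_assoc (I : ℝ≥0∞)⁻¹,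
      ENNReal.inv_mul_cancel hI0 (ENNReal.natCast_ne_top I), one_mul, Finset.mul_sum,
      ← mul_assoc]
    norm_num
  refine (add_le_add h11 hfin).trans (le_of_eq ?_)
  have h13 : (12 : ℝ≥0∞) * C = ∑ j ∈ Finset.range I, 12 * (ENNReal.ofReal ((1 + I) * η ^ 2) *
      Q^[j] (fun s' => ENNReal.ofReal (‖∇ f s'.1‖ ^ 2)) s) +
      ENNReal.ofReal (12 * I * η ^ 2 * n) := by
    have h12 : (12 : ℝ≥0∞) = ENNReal.ofReal 12 := by simp
    rw [hC', mul_add, Finset.mul_sum]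
    congr 1
    rw [h12, ← ENNReal.ofReal_mul (by positivity)]
    congr 1
    ring
  rw [Finset.sum_add_distrib]
  calc _ = 12 * C + (∑ i ∈ Finset.range I, (I : ℝ≥0∞)⁻¹ *
        (3 * Q^[i] (fun s' => ENNReal.ofReal (η ^ 2 * ‖s'.2‖ ^ 2)) s) +
        ENNReal.ofReal (3 * η ^ 2 * ‖s.2‖ ^ 2)) := by ring
    _ = _ := by rw [h13]; ring

/-- The sum over `T` starting times of the bound for the displacement over a block. -/
theorem StochasticGradient.sum_blockBound_le (hG : StochasticGradient D f G σ)
    {fmax L ρ : ℝ} (hf : SmoothObjective f fmax L ρ) (hL : 0 < L) (hd : 1 ≤ d) (hk : k ≤ d)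
    (r : ℝ) {η μ : ℝ} (hη : 0 < η) (hμ : μ = k / d) (hμ0 : 0 < μ)
    (hημ : η * L ≤ μ / 8) (x₀ : Vec d) {I : ℕ} (hI : 1 ≤ I) (T : ℕ) :
    ∑ t ∈ Finset.range T, (markovOp (innovationLaw d k D r) (sgdStep G η))^[t]
        (blockBound (innovationLaw d k D r) f G η (σ ^ 2 + r ^ 2) I) (x₀, 0) ≤
      ENNReal.ofReal ((12 / (η * L ^ 2) + 96 * I ^ 2 * η) *
        (fmax + (T + I) * (L * η ^ 2 * (σ ^ 2 + r ^ 2))) +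
        T * (12 * I * η ^ 2 * (σ ^ 2 + r ^ 2))) := by
  have := isProbabilityMeasure_innovationLaw hk D r
  have hI' : (1 : ℝ) ≤ I := by exact_mod_cast hI
  have hΦ := measurable_sgdStep hG.measurable η
  have hgm : Measurable (∇ f) := hf.continuous_gradient.measurable
  have hfmax : 0 ≤ fmax := (abs_nonneg _).trans (hf.bounded x₀ x₀)
  set n := σ ^ 2 + r ^ 2 with hn
  have hn0 : 0 ≤ n := by positivity
  set Q := markovOp (innovationLaw d k D r) (sgdStep G η) with hQ
  set H : Vec d × Vec d → ℝ≥0∞ := fun s =>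
    ENNReal.ofReal (η / 4 * ‖∇ f s.1‖ ^ 2 + η ^ 3 * L ^ 2 / 2 * ‖s.2‖ ^ 2) with hH
  have hHm : Measurable H := by fun_prop
  -- These constants make κ₁H and κ₂H dominate the terms of `blockBound`: the part 6/(IηL²) covers
  -- the errors inside the block, 96Iη the gradients (as 24I ≥ 12(1 + I)), and κ₂ the initial error.
  set κ₁ : ℝ := 6 / (I * (η * L ^ 2)) + 96 * I * η with hκ₁
  set κ₂ : ℝ := 6 / (η * L ^ 2) with hκ₂
  have hκ₁0 : 0 ≤ κ₁ := by positivity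
  have hκ₂0 : 0 ≤ κ₂ := by positivity
  set B : ℝ := fmax + (T + I) * (L * η ^ 2 * n) with hB
  have hB0 : 0 ≤ B := by positivity
  have hpt : ∀ s, blockBound (innovationLaw d k D r) f G η n I s ≤
      (∑ j ∈ Finset.range I, ENNReal.ofReal κ₁ * Q^[j] H s) +
        (ENNReal.ofReal κ₂ * H s + ENNReal.ofReal (12 * I * η ^ 2 * n)) := by
    intro s
    unfold blockBound
    refine add_le_add (Finset.sum_le_sum fun j _ => ?_) (add_le_add_left ?_ _)
    · rw [← markovOp_iterate_const_mul hΦ hHm]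
      refine markovOp_iterate_mono (fun s' => ?_) j s
      rw [hH, ← ENNReal.ofReal_mul hκ₁0]
      refine ENNReal.ofReal_le_ofReal ?_
      have h1 : 6 / (I * (η * L ^ 2)) * (η ^ 3 * L ^ 2 / 2) = 3 / I * η ^ 2 := by
        field_simp
        norm_num
      have h2 : κ₁ * (η ^ 3 * L ^ 2 / 2) ≥ 3 / I * η ^ 2 := by
        rw [hκ₁, add_mul, h1]
        have : 0 ≤ 96 * I * η * (η ^ 3 * L ^ 2 / 2) := by positivity
        linarith
      have h3 : κ₁ * (η / 4) ≥ 12 * (1 + I) * η ^ 2 := by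
        have h4 : 0 ≤ 6 / (I * (η * L ^ 2)) * (η / 4) := by positivity
        rw [hκ₁, add_mul]
        nlinarith [mul_le_mul_of_nonneg_right hI' (sq_nonneg η)]
      have h5 := mul_le_mul_of_nonneg_right h2 (sq_nonneg ‖s'.2‖)
      have h6 := mul_le_mul_of_nonneg_right h3 (sq_nonneg ‖∇ f s'.1‖)
      linarith
    · rw [hH, ← ENNReal.ofReal_mul hκ₂0]
      refine ENNReal.ofReal_le_ofReal ?_
      have h1 : κ₂ * (η ^ 3 * L ^ 2 / 2) = 3 * η ^ 2 := by
        rw [hκ₂]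
        field_simp
        norm_num
      have h2 : 0 ≤ κ₂ * (η / 4 * ‖∇ f s.1‖ ^ 2) := by positivity
      rw [mul_add, ← mul_assoc κ₂ (η ^ 3 * L ^ 2 / 2), h1]
      linarith
  have hsum : ∀ m, m ≤ T + I → ∑ t ∈ Finset.range m, Q^[t] H (x₀, 0) ≤ ENNReal.ofReal B := by
    intro m hm
    refine (hG.sum_gradient_sq_add_error_sq_le hf hL hd hk r hη hμ hμ0 hημ x₀ m).trans ?_
    refine ENNReal.ofReal_le_ofReal ?_
    rw [hB]
    have : (m : ℝ) ≤ T + I := by exact_mod_cast hm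
    gcongr
  have hstep : ∀ t, Q^[t] (blockBound (innovationLaw d k D r) f G η n I) (x₀, 0) ≤
      (∑ j ∈ Finset.range I, ENNReal.ofReal κ₁ * Q^[t + j] H (x₀, 0)) +
        (ENNReal.ofReal κ₂ * Q^[t] H (x₀, 0) + ENNReal.ofReal (12 * I * η ^ 2 * n)) := by
    intro t
    refine (markovOp_iterate_mono hpt t _).trans (le_of_eq ?_)
    have hHj : ∀ j, Measurable (Q^[j] H) := fun j => measurable_markovOp_iterate hΦ hHm j
    rw [markovOp_iterate_add hΦ (Finset.measurable_sum _ fun j _ => (hHj j).const_mul _),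
      markovOp_iterate_add hΦ (hHm.const_mul _), markovOp_iterate_const,
      markovOp_iterate_const_mul hΦ hHm,
      markovOp_iterate_sum hΦ _ fun j => (hHj j).const_mul _]
    congr 1
    refine Finset.sum_congr rfl fun j _ => ?_
    rw [markovOp_iterate_const_mul hΦ (hHj j), ← hQ, ← Function.iterate_add_apply]
  refine (Finset.sum_le_sum fun t _ => hstep t).trans ?_
  rw [Finset.sum_add_distrib, Finset.sum_add_distrib, Finset.sum_comm, ← Finset.mul_sum]
  -- For fixed j the sum over t is part of the energy sum up to time T + I, so the overlap of the
  -- blocks costs only a factor I.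
  have h1 : ∑ j ∈ Finset.range I, ∑ t ∈ Finset.range T,
      ENNReal.ofReal κ₁ * Q^[t + j] H (x₀, 0) ≤ I * (ENNReal.ofReal κ₁ * ENNReal.ofReal B) := by
    have h2 : ∀ j ∈ Finset.range I, ∑ t ∈ Finset.range T,
        ENNReal.ofReal κ₁ * Q^[t + j] H (x₀, 0) ≤ ENNReal.ofReal κ₁ * ENNReal.ofReal B := by
      intro j hj
      have hj' := Finset.mem_range.1 hj
      rw [← Finset.mul_sum]
      gcongr
      refine le_trans ?_ (hsum (T + j) (by omega))
      rw [add_comm T j, Finset.sum_range_add]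
      simp only [add_comm]
      exact le_add_self
    refine (Finset.sum_le_sum h2).trans (le_of_eq ?_)
    rw [Finset.sum_const, Finset.card_range, nsmul_eq_mul]
  refine (add_le_add h1 (add_le_add_left (mul_le_mul_right (hsum T (by omega)) _) _)).trans ?_
  rw [Finset.sum_const, Finset.card_range, nsmul_eq_mul, ← ENNReal.ofReal_natCast,
    ← ENNReal.ofReal_natCast, ← ENNReal.ofReal_mul hκ₁0, ← ENNReal.ofReal_mul (by positivity),
    ← ENNReal.ofReal_mul hκ₂0, ← ENNReal.ofReal_mul (by positivity),
    ← ENNReal.ofReal_add (by positivity) (by positivity),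
    ← ENNReal.ofReal_add (by positivity) (by positivity)]
  refine ENNReal.ofReal_le_ofReal (le_of_eq ?_)
  have h3 : I * κ₁ + κ₂ = 12 / (η * L ^ 2) + 96 * I ^ 2 * η := by
    rw [hκ₁, hκ₂]
    field_simp
    ring
  rw [← h3]
  ring

end Displacement

/-! ### The Hessian: symmetry, Taylor remainder, bottom eigenvector. -/

section Hessian

variable {d : ℕ} {f : Vec d → ℝ} {fmax L ρ : ℝ}

/-- Symmetry of the second derivative of f, carried over to the gradient by the Riesz isomorphism.
-/
theorem SmoothObjective.inner_hessian_comm (hf : SmoothObjective f fmax L ρ) (x a b : Vec d) :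
    inner ℝ (fderiv ℝ (∇ f) x a) b = inner ℝ a (fderiv ℝ (∇ f) x b) := by
  have h1 : ∀ y, HasFDerivAt f (InnerProductSpace.toDual ℝ (Vec d) (∇ f y)) y := fun y =>
    (hf.differentiable y).hasGradientAt.hasFDerivAt
  have h2 : HasFDerivAt (fun y => InnerProductSpace.toDual ℝ (Vec d) (∇ f y))
      ((InnerProductSpace.toDual ℝ (Vec d)).toContinuousLinearEquiv.toContinuousLinearMap.comp
        (fderiv ℝ (∇ f) x)) x :=
    ((InnerProductSpace.toDual ℝ (Vec d)).toContinuousLinearEquiv.toContinuousLinearMap.hasFDerivAt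
      (x := ∇ f x)).comp x (hf.differentiable_gradient x).hasFDerivAt
  have h3 := second_derivative_symmetric h1 h2 a b
  have h4 : ∀ a b, ((InnerProductSpace.toDual ℝ (Vec d)).toContinuousLinearEquiv.toContinuousLinearMap.comp
        (fderiv ℝ (∇ f) x)) a b = inner ℝ (fderiv ℝ (∇ f) x a) b := fun a b => rfl
  rw [h4, h4] at h3
  rw [h3, real_inner_comm]

theorem SmoothObjective.norm_hessian_le (hf : SmoothObjective f fmax L ρ) (hL : 0 ≤ L)
    (x : Vec d) : ‖fderiv ℝ (∇ f) x‖ ≤ L := by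
  have h := norm_fderiv_le_of_lipschitz ℝ (f := ∇ f) (x₀ := x) (C := ⟨L, hL⟩)
    (LipschitzWith.of_dist_le_mul fun a b => by
      rw [dist_eq_norm, dist_eq_norm]
      exact hf.smooth a b)
  exact h

/-- Mean value inequality on the smallest ball about x₀ containing both points. The Hessian is
frozen at x₀, so one linear operator serves for the whole block. -/
theorem SmoothObjective.norm_gradient_sub_sub_le (hf : SmoothObjective f fmax L ρ) (hρ : 0 ≤ ρ)
    (x₀ x x' : Vec d) :
    ‖∇ f x - ∇ f x' - fderiv ℝ (∇ f) x₀ (x - x')‖ ≤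
      ρ * max ‖x - x₀‖ ‖x' - x₀‖ * ‖x - x'‖ := by
  refine (convex_closedBall x₀ (max ‖x - x₀‖ ‖x' - x₀‖)).norm_image_sub_le_of_norm_fderiv_le'
    (𝕜 := ℝ) (fun y _ => hf.differentiable_gradient y) (fun y hy => ?_) ?_ ?_
  · refine (hf.hessian_lipschitz y x₀).trans ?_
    gcongr
    simpa [dist_eq_norm] using hy
  · simp [dist_eq_norm]
  · simp [dist_eq_norm]

/-- If the Hessian at `x` has an eigenvalue below `-g`, there is a unit eigenvector for the least
eigenvalue `-γ`, and gradient descent steps for the quadratic model expand by at most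
`1 + η γ`. -/
theorem SmoothObjective.exists_min_eigenvector (hf : SmoothObjective f fmax L ρ) (hL : 0 ≤ L)
    {x : Vec d} {g lam : ℝ}
    (hlam : Module.End.HasEigenvalue (fderiv ℝ (∇ f) x : Vec d →ₗ[ℝ] Vec d) lam)
    (hg0 : 0 ≤ g) (hg : lam < -g) :
    ∃ (γ : ℝ) (v : Vec d), g < γ ∧ γ ≤ L ∧ ‖v‖ = 1 ∧ fderiv ℝ (∇ f) x v = -γ • v ∧
      ∀ (η : ℝ) (w : Vec d), 0 ≤ η → η * L ≤ 1 →
        ‖w - η • fderiv ℝ (∇ f) x w‖ ≤ (1 + η * γ) * ‖w‖ := by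
  set H := fderiv ℝ (∇ f) x with hH
  have hsym : (H : Vec d →ₗ[ℝ] Vec d).IsSymmetric := fun a b => hf.inner_hessian_comm x a b
  have hn : Module.finrank ℝ (Vec d) = d := by simp
  obtain ⟨j, hj⟩ := hsym.exists_eigenvalues_eq hn hlam
  set ev := hsym.eigenvalues hn with hev
  set b := hsym.eigenvectorBasis hn with hb
  have hHb : ∀ i, H (b i) = ev i • b i := fun i => hsym.apply_eigenvectorBasis hn i
  obtain ⟨i, -, hi⟩ := Finset.exists_min_image Finset.univ ev ⟨j, Finset.mem_univ j⟩
  have habs : ∀ i, |ev i| ≤ L := by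
    intro i
    have h1 := (H.le_opNorm (b i)).trans
      (mul_le_mul_of_nonneg_right (hf.norm_hessian_le hL x) (norm_nonneg _))
    rw [hHb, norm_smul, b.norm_eq_one] at h1
    simpa using h1
  have hj' : ev j = lam := by simpa using hj
  refine ⟨-ev i, b i, ?_, ?_, b.norm_eq_one i, by rw [hHb, neg_neg], ?_⟩
  · have := hi j (Finset.mem_univ j)
    linarith
  · exact (neg_le_abs _).trans (habs i)
  · intro η w hη hηL
    have hγ : 0 ≤ -ev i := by
      have := hi j (Finset.mem_univ j)
      linarith
    have h1 : ∀ m, inner ℝ (b m) (w - η • H w) = (1 - η * ev m) * inner ℝ (b m) w := by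
      intro m
      have : inner ℝ (b m) (H w) = ev m * inner ℝ (b m) w := by
        rw [← hf.inner_hessian_comm x, ← hH, hHb, inner_smul_left]
        simp
      rw [inner_sub_right, inner_smul_right, this]
      ring
    have h2 : ‖w - η • H w‖ ^ 2 ≤ ((1 + η * (-ev i)) * ‖w‖) ^ 2 := by
      rw [← b.sum_sq_norm_inner_right, mul_pow, ← b.sum_sq_norm_inner_right w, Finset.mul_sum]
      refine Finset.sum_le_sum fun m _ => ?_
      rw [h1, norm_mul, mul_pow]
      gcongr
      -- Since `ev i` ≤ `ev m` ≤ L and ηL ≤ 1, the eigenvalue 1 - η `ev m` lies in [0, 1 + ηγ].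
      rw [Real.norm_eq_abs, abs_le]
      have h3 := mul_le_mul_of_nonneg_left (hi m (Finset.mem_univ m)) hη
      have h4 := mul_le_mul_of_nonneg_left ((le_abs_self _).trans (habs m)) hη
      have h5 := mul_nonneg hη hγ
      constructor <;> linarith
    exact (sq_le_sq₀ (norm_nonneg _) (by positivity)).1 h2

end Hessian

/-! ### Scalar inequalities for the drift of the coupled chain. -/

theorem add_sq_le_young {I : ℝ} (hI : 1 ≤ I) (p q : ℝ) :
    (p + q) ^ 2 ≤ (1 + 1 / I) * p ^ 2 + 2 * I * q ^ 2 := by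
  have h6 : 0 ≤ I * (q - p / I) ^ 2 := by positivity
  have h7 : I * (q - p / I) ^ 2 = I * q ^ 2 - 2 * (p * q) + 1 / I * p ^ 2 := by
    field_simp
    ring
  nlinarith [mul_le_mul_of_nonneg_right hI (sq_nonneg q)]

theorem sq_le_young_of_le {I p q r B : ℝ} (hI : 1 ≤ I) (hr : 0 ≤ r) (hle : r ≤ p + q)
    (hq : q ^ 2 ≤ B) : r ^ 2 ≤ (1 + 1 / I) * p ^ 2 + 2 * I * B := by
  have h1 : r ^ 2 ≤ (p + q) ^ 2 := pow_le_pow_left₀ hr hle 2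
  have h2 : 2 * I * q ^ 2 ≤ 2 * I * B := mul_le_mul_of_nonneg_left hq (by linarith)
  linarith [add_sq_le_young hI p q]

/-- Combining the growth of the three squares with the noise terms. -/
theorem weighted_growth_le {I η μ M N n₂ ν₁ κ lam V₀ W₂ E₂ Δ₂ A₂ B₂ C₂ R : ℝ} (hI : 0 < I)
    (hμ0 : 0 ≤ μ) (hM : 0 ≤ M) (hlam : 1 ≤ lam) (hN : 0 ≤ N) (hn₂ : 0 ≤ n₂)
    (hκ : 0 ≤ κ) (hV₀ : V₀ = W₂ + η ^ 2 * E₂) (hW₂ : 0 ≤ W₂) (hE₂ : 0 ≤ E₂) (hΔ₂ : 0 ≤ Δ₂)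
    (hA : A₂ ≤ (1 + 1 / I) * (lam * W₂) + R) (hC : C₂ ≤ (1 + 1 / I) * (lam * Δ₂) + R)
    (hB : (1 - μ) * B₂ ≤ (1 - μ / 2) * E₂ + ν₁) (hν₁ : η ^ 2 * ν₁ ≤ 1 / I * V₀)
    (hN' : (M + 2) * (η ^ 2 * N) ≤ 1 / I * V₀ + η ^ 2 * n₂)
    (hR : (M + 1) * R ≤ μ / 2 * (η ^ 2 * E₂) + κ * V₀) :
    (A₂ + η ^ 2 * (N + 4 * n₂)) + η ^ 2 * ((1 - μ) * (B₂ + (N + 4 * n₂))) +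
        M * (C₂ + η ^ 2 * N) ≤
      (1 + 3 / I + κ) * (lam * (W₂ + η ^ 2 * E₂ + M * Δ₂)) + 9 * η ^ 2 * n₂ := by
  rw [← hV₀]
  have h0 : 0 ≤ η ^ 2 * E₂ := mul_nonneg (sq_nonneg η) hE₂
  have h1 : 0 ≤ M * Δ₂ := mul_nonneg hM hΔ₂
  have hV₀0 : 0 ≤ V₀ := by rw [hV₀]; exact add_nonneg hW₂ h0
  have k1 : η ^ 2 * ((1 - μ) * (B₂ + (N + 4 * n₂))) ≤
      η ^ 2 * ((1 - μ / 2) * E₂ + ν₁) + η ^ 2 * (N + 4 * n₂) := by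
    have l1 : 0 ≤ μ * (N + 4 * n₂) := by positivity
    have l2 : (1 - μ) * (B₂ + (N + 4 * n₂)) ≤ ((1 - μ / 2) * E₂ + ν₁) + (N + 4 * n₂) := by
      linarith
    have l3 := mul_le_mul_of_nonneg_left l2 (sq_nonneg η)
    linarith
  have k4 := mul_le_mul_of_nonneg_left hC hM
  have hI1 : 0 ≤ 1 / I := by positivity
  have k6 : V₀ ≤ lam * (V₀ + M * Δ₂) :=
    (le_add_of_nonneg_right h1).trans (le_mul_of_one_le_left (add_nonneg hV₀0 h1) hlam)
  have k7 : η ^ 2 * E₂ ≤ (1 + 1 / I) * (lam * (η ^ 2 * E₂)) :=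
    (le_mul_of_one_le_left h0 hlam).trans
      (le_mul_of_one_le_left (mul_nonneg (by linarith) h0) (by linarith))
  have k8 : (2 * (1 / I) + κ) * V₀ ≤ (2 * (1 / I) + κ) * (lam * (V₀ + M * Δ₂)) :=
    mul_le_mul_of_nonneg_left k6 (by positivity)
  -- Of the 3/I, one comes from Young's inequality, one from the effect of the gradient difference
  -- on the error, one from the variance of gradient differences. The noise constant 9 is 4 for the
  -- iterate, 4 for the error, and 1 from `hN'`.
  have k9 : (1 + 3 / I + κ) * (lam * (V₀ + M * Δ₂)) =
      (1 + 1 / I) * (lam * W₂) + (1 + 1 / I) * (lam * (η ^ 2 * E₂)) +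
        M * ((1 + 1 / I) * (lam * Δ₂)) + (2 * (1 / I) + κ) * (lam * (V₀ + M * Δ₂)) := by
    rw [hV₀]
    ring
  rw [k9]
  linarith

/-- The one-step growth of the weighted squares of the difference, of the compression error
difference, and of the deviation from the linear model. -/
theorem coupled_drift_le {η L μ ℓ τ n₂ M lam δ W E Δ U A B C : ℝ} {I : ℕ} (hI : 1 ≤ I)
    (hη : 0 < η) (hμ0 : 0 < μ) (hμ1 : μ ≤ 1) (hn₂ : 0 ≤ n₂) (hτ : 0 ≤ τ)
    (hM : 0 ≤ M) (hlam : 1 ≤ lam)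
    (hU0 : 0 ≤ U) (hU : U ≤ W + η * E) (hA0 : 0 ≤ A) (hB0 : 0 ≤ B) (hC0 : 0 ≤ C)
    (hA : A ≤ lam * W + (η ^ 2 * L * E + η * δ * U))
    (hB : B ≤ E + L * U) (hC : C ≤ lam * Δ + (η ^ 2 * L * E + η * δ * U))
    (h1 : 8 * (M + 1) * I * η ^ 2 * L ^ 2 ≤ μ) (h2 : 2 * (M + 2) * η ^ 2 * ℓ ^ 2 * I ≤ 1)
    (h3 : (M + 2) * τ ≤ n₂) :
    (A ^ 2 + η ^ 2 * (ℓ ^ 2 * U ^ 2 + τ + 4 * n₂)) +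
        η ^ 2 * ((1 - μ) * (B ^ 2 + (ℓ ^ 2 * U ^ 2 + τ + 4 * n₂))) +
        M * (C ^ 2 + η ^ 2 * (ℓ ^ 2 * U ^ 2 + τ)) ≤
      (1 + 3 / I + 8 * (M + 1) * I * η ^ 2 * δ ^ 2) *
          (lam ^ 2 * (W ^ 2 + η ^ 2 * E ^ 2 + M * Δ ^ 2)) + 9 * η ^ 2 * n₂ := by
  have hI' : (1 : ℝ) ≤ I := by exact_mod_cast hI
  have hI0 : (0 : ℝ) < I := by linarith
  obtain ⟨V₀, hV₀⟩ : ∃ V₀, V₀ = W ^ 2 + η ^ 2 * E ^ 2 := ⟨_, rfl⟩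
  have hV₀0 : 0 ≤ V₀ := by rw [hV₀]; positivity
  have hU2 : U ^ 2 ≤ 2 * V₀ := by
    have h4 : U ^ 2 ≤ (W + η * E) ^ 2 := pow_le_pow_left₀ hU0 hU 2
    have h5 := sq_nonneg (W - η * E)
    rw [hV₀]
    linarith
  have hF2 : (η ^ 2 * L * E + η * δ * U) ^ 2 ≤
      2 * η ^ 4 * L ^ 2 * E ^ 2 + 4 * η ^ 2 * δ ^ 2 * V₀ := by
    have h4 := sq_nonneg (η ^ 2 * L * E - η * δ * U)
    have h5 := mul_le_mul_of_nonneg_left hU2 (by positivity : 0 ≤ η ^ 2 * δ ^ 2)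
    linarith
  have hA2 := sq_le_young_of_le hI' hA0 hA hF2
  have hC2 := sq_le_young_of_le hI' hC0 hC hF2
  rw [mul_pow] at hA2 hC2
  have hB2 : (1 - μ) * B ^ 2 ≤ (1 - μ / 2) * E ^ 2 + 2 / μ * (2 * L ^ 2 * V₀) := by
    have h4 : B ^ 2 ≤ (E + L * U) ^ 2 := pow_le_pow_left₀ hB0 hB 2
    have h5 := mul_le_mul_of_nonneg_left h4 (sub_nonneg.2 hμ1)
    have h6 := mul_le_mul_of_nonneg_left hU2 (sq_nonneg L)
    have h7 : 2 / μ * (L * U) ^ 2 ≤ 2 / μ * (2 * L ^ 2 * V₀) :=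
      mul_le_mul_of_nonneg_left (by rw [mul_pow]; linarith) (by positivity)
    linarith [one_sub_mul_add_sq_le hμ0 hμ1 E (L * U)]
  have h8 : 4 * η ^ 2 * L ^ 2 / μ ≤ 1 / I := by
    rw [div_le_div_iff₀ hμ0 hI0]
    have : 0 ≤ (8 * M + 4) * I * η ^ 2 * L ^ 2 := by positivity
    linarith
  have h9 : 2 * (M + 2) * η ^ 2 * ℓ ^ 2 ≤ 1 / I := by
    rw [le_div_iff₀ hI0]
    exact h2
  refine weighted_growth_le hI0 hμ0.le hM (one_le_pow₀ hlam) (by positivity) hn₂ (by positivity)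
    hV₀ (sq_nonneg W) (sq_nonneg E) (sq_nonneg Δ) hA2 hC2 hB2 ?_ ?_ ?_
  · have h10 : η ^ 2 * (2 / μ * (2 * L ^ 2 * V₀)) = 4 * η ^ 2 * L ^ 2 / μ * V₀ := by ring
    rw [h10]
    exact mul_le_mul_of_nonneg_right h8 hV₀0
  · have l0 := mul_le_mul_of_nonneg_left hU2 (by positivity : 0 ≤ (M + 2) * (η ^ 2 * ℓ ^ 2))
    have l2 := mul_le_mul_of_nonneg_right h9 hV₀0
    have l3 := mul_le_mul_of_nonneg_left h3 (sq_nonneg η)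
    linarith
  -- By `h1`, the part of the perturbation proportional to E is absorbed by the half contraction μ/2
  -- left in `hB2`. The part with δ is exactly the growth 8(M + 1)Iη²δ².
  · have h11 := mul_le_mul_of_nonneg_right h1 (by positivity : 0 ≤ η ^ 2 * E ^ 2 / 2)
    linarith

/-! ### The reflection coupling. -/

section Coupling

variable {d k : ℕ} {Θ : Type u} [MeasurableSpace Θ]

/-- The reflection of `ξ` in the hyperplane orthogonal to the unit vector `v`. -/
noncomputable def reflectAlong (v ξ : Vec d) : Vec d := ξ - (2 * inner ℝ v ξ) • v

/-- As a linear isometry the reflection preserves the Gaussian law. -/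
theorem reflectAlong_eq_reflection {v : Vec d} (hv : ‖v‖ = 1) (ξ : Vec d) :
    reflectAlong v ξ = (ℝ ∙ v)ᗮ.reflection ξ := by
  rw [Submodule.reflection_orthogonal_apply, Submodule.reflection_singleton_apply, hv]
  simp only [reflectAlong, RCLike.ofReal_real_eq_id, id_eq]
  module

/-- The innovation with reflected noise. -/
noncomputable def reflectNoise (v : Vec d) (z : Vec d × Θ × Finset (Fin d)) :
    Vec d × Θ × Finset (Fin d) := (reflectAlong v z.1, z.2)

theorem measurable_reflectNoise (v : Vec d) : Measurable (reflectNoise (Θ := Θ) v) := by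
  unfold reflectNoise reflectAlong
  fun_prop

theorem measurePreserving_reflectNoise (hk : k ≤ d) (D : Measure Θ) [IsProbabilityMeasure D]
    (r : ℝ) {v : Vec d} (hv : ‖v‖ = 1) :
    MeasurePreserving (reflectNoise (Θ := Θ) v) (innovationLaw d k D r)
      (innovationLaw d k D r) := by
  have := isProbabilityMeasure_randomKLaw hk
  have h1 : MeasurePreserving (reflectAlong v) (noiseLaw d r) (noiseLaw d r) := by
    have h2 : reflectAlong v = (ℝ ∙ v)ᗮ.reflection := funext (reflectAlong_eq_reflection hv)
    rw [h2]
    exact measurePreserving_reflection_noiseLaw r _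
  exact h1.prod (MeasurePreserving.id (D.prod (randomKLaw d k)))

/-- The state of two coupled copies of compressed SGD, of a linear model for the difference of
their corrected iterates in one direction, and of the sum of the squared distances of the
iterates to the starting point. -/
abbrev CoupledState (d : ℕ) := ((Vec d × Vec d) × (Vec d × Vec d)) × (ℝ × NNReal)

/-- One iteration of two copies of compressed SGD, the second one with the noise reflected
along `v`. -/
noncomputable def coupledStep (G : Vec d → Θ → Vec d) (η : ℝ) (v : Vec d) (lam : ℝ) (x₀ : Vec d)
    (p : CoupledState d) (z : Vec d × Θ × Finset (Fin d)) : CoupledState d :=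
  ((sgdStep G η p.1.1 z, sgdStep G η p.1.2 (reflectNoise v z)),
    (lam * p.2.1 - 2 * η * inner ℝ v z.1,
      p.2.2 + (‖p.1.1.1 - x₀‖₊ ^ 2 + ‖p.1.2.1 - x₀‖₊ ^ 2)))

/-- The difference of the corrected iterates. -/
def correctedDiff (η : ℝ) (p : CoupledState d) : Vec d :=
  corrected η p.1.1 - corrected η p.1.2

/-- The difference of the compression errors. -/
def errorDiff (p : CoupledState d) : Vec d := p.1.1.2 - p.1.2.2

/-- The deviation of the difference in the direction `v` from its linear model. -/
noncomputable def modelDeviation (η : ℝ) (v : Vec d) (p : CoupledState d) : ℝ :=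
  inner ℝ v (correctedDiff η p) - p.2.1

theorem measurable_coupledStep {G : Vec d → Θ → Vec d} (hG : Measurable (Function.uncurry G))
    (η : ℝ) (v : Vec d) (lam : ℝ) (x₀ : Vec d) :
    Measurable (Function.uncurry (coupledStep G η v lam x₀)) := by
  have h := measurable_sgdStep hG η
  refine Measurable.prodMk (Measurable.prodMk ?_ ?_) (Measurable.prodMk ?_ ?_)
  · exact h.comp (by fun_prop : Measurable
      fun q : CoupledState d × (Vec d × Θ × Finset (Fin d)) => (q.1.1.1, q.2))
  · have h2 := measurable_reflectNoise (Θ := Θ) v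
    exact h.comp (by fun_prop : Measurable
      fun q : CoupledState d × (Vec d × Θ × Finset (Fin d)) => (q.1.1.2, reflectNoise v q.2))
  · fun_prop
  · fun_prop

theorem measurable_correctedDiff (η : ℝ) : Measurable (correctedDiff (d := d) η) := by
  have := measurable_corrected (d := d) η
  unfold correctedDiff
  fun_prop

theorem measurable_errorDiff : Measurable (errorDiff (d := d)) := by
  unfold errorDiff
  fun_prop

theorem measurable_modelDeviation (η : ℝ) (v : Vec d) : Measurable (modelDeviation η v) := by
  have := measurable_correctedDiff (d := d) η
  unfold modelDeviation
  fun_prop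

omit [MeasurableSpace Θ] in
-- The copies share θ, and ξ minus its reflection is 2⟨v, ξ⟩v, so noise enters the difference only
-- along v.
theorem correctedDiff_coupledStep (G : Vec d → Θ → Vec d) (η : ℝ) (v : Vec d) (lam : ℝ)
    (x₀ : Vec d) (p : CoupledState d) (z : Vec d × Θ × Finset (Fin d)) :
    correctedDiff η (coupledStep G η v lam x₀ p z) = correctedDiff η p -
      η • ((G p.1.1.1 z.2.1 - G p.1.2.1 z.2.1) + (2 * inner ℝ v z.1) • v) := by
  simp only [correctedDiff, coupledStep, corrected_sgdStep, reflectNoise, reflectAlong]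
  module

theorem keepCoords_sub (a b : Vec d) (S : Finset (Fin d)) :
    keepCoords (a - b) S = keepCoords a S - keepCoords b S := by
  ext i
  by_cases hi : i ∈ S <;> simp [keepCoords, hi]

omit [MeasurableSpace Θ] in
-- For a shared set S the compressor is linear, so the difference of the errors is itself a
-- compression error and contracts at the rate 1 - μ.
theorem errorDiff_coupledStep (G : Vec d → Θ → Vec d) (η : ℝ) (v : Vec d) (lam : ℝ)
    (x₀ : Vec d) (p : CoupledState d) (z : Vec d × Θ × Finset (Fin d)) :
    errorDiff (coupledStep G η v lam x₀ p z) =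
      (errorDiff p + ((G p.1.1.1 z.2.1 - G p.1.2.1 z.2.1) + (2 * inner ℝ v z.1) • v)) -
      keepCoords (errorDiff p +
        ((G p.1.1.1 z.2.1 - G p.1.2.1 z.2.1) + (2 * inner ℝ v z.1) • v)) z.2.2 := by
  have h1 : errorDiff p + ((G p.1.1.1 z.2.1 - G p.1.2.1 z.2.1) + (2 * inner ℝ v z.1) • v) =
      (p.1.1.2 + G p.1.1.1 z.2.1 + z.1) -
        (p.1.2.2 + G p.1.2.1 z.2.1 + (z.1 - (2 * inner ℝ v z.1) • v)) := by
    simp only [errorDiff]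
    module
  rw [h1, keepCoords_sub]
  simp only [errorDiff, coupledStep, sgdStep, reflectNoise, reflectAlong]
  abel

omit [MeasurableSpace Θ] in
-- The model receives exactly the noise -2η⟨v, ξ⟩ of the difference, which therefore cancels. This
-- is why the deviation can carry a large weight M in the potential without amplifying the injected
-- noise.
theorem modelDeviation_coupledStep (G : Vec d → Θ → Vec d) (η : ℝ) {v : Vec d} (hv : ‖v‖ = 1)
    (lam : ℝ) (x₀ : Vec d) (p : CoupledState d) (z : Vec d × Θ × Finset (Fin d)) :
    modelDeviation η v (coupledStep G η v lam x₀ p z) =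
      (inner ℝ v (correctedDiff η p) - lam * p.2.1) +
        (-η) * inner ℝ v (G p.1.1.1 z.2.1 - G p.1.2.1 z.2.1) := by
  rw [modelDeviation, correctedDiff_coupledStep, inner_sub_right, inner_smul_right,
    inner_add_right, inner_smul_right, real_inner_self_eq_norm_sq, hv]
  simp only [coupledStep]
  ring

variable {D : Measure Θ} [IsProbabilityMeasure D] {f : Vec d → ℝ} {G : Vec d → Θ → Vec d} {σ : ℝ}

/-- The difference of two stochastic gradients with the same seed has variance at most
`ℓ² ‖x - x'‖² + τ`. -/
def GradientDiffVariance (D : Measure Θ) (f : Vec d → ℝ) (G : Vec d → Θ → Vec d) (ℓ τ : ℝ) : Prop :=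
  ∀ x x', ∫ θ, ‖G x θ - G x' θ - (∇ f x - ∇ f x')‖ ^ 2 ∂D ≤ ℓ ^ 2 * ‖x - x'‖ ^ 2 + τ

theorem StochasticGradient.memLp_sub (hG : StochasticGradient D f G σ) (x x' : Vec d) :
    MemLp (fun θ => G x θ - G x' θ) 2 D := (hG.memLp x).sub (hG.memLp x')

omit [IsProbabilityMeasure D] in
theorem StochasticGradient.integral_sub (hG : StochasticGradient D f G σ) (x x' : Vec d) :
    ∫ θ, (G x θ - G x' θ) ∂D = ∇ f x - ∇ f x' := by
  rw [MeasureTheory.integral_sub (hG.integrable x) (hG.integrable x'), hG.unbiased, hG.unbiased]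

/-- The second moment of a vector after a step along the difference of two coupled noisy
gradients. -/
theorem StochasticGradient.lintegral_norm_sub_diff_sq_le (hG : StochasticGradient D f G σ)
    {ℓ τ : ℝ} (hvar : GradientDiffVariance D f G ℓ τ) (r η : ℝ) {v : Vec d} (hv : ‖v‖ = 1)
    (x x' A : Vec d) :
    ∫⁻ ξ, ∫⁻ θ, ENNReal.ofReal (‖A - η • ((G x θ - G x' θ) + (2 * inner ℝ v ξ) • v)‖ ^ 2) ∂D
        ∂noiseLaw d r ≤
      ENNReal.ofReal (‖A - η • (∇ f x - ∇ f x')‖ ^ 2 +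
        η ^ 2 * (ℓ ^ 2 * ‖x - x'‖ ^ 2 + τ + 4 * (r ^ 2 / d))) := by
  have h1 : ∀ ξ θ, A - η • ((G x θ - G x' θ) + (2 * inner ℝ v ξ) • v) =
      A + (-(2 * η) * inner ℝ v ξ) • v + (-η) • (G x θ - G x' θ) := fun ξ θ => by module
  have hX : MemLp (fun ξ : Vec d => (-(2 * η) * inner ℝ v ξ) • v) 2 (noiseLaw d r) := by
    have h2 : MemLp (fun ξ : Vec d => inner ℝ v ξ) 2 (noiseLaw d r) :=
      (memLp_noiseLaw r).const_inner v
    have h3 := (ContinuousLinearMap.toSpanSingleton ℝ v).comp_memLp'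
      (h2.const_mul (-(2 * η)))
    exact h3
  have hX0 : ∫ ξ : Vec d, (-(2 * η) * inner ℝ v ξ) • v ∂noiseLaw d r = 0 := by
    rw [integral_smul_const, integral_const_mul,
      integral_inner ((memLp_noiseLaw r).integrable one_le_two), integral_noiseLaw]
    simp
  simp only [h1]
  rw [lintegral_lintegral_norm_add_sq (X := fun ξ : Vec d => (-(2 * η) * inner ℝ v ξ) • v)
    (Y := fun θ => (-η) • (G x θ - G x' θ)) hX hX0 ((hG.memLp_sub x x').const_smul (-η))
    (m := (-η) • (∇ f x - ∇ f x')) (by rw [integral_smul, hG.integral_sub])]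
  refine ENNReal.ofReal_le_ofReal ?_
  simp only [← smul_sub, norm_smul, mul_pow, norm_neg, norm_mul, Real.norm_eq_abs, sq_abs, hv]
  rw [integral_const_mul, neg_smul, ← sub_eq_add_neg]
  have h4 : ∫ ξ : Vec d, (|(2 : ℝ)| ^ 2 * η ^ 2 * (inner ℝ v ξ) ^ 2 * 1 ^ 2) ∂noiseLaw d r =
      η ^ 2 * (4 * (r ^ 2 / d)) := by
    have h5 : ∀ ξ : Vec d, (|(2 : ℝ)| ^ 2 * η ^ 2 * (inner ℝ v ξ) ^ 2 * 1 ^ 2) =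
        4 * η ^ 2 * (inner ℝ v ξ) ^ 2 := fun ξ => by norm_num
    simp only [h5]
    rw [integral_const_mul, integral_inner_sq_noiseLaw r hv]
    ring
  have h6 := mul_le_mul_of_nonneg_left (hvar x x') (sq_nonneg η)
  simp only [sq_abs] at h4
  rw [h4]
  linarith

theorem StochasticGradient.lintegral_correctedDiff_le (hG : StochasticGradient D f G σ)
    (hk : k ≤ d) {ℓ τ : ℝ} (hvar : GradientDiffVariance D f G ℓ τ) (r η : ℝ) {v : Vec d}
    (hv : ‖v‖ = 1) (lam : ℝ) (x₀ : Vec d) (p : CoupledState d) :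
    ∫⁻ z, ENNReal.ofReal (‖correctedDiff η (coupledStep G η v lam x₀ p z)‖ ^ 2)
        ∂innovationLaw d k D r ≤
      ENNReal.ofReal (‖correctedDiff η p - η • (∇ f p.1.1.1 - ∇ f p.1.2.1)‖ ^ 2 +
        η ^ 2 * (ℓ ^ 2 * ‖p.1.1.1 - p.1.2.1‖ ^ 2 + τ + 4 * (r ^ 2 / d))) := by
  have := isProbabilityMeasure_randomKLaw hk
  have hm : Measurable fun z => coupledStep G η v lam x₀ p z :=
    (measurable_coupledStep hG.measurable η v lam x₀).comp measurable_prodMk_left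
  have hm' : Measurable fun z =>
      ENNReal.ofReal (‖correctedDiff η (coupledStep G η v lam x₀ p z)‖ ^ 2) :=
    (((measurable_correctedDiff η).comp hm).norm.pow_const 2).ennreal_ofReal
  rw [lintegral_innovationLaw hk D r hm']
  simp only [correctedDiff_coupledStep, lintegral_const, measure_univ, mul_one]
  exact hG.lintegral_norm_sub_diff_sq_le hvar r η hv _ _ _

theorem StochasticGradient.lintegral_errorDiff_le (hG : StochasticGradient D f G σ)
    (hd : 1 ≤ d) (hk : k ≤ d) {ℓ τ : ℝ} (hvar : GradientDiffVariance D f G ℓ τ) (r η : ℝ)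
    {v : Vec d} (hv : ‖v‖ = 1) (lam : ℝ) (x₀ : Vec d) (p : CoupledState d) :
    ∫⁻ z, ENNReal.ofReal (‖errorDiff (coupledStep G η v lam x₀ p z)‖ ^ 2)
        ∂innovationLaw d k D r ≤
      ENNReal.ofReal ((1 - k / d) * (‖errorDiff p + (∇ f p.1.1.1 - ∇ f p.1.2.1)‖ ^ 2 +
        (ℓ ^ 2 * ‖p.1.1.1 - p.1.2.1‖ ^ 2 + τ + 4 * (r ^ 2 / d)))) := by
  have hk' : (0 : ℝ) ≤ 1 - k / d := by
    rw [sub_nonneg, div_le_one (by positivity)]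
    exact_mod_cast hk
  have hm : Measurable fun z => coupledStep G η v lam x₀ p z :=
    (measurable_coupledStep hG.measurable η v lam x₀).comp measurable_prodMk_left
  have hm' : Measurable fun z =>
      ENNReal.ofReal (‖errorDiff (coupledStep G η v lam x₀ p z)‖ ^ 2) :=
    ((measurable_errorDiff.comp hm).norm.pow_const 2).ennreal_ofReal
  rw [lintegral_innovationLaw hk D r hm']
  simp only [errorDiff_coupledStep, lintegral_norm_sub_keepCoords_sq hd hk,
    ENNReal.ofReal_mul hk']
  have h2 := hG.lintegral_norm_sub_diff_sq_le hvar r (-1) hv p.1.1.1 p.1.2.1 (errorDiff p)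
  simp only [neg_smul, one_smul, sub_neg_eq_add] at h2
  have hG1 := hG.measurable_apply p.1.1.1
  have hG2 := hG.measurable_apply p.1.2.1
  have h3 : Measurable fun q : Vec d × Θ => ENNReal.ofReal (‖errorDiff p +
      ((G p.1.1.1 q.2 - G p.1.2.1 q.2) + (2 * inner ℝ v q.1) • v)‖ ^ 2) := by
    fun_prop
  calc ∫⁻ ξ, ∫⁻ θ, ENNReal.ofReal (1 - k / d) * ENNReal.ofReal (‖errorDiff p +
        ((G p.1.1.1 θ - G p.1.2.1 θ) + (2 * inner ℝ v ξ) • v)‖ ^ 2) ∂D ∂noiseLaw d r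
      = ENNReal.ofReal (1 - k / d) * ∫⁻ ξ, ∫⁻ θ, ENNReal.ofReal (‖errorDiff p +
        ((G p.1.1.1 θ - G p.1.2.1 θ) + (2 * inner ℝ v ξ) • v)‖ ^ 2) ∂D ∂noiseLaw d r := by
        have h4 : Measurable fun ξ : Vec d => ∫⁻ θ, ENNReal.ofReal (‖errorDiff p +
            ((G p.1.1.1 θ - G p.1.2.1 θ) + (2 * inner ℝ v ξ) • v)‖ ^ 2) ∂D :=
          h3.lintegral_prod_right'
        rw [← lintegral_const_mul _ h4]
        refine lintegral_congr fun ξ => ?_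
        have h5 : Measurable fun θ => ENNReal.ofReal (‖errorDiff p +
            ((G p.1.1.1 θ - G p.1.2.1 θ) + (2 * inner ℝ v ξ) • v)‖ ^ 2) := by fun_prop
        rw [lintegral_const_mul _ h5]
    _ ≤ _ := by
        gcongr
        refine h2.trans (le_of_eq ?_)
        congr 1
        ring

/-- In contrast to the two preceding bounds there is no term in r²; only the variance of gradient
differences is added. -/
theorem StochasticGradient.lintegral_modelDeviation_le (hG : StochasticGradient D f G σ)
    (hk : k ≤ d) {ℓ τ : ℝ} (hvar : GradientDiffVariance D f G ℓ τ) (r η : ℝ) {v : Vec d}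
    (hv : ‖v‖ = 1) (lam : ℝ) (x₀ : Vec d) (p : CoupledState d) :
    ∫⁻ z, ENNReal.ofReal (modelDeviation η v (coupledStep G η v lam x₀ p z) ^ 2)
        ∂innovationLaw d k D r ≤
      ENNReal.ofReal ((inner ℝ v (correctedDiff η p - η • (∇ f p.1.1.1 - ∇ f p.1.2.1)) -
        lam * p.2.1) ^ 2 + η ^ 2 * (ℓ ^ 2 * ‖p.1.1.1 - p.1.2.1‖ ^ 2 + τ)) := by
  have := isProbabilityMeasure_randomKLaw hk
  have hm : Measurable fun z => coupledStep G η v lam x₀ p z :=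
    (measurable_coupledStep hG.measurable η v lam x₀).comp measurable_prodMk_left
  have hm' : Measurable fun z =>
      ENNReal.ofReal (modelDeviation η v (coupledStep G η v lam x₀ p z) ^ 2) :=
    (((measurable_modelDeviation η v).comp hm).pow_const 2).ennreal_ofReal
  rw [lintegral_innovationLaw hk D r hm']
  simp only [modelDeviation_coupledStep G η hv, lintegral_const, measure_univ, mul_one]
  have hL := hG.memLp_sub p.1.1.1 p.1.2.1
  have hY : MemLp (fun θ => (-η) * inner ℝ v (G p.1.1.1 θ - G p.1.2.1 θ)) 2 D :=
    (hL.const_inner v).const_mul (-η)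
  have hY0 : ∫ θ, (-η) * inner ℝ v (G p.1.1.1 θ - G p.1.2.1 θ) ∂D =
      (-η) * inner ℝ v (∇ f p.1.1.1 - ∇ f p.1.2.1) := by
    rw [integral_const_mul, integral_inner (hL.integrable one_le_two), hG.integral_sub]
  have h1 := lintegral_norm_const_add_sq hY hY0 (inner ℝ v (correctedDiff η p) - lam * p.2.1)
    le_rfl
  simp only [add_zero, Real.norm_eq_abs, sq_abs] at h1
  rw [h1]
  refine ENNReal.ofReal_le_ofReal (add_le_add (le_of_eq ?_) ?_)
  · rw [inner_sub_right v (correctedDiff η p), inner_smul_right]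
    ring
  · have h2 : Integrable (fun θ => ‖G p.1.1.1 θ - G p.1.2.1 θ -
        (∇ f p.1.1.1 - ∇ f p.1.2.1)‖ ^ 2) D :=
      (hL.sub (memLp_const (∇ f p.1.1.1 - ∇ f p.1.2.1))).integrable_norm_pow two_ne_zero
    refine le_trans ?_ (mul_le_mul_of_nonneg_left (hvar p.1.1.1 p.1.2.1) (sq_nonneg η))
    rw [← integral_const_mul]
    refine integral_mono_of_nonneg (Filter.Eventually.of_forall fun θ => sq_nonneg _)
      (h2.const_mul _) (Filter.Eventually.of_forall fun θ => ?_)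
    simp only
    rw [← mul_sub, ← inner_sub_right, mul_pow, neg_sq]
    refine mul_le_mul_of_nonneg_left ?_ (sq_nonneg η)
    have h3 := abs_real_inner_le_norm v (G p.1.1.1 θ - G p.1.2.1 θ - (∇ f p.1.1.1 - ∇ f p.1.2.1))
    rw [hv, one_mul] at h3
    exact sq_le_sq' (neg_le_of_abs_le h3) (le_of_abs_le h3)

end Coupling

/-! ### The Gaussian linear model. -/

section LinearModel

variable {d k : ℕ} {Θ : Type u} [MeasurableSpace Θ]

/-- The linear model `b ↦ lam b - 2 η ⟪v, ξ⟫` started at `0` is Gaussian. -/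
theorem markovOp_iterate_linearModel (hk : k ≤ d) (D : Measure Θ) [IsProbabilityMeasure D]
    (r η : ℝ) {v : Vec d} (hv : ‖v‖ = 1) (lam : ℝ) {h : ℝ → ℝ≥0∞} (hh : Measurable h) (n : ℕ) :
    (markovOp (innovationLaw d k D r) fun b z => lam * b - 2 * η * inner ℝ v z.1)^[n] h 0 =
      ∫⁻ b, h b ∂gaussianReal 0 (Real.toNNReal
        (4 * η ^ 2 * (r ^ 2 / d) * ∑ i ∈ Finset.range n, (lam ^ 2) ^ i)) := by
  have := isProbabilityMeasure_randomKLaw hk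
  have := isProbabilityMeasure_innovationLaw hk D r
  set Φ : ℝ → (Vec d × Θ × Finset (Fin d)) → ℝ := fun b z => lam * b - 2 * η * inner ℝ v z.1
    with hΦ
  have hΦm : Measurable (Function.uncurry Φ) := by
    simp only [hΦ]
    fun_prop
  induction n generalizing h with
  | zero => simp
  | succ n ih =>
    rw [Function.iterate_succ_apply, ih (measurable_markovOp hΦm hh)]
    set w : NNReal := Real.toNNReal
      (4 * η ^ 2 * (r ^ 2 / d) * ∑ i ∈ Finset.range n, (lam ^ 2) ^ i) with hw
    set w₁ : NNReal := Real.toNNReal (4 * η ^ 2 * (r ^ 2 / d)) with hw₁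
    have h1 : ∀ b, markovOp (innovationLaw d k D r) Φ h b =
        ∫⁻ y, h (lam * b + y) ∂gaussianReal 0 w₁ := by
      intro b
      have h2 : (noiseLaw d r).map (fun ξ => -(2 * η) * inner ℝ v ξ) = gaussianReal 0 w₁ := by
        have : (fun ξ : Vec d => -(2 * η) * inner ℝ v ξ) =
            (fun x : ℝ => -(2 * η) * x) ∘ fun ξ => inner ℝ v ξ := rfl
        rw [this, ← Measure.map_map (by fun_prop) (by fun_prop), map_inner_noiseLaw r hv,
          gaussianReal_map_const_mul]
        congr 1
        · simp
        · ext
          simp only [NNReal.coe_mul, NNReal.coe_mk, hw₁]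
          rw [Real.coe_toNNReal _ (by positivity), Real.coe_toNNReal _ (by positivity)]
          ring
      have h3 : Measurable fun z : Vec d × Θ × Finset (Fin d) => h (Φ b z) :=
        hh.comp (hΦm.comp measurable_prodMk_left)
      rw [markovOp, lintegral_innovationLaw hk D r h3, ← h2,
        lintegral_map (by fun_prop) (by fun_prop)]
      simp only [hΦ, lintegral_const, measure_univ, mul_one]
      refine lintegral_congr fun ξ => ?_
      congr 1
      ring
    simp only [h1]
    have h4 : Measurable fun b => ∫⁻ y, h (b + y) ∂gaussianReal 0 w₁ :=
      Measurable.lintegral_prod_right' (f := fun p : ℝ × ℝ => h (p.1 + p.2)) (by fun_prop)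
    calc ∫⁻ b, ∫⁻ y, h (lam * b + y) ∂gaussianReal 0 w₁ ∂gaussianReal 0 w
        = ∫⁻ b, ∫⁻ y, h (b + y) ∂gaussianReal 0 w₁
            ∂((gaussianReal 0 w).map fun b => lam * b) := (lintegral_map h4 (by fun_prop)).symm
      _ = ∫⁻ b, h b ∂(((gaussianReal 0 w).map fun b => lam * b) ∗ gaussianReal 0 w₁) :=
          (Measure.lintegral_conv hh).symm
      _ = _ := by
          rw [gaussianReal_map_const_mul, gaussianReal_conv_gaussianReal]
          congr 2
          · simp
          · ext
            simp only [NNReal.coe_add, NNReal.coe_mul, NNReal.coe_mk, hw, hw₁]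
            rw [Real.coe_toNNReal _ (by positivity), Real.coe_toNNReal _ (by positivity),
              Real.coe_toNNReal _ (by positivity), Finset.sum_range_succ']
            simp only [pow_succ, ← Finset.sum_mul]
            ring

/-- A centred Gaussian is within a quarter of its standard deviation of zero with probability
at most `1 / 4`. -/
theorem gaussianReal_abs_lt_le {s₂ : ℝ} (hs : 0 < s₂) :
    gaussianReal 0 (Real.toNNReal s₂) {b | |b| < √s₂ / 4} ≤ ENNReal.ofReal (1 / 4) := by
  have hv : Real.toNNReal s₂ ≠ 0 := by simpa using hs
  rw [gaussianReal_apply 0 hv]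
  have hsq : 0 < √s₂ := Real.sqrt_pos.2 hs
  have h1 : {b : ℝ | |b| < √s₂ / 4} = Set.Ioo (-(√s₂ / 4)) (√s₂ / 4) := by
    ext b
    simp [abs_lt]
  -- Since 2π ≥ 4 the density is at most 1/(2√s₂), and the interval has length √s₂/2.
  have h2 : ∀ b, gaussianPDF 0 (Real.toNNReal s₂) b ≤ ENNReal.ofReal (1 / (2 * √s₂)) := by
    intro b
    refine ENNReal.ofReal_le_ofReal ?_
    rw [gaussianPDFReal, Real.coe_toNNReal _ hs.le]
    have h3 : Real.exp (-(b - 0) ^ 2 / (2 * s₂)) ≤ 1 := by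
      rw [Real.exp_le_one_iff]
      exact div_nonpos_of_nonpos_of_nonneg (by nlinarith [sq_nonneg (b - 0)]) (by positivity)
    have h4 : 2 * √s₂ ≤ √(2 * Real.pi * s₂) := by
      refine Real.le_sqrt_of_sq_le ?_
      rw [mul_pow, Real.sq_sqrt hs.le]
      nlinarith [Real.pi_gt_three]
    calc (√(2 * Real.pi * s₂))⁻¹ * Real.exp (-(b - 0) ^ 2 / (2 * s₂))
        ≤ (2 * √s₂)⁻¹ * 1 := by gcongr
      _ = _ := by simp
  calc ∫⁻ b in {b | |b| < √s₂ / 4}, gaussianPDF 0 (Real.toNNReal s₂) b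
      ≤ ∫⁻ _ in {b | |b| < √s₂ / 4}, ENNReal.ofReal (1 / (2 * √s₂)) :=
        lintegral_mono fun b => h2 b
    _ = ENNReal.ofReal (1 / 4) := by
        rw [lintegral_const, Measure.restrict_apply_univ, h1, Real.volume_Ioo,
          ← ENNReal.ofReal_mul (by positivity)]
        congr 1
        field_simp
        ring

end LinearModel

/-! ### The weighted potential of the coupled chain. -/

section Escape

theorem lintegral_mul_add_mul_add_mul {Z : Type*} [MeasurableSpace Z] {μ : Measure Z}
    {F₁ F₂ F₃ : Z → ℝ≥0∞} (h1 : Measurable F₁) (h2 : Measurable F₂) (h3 : Measurable F₃)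
    (c c₂ c₃ : ℝ≥0∞) :
    ∫⁻ z, c * (F₁ z + c₂ * F₂ z + c₃ * F₃ z) ∂μ =
      c * (∫⁻ z, F₁ z ∂μ + c₂ * ∫⁻ z, F₂ z ∂μ + c₃ * ∫⁻ z, F₃ z ∂μ) := by
  rw [lintegral_const_mul _ (by fun_prop), lintegral_add_left (by fun_prop),
    lintegral_add_left h1, lintegral_const_mul _ h2, lintegral_const_mul _ h3]

theorem ofReal_mul_add_mul_add_mul {c c₂ c₃ a₁ a₂ a₃ : ℝ} (hc : 0 ≤ c) (hc₂ : 0 ≤ c₂)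
    (hc₃ : 0 ≤ c₃) (h1 : 0 ≤ a₁) (h2 : 0 ≤ a₂) (h3 : 0 ≤ a₃) :
    ENNReal.ofReal c * (ENNReal.ofReal a₁ + ENNReal.ofReal c₂ * ENNReal.ofReal a₂ +
      ENNReal.ofReal c₃ * ENNReal.ofReal a₃) =
      ENNReal.ofReal (c * (a₁ + c₂ * a₂ + c₃ * a₃)) := by
  rw [← ENNReal.ofReal_mul hc₂, ← ENNReal.ofReal_mul hc₃,
    ← ENNReal.ofReal_add h1 (mul_nonneg hc₂ h2),
    ← ENNReal.ofReal_add (add_nonneg h1 (mul_nonneg hc₂ h2)) (mul_nonneg hc₃ h3),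
    ← ENNReal.ofReal_mul hc]

/-- The exponential weight absorbs the random part of the growth. -/
theorem exp_neg_mul_growth_le {C q a κ t V n : ℝ} (hC : 0 ≤ C) (hq : 0 ≤ q) (ha : 0 ≤ a)
    (ht : 0 ≤ t) (hV : 0 ≤ V) (hn : 0 ≤ n) (hκ : κ ≤ C * a) :
    Real.exp (-(C * (q + a))) * ((1 + t + κ) * V + n) ≤
      (1 + t) * (Real.exp (-(C * q)) * V) + n := by
  have hCa : 0 ≤ C * a := mul_nonneg hC ha
  have m1 : 1 + t + κ ≤ (1 + t) * Real.exp (C * a) := by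
    have l1 := Real.add_one_le_exp (C * a)
    have l2 := mul_le_mul_of_nonneg_left l1 (by linarith : 0 ≤ 1 + t)
    have l3 := mul_nonneg ht hCa
    linarith
  have m2 : Real.exp (-(C * (q + a))) * Real.exp (C * a) = Real.exp (-(C * q)) := by
    rw [← Real.exp_add]
    congr 1
    ring
  have m3 : Real.exp (-(C * (q + a))) ≤ 1 := by
    rw [Real.exp_le_one_iff]
    have := mul_nonneg hC (add_nonneg hq ha)
    linarith
  rw [mul_add]
  refine add_le_add ?_ (mul_le_of_le_one_left hn m3)
  calc Real.exp (-(C * (q + a))) * ((1 + t + κ) * V)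
      ≤ Real.exp (-(C * (q + a))) * (((1 + t) * Real.exp (C * a)) * V) :=
        mul_le_mul_of_nonneg_left (mul_le_mul_of_nonneg_right m1 hV) (Real.exp_nonneg _)
    _ = (1 + t) * ((Real.exp (-(C * (q + a))) * Real.exp (C * a)) * V) := by ring
    _ = _ := by rw [m2]

variable {d k : ℕ} {Θ : Type u} [MeasurableSpace Θ] {D : Measure Θ} [IsProbabilityMeasure D]
  {f : Vec d → ℝ} {G : Vec d → Θ → Vec d} {σ : ℝ}

/-- The Lyapunov function of the coupled chain. -/
noncomputable def coupledPotential (C η M : ℝ) (v : Vec d) (p : CoupledState d) : ℝ≥0∞ :=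
  ENNReal.ofReal (Real.exp (-(C * p.2.2))) * (ENNReal.ofReal (‖correctedDiff η p‖ ^ 2) +
    ENNReal.ofReal (η ^ 2) * ENNReal.ofReal (‖errorDiff p‖ ^ 2) +
    ENNReal.ofReal M * ENNReal.ofReal (modelDeviation η v p ^ 2))

theorem measurable_coupledPotential (C η M : ℝ) (v : Vec d) :
    Measurable (coupledPotential C η M v) := by
  have h1 := measurable_correctedDiff (d := d) η
  have h2 := measurable_errorDiff (d := d)
  have h3 := measurable_modelDeviation η v
  unfold coupledPotential
  fun_prop

/-- The growth of the coupled chain in terms of the state. -/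
theorem SmoothObjective.coupled_growth_le {fmax L ρ : ℝ} (hf : SmoothObjective f fmax L ρ)
    (hL : 0 < L) (hρ : 0 ≤ ρ) {ℓ τ n₂ : ℝ} (hτ : 0 ≤ τ) (hn₂0 : 0 ≤ n₂)
    {η μ : ℝ} (hη : 0 < η) (hμ0 : 0 < μ) (hμ1 : μ ≤ 1) (hηL : η * L ≤ 1)
    {I : ℕ} (hI : 1 ≤ I) {M : ℝ} (hM : 0 ≤ M)
    (h1 : 8 * (M + 1) * I * η ^ 2 * L ^ 2 ≤ μ) (h2 : 2 * (M + 2) * η ^ 2 * ℓ ^ 2 * I ≤ 1)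
    (h3 : (M + 2) * τ ≤ n₂)
    {x₀ v : Vec d} {γ : ℝ} (hγ : 0 ≤ γ) (hv : ‖v‖ = 1)
    (hHv : fderiv ℝ (∇ f) x₀ v = -γ • v)
    (hexp : ∀ (η : ℝ) (w : Vec d), 0 ≤ η → η * L ≤ 1 →
        ‖w - η • fderiv ℝ (∇ f) x₀ w‖ ≤ (1 + η * γ) * ‖w‖)
    {x x' w e : Vec d} (hxx : x - x' = w + η • e) (b : ℝ) :
    (‖w - η • (∇ f x - ∇ f x')‖ ^ 2 + η ^ 2 * (ℓ ^ 2 * ‖x - x'‖ ^ 2 + τ + 4 * n₂)) +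
        η ^ 2 * ((1 - μ) * (‖e + (∇ f x - ∇ f x')‖ ^ 2 +
          (ℓ ^ 2 * ‖x - x'‖ ^ 2 + τ + 4 * n₂))) +
        M * ((inner ℝ v (w - η • (∇ f x - ∇ f x')) - (1 + η * γ) * b) ^ 2 +
          η ^ 2 * (ℓ ^ 2 * ‖x - x'‖ ^ 2 + τ)) ≤
      (1 + 3 / I + 8 * (M + 1) * I * η ^ 2 * (ρ * max ‖x - x₀‖ ‖x' - x₀‖) ^ 2) *
          ((1 + η * γ) ^ 2 * (‖w‖ ^ 2 + η ^ 2 * ‖e‖ ^ 2 + M * (inner ℝ v w - b) ^ 2)) +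
        9 * η ^ 2 * n₂ := by
  have hlam1 : 1 ≤ 1 + η * γ := by linarith [mul_nonneg hη.le hγ]
  obtain ⟨H, hH⟩ : ∃ H, H = fderiv ℝ (∇ f) x₀ := ⟨_, rfl⟩
  obtain ⟨δ, hδ⟩ : ∃ δ, δ = ρ * max ‖x - x₀‖ ‖x' - x₀‖ := ⟨_, rfl⟩
  have hsm := hf.smooth x x'
  have hrem : ‖∇ f x - ∇ f x' - H (x - x')‖ ≤ δ * ‖x - x'‖ := by
    rw [hδ, hH]
    exact hf.norm_gradient_sub_sub_le hρ x₀ x x'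
  obtain ⟨g, hg⟩ : ∃ g, g = ∇ f x - ∇ f x' := ⟨_, rfl⟩
  rw [← hg] at hsm hrem ⊢
  rw [← hδ]
  rw [← hH] at hHv hexp
  have hHe : ‖H e‖ ≤ L * ‖e‖ := by
    rw [hH]
    exact (ContinuousLinearMap.le_opNorm _ e).trans
      (mul_le_mul_of_nonneg_right (hf.norm_hessian_le hL.le x₀) (norm_nonneg _))
  have hHvw : inner ℝ v (H w) = -γ * inner ℝ v w := by
    rw [hH, ← hf.inner_hessian_comm x₀, ← hH, hHv, inner_smul_left]
    simp
  have hFn : ‖(η ^ 2) • H e + η • (g - H (x - x'))‖ ≤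
      η ^ 2 * L * ‖e‖ + η * δ * ‖x - x'‖ := by
    refine (norm_add_le _ _).trans ?_
    rw [norm_smul, norm_smul, Real.norm_of_nonneg hη.le, Real.norm_of_nonneg (sq_nonneg η)]
    have l1 := mul_le_mul_of_nonneg_left hHe (sq_nonneg η)
    have l2 := mul_le_mul_of_nonneg_left hrem hη.le
    linarith
  -- The exact linear evolution of w, minus two perturbations: the Hessian acting on the gap ηe, and
  -- the Taylor remainder.
  have hdecomp : w - η • g = (w - η • H w) - ((η ^ 2) • H e + η • (g - H (x - x'))) := by
    rw [hxx, map_add, map_smul]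
    module
  have hA : ‖w - η • g‖ ≤ (1 + η * γ) * ‖w‖ + (η ^ 2 * L * ‖e‖ + η * δ * ‖x - x'‖) := by
    rw [hdecomp]
    exact (norm_sub_le _ _).trans (add_le_add (hexp η w hη.le hηL) hFn)
  have hB : ‖e + g‖ ≤ ‖e‖ + L * ‖x - x'‖ :=
    (norm_add_le _ _).trans (add_le_add_right hsm _)
  have hU : ‖x - x'‖ ≤ ‖w‖ + η * ‖e‖ := by
    rw [hxx]
    refine (norm_add_le _ _).trans ?_
    rw [norm_smul, Real.norm_of_nonneg hη.le]
  have hC : |inner ℝ v (w - η • g) - (1 + η * γ) * b| ≤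
      (1 + η * γ) * |inner ℝ v w - b| + (η ^ 2 * L * ‖e‖ + η * δ * ‖x - x'‖) := by
    have l2 : inner ℝ v (w - η • g) - (1 + η * γ) * b = (1 + η * γ) * (inner ℝ v w - b) -
        inner ℝ v ((η ^ 2) • H e + η • (g - H (x - x'))) := by
      rw [hdecomp, inner_sub_right, inner_sub_right, inner_smul_right, hHvw]
      ring
    rw [l2]
    refine (abs_sub _ _).trans (add_le_add ?_ ?_)
    · rw [abs_mul, abs_of_nonneg (by linarith : 0 ≤ 1 + η * γ)]
    · refine (abs_real_inner_le_norm _ _).trans ?_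
      rw [hv, one_mul]
      exact hFn
  have hdrift := coupled_drift_le hI hη hμ0 hμ1 hn₂0 hτ hM hlam1 (norm_nonneg _) hU
    (norm_nonneg _) (norm_nonneg _) (abs_nonneg _) hA hB hC h1 h2 h3
  rwa [sq_abs, sq_abs] at hdrift

/-- The Lyapunov inequality for the coupled chain. -/
theorem StochasticGradient.markovOp_coupledPotential_le (hG : StochasticGradient D f G σ)
    {fmax L ρ : ℝ} (hf : SmoothObjective f fmax L ρ) (hL : 0 < L) (hρ : 0 ≤ ρ) (hd : 1 ≤ d)
    (hk : k ≤ d) {ℓ τ : ℝ} (hτ : 0 ≤ τ) (hvar : GradientDiffVariance D f G ℓ τ) (r : ℝ)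
    {η μ : ℝ} (hη : 0 < η) (hμ : μ = k / d) (hμ0 : 0 < μ) (hηL : η * L ≤ 1)
    {I : ℕ} (hI : 1 ≤ I) {M : ℝ} (hM : 0 ≤ M)
    (h1 : 8 * (M + 1) * I * η ^ 2 * L ^ 2 ≤ μ) (h2 : 2 * (M + 2) * η ^ 2 * ℓ ^ 2 * I ≤ 1)
    (h3 : (M + 2) * τ ≤ r ^ 2 / d)
    {x₀ v : Vec d} {γ : ℝ} (hγ : 0 ≤ γ) (hv : ‖v‖ = 1)
    (hHv : fderiv ℝ (∇ f) x₀ v = -γ • v)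
    (hexp : ∀ (η : ℝ) (w : Vec d), 0 ≤ η → η * L ≤ 1 →
        ‖w - η • fderiv ℝ (∇ f) x₀ w‖ ≤ (1 + η * γ) * ‖w‖)
    {C : ℝ} (hC : C = 8 * (M + 1) * I * η ^ 2 * ρ ^ 2) (p : CoupledState d) :
    markovOp (innovationLaw d k D r) (coupledStep G η v (1 + η * γ) x₀)
        (coupledPotential C η M v) p ≤
      ENNReal.ofReal ((1 + 3 / I) * (1 + η * γ) ^ 2) * coupledPotential C η M v p +
      ENNReal.ofReal (9 * η ^ 2 * (r ^ 2 / d)) := by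
  have hμ1 : μ ≤ 1 := by
    rw [hμ, div_le_one (by positivity)]
    exact_mod_cast hk
  have hk0 : 0 ≤ 1 - μ := sub_nonneg.2 hμ1
  have hC0 : 0 ≤ C := by rw [hC]; positivity
  have hm : Measurable fun z => coupledStep G η v (1 + η * γ) x₀ p z :=
    (measurable_coupledStep hG.measurable η v _ x₀).comp measurable_prodMk_left
  have hm1 : Measurable fun z =>
      ENNReal.ofReal (‖correctedDiff η (coupledStep G η v (1 + η * γ) x₀ p z)‖ ^ 2) :=
    (((measurable_correctedDiff η).comp hm).norm.pow_const 2).ennreal_ofReal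
  have hm2 : Measurable fun z =>
      ENNReal.ofReal (‖errorDiff (coupledStep G η v (1 + η * γ) x₀ p z)‖ ^ 2) :=
    ((measurable_errorDiff.comp hm).norm.pow_const 2).ennreal_ofReal
  have hm3 : Measurable fun z =>
      ENNReal.ofReal (modelDeviation η v (coupledStep G η v (1 + η * γ) x₀ p z) ^ 2) :=
    (((measurable_modelDeviation η v).comp hm).pow_const 2).ennreal_ofReal
  have hq : ∀ z, ((coupledStep G η v (1 + η * γ) x₀ p z).2.2 : ℝ) =
      p.2.2 + (‖p.1.1.1 - x₀‖ ^ 2 + ‖p.1.2.1 - x₀‖ ^ 2) := by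
    intro z
    simp [coupledStep]
  have hxx : p.1.1.1 - p.1.2.1 = correctedDiff η p + η • errorDiff p := by
    simp only [correctedDiff, corrected, errorDiff]
    module
  have e1 := hG.lintegral_correctedDiff_le hk hvar r η hv (1 + η * γ) x₀ p
  have e2 := hG.lintegral_errorDiff_le hd hk hvar r η hv (1 + η * γ) x₀ p
  have e3 := hG.lintegral_modelDeviation_le hk hvar r η hv (1 + η * γ) x₀ p
  have hn₂0 : 0 ≤ r ^ 2 / (d : ℝ) := by positivity
  have hdrift := hf.coupled_growth_le hL hρ hτ hn₂0 hη hμ0 hμ1 hηL hI hM h1 h2 h3 hγ hv hHv hexp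
    hxx p.2.1
  rw [← hμ] at e2
  -- The growth due to the variation of the Hessian is at most C times the increment of the
  -- accumulated distance q in this very step. The decrease of exp(-Cq) cancels it.
  have hκ : 8 * (M + 1) * I * η ^ 2 * (ρ * max ‖p.1.1.1 - x₀‖ ‖p.1.2.1 - x₀‖) ^ 2 ≤
      C * (‖p.1.1.1 - x₀‖ ^ 2 + ‖p.1.2.1 - x₀‖ ^ 2) := by
    have l1 : (max ‖p.1.1.1 - x₀‖ ‖p.1.2.1 - x₀‖) ^ 2 ≤
        ‖p.1.1.1 - x₀‖ ^ 2 + ‖p.1.2.1 - x₀‖ ^ 2 := by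
      rcases max_cases ‖p.1.1.1 - x₀‖ ‖p.1.2.1 - x₀‖ with ⟨h, -⟩ | ⟨h, -⟩ <;> rw [h]
      · exact le_add_of_nonneg_right (sq_nonneg _)
      · exact le_add_of_nonneg_left (sq_nonneg _)
    refine le_trans (le_of_eq ?_) (mul_le_mul_of_nonneg_left l1 hC0)
    rw [hC]
    ring
  have hnn : 0 ≤ ℓ ^ 2 * ‖p.1.1.1 - p.1.2.1‖ ^ 2 + τ :=
    add_nonneg (mul_nonneg (sq_nonneg _) (sq_nonneg _)) hτ
  have hnn4 : 0 ≤ ℓ ^ 2 * ‖p.1.1.1 - p.1.2.1‖ ^ 2 + τ + 4 * (r ^ 2 / d) :=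
    add_nonneg hnn (by linarith)
  have hV0 : 0 ≤ (1 + η * γ) ^ 2 * (‖correctedDiff η p‖ ^ 2 + η ^ 2 * ‖errorDiff p‖ ^ 2 +
      M * modelDeviation η v p ^ 2) := by positivity
  have hfin := exp_neg_mul_growth_le hC0 (NNReal.coe_nonneg p.2.2)
    (add_nonneg (sq_nonneg ‖p.1.1.1 - x₀‖) (sq_nonneg ‖p.1.2.1 - x₀‖))
    (by positivity : (0 : ℝ) ≤ 3 / I) hV0 (by positivity : 0 ≤ 9 * η ^ 2 * (r ^ 2 / (d : ℝ))) hκ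
  simp only [markovOp, coupledPotential, hq]
  rw [lintegral_mul_add_mul_add_mul hm1 hm2 hm3]
  refine (mul_le_mul_right (add_le_add (add_le_add e1 (mul_le_mul_right e2 _))
    (mul_le_mul_right e3 _)) _).trans ?_
  rw [ofReal_mul_add_mul_add_mul (Real.exp_nonneg _) (sq_nonneg η) hM
    (add_nonneg (sq_nonneg _) (mul_nonneg (sq_nonneg η) hnn4))
    (mul_nonneg hk0 (add_nonneg (sq_nonneg _) hnn4))
    (add_nonneg (sq_nonneg _) (mul_nonneg (sq_nonneg η) hnn))]
  refine (ENNReal.ofReal_le_ofReal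
    ((mul_le_mul_of_nonneg_left hdrift (Real.exp_nonneg _)).trans hfin)).trans (le_of_eq ?_)
  rw [ofReal_mul_add_mul_add_mul (Real.exp_nonneg _) (sq_nonneg η) hM (sq_nonneg _) (sq_nonneg _)
    (sq_nonneg _), ← ENNReal.ofReal_mul (by positivity),
    ← ENNReal.ofReal_add (by positivity) (by positivity)]
  congr 1
  ring

end Escape

/-! ### Lower bound for the displacement at points of negative curvature. -/

section Escape

/-- A Markov chain with multiplicative growth and additive noise. -/
theorem markovOp_iterate_le_geom_sum {S Z : Type*} [MeasurableSpace S] [MeasurableSpace Z]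
    {ν : Measure Z} [IsProbabilityMeasure ν] {Φ : S → Z → S}
    (hΦ : Measurable (Function.uncurry Φ)) {V : S → ℝ≥0∞} (hV : Measurable V) {a c : ℝ}
    (ha : 0 ≤ a) (hc : 0 ≤ c)
    (hle : ∀ s, markovOp ν Φ V s ≤ ENNReal.ofReal a * V s + ENNReal.ofReal c) {s : S}
    (hs : V s = 0) (n : ℕ) :
    (markovOp ν Φ)^[n] V s ≤ ENNReal.ofReal (c * ∑ i ∈ Finset.range n, a ^ i) := by
  induction n with
  | zero => simp [hs]
  | succ n ih =>
    refine (markovOp_iterate_succ_le hΦ hV hle n s).trans ?_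
    rw [markovOp_iterate_const]
    refine (add_le_add_left (mul_le_mul_right ih _) _).trans (le_of_eq ?_)
    have h0 : 0 ≤ c * ∑ i ∈ Finset.range n, a ^ i := by positivity
    rw [← ENNReal.ofReal_mul ha, ← ENNReal.ofReal_add (by positivity) hc,
      Finset.sum_range_succ']
    congr 1
    simp only [pow_succ, ← Finset.sum_mul, pow_zero]
    ring

variable {d k : ℕ} {Θ : Type u} [MeasurableSpace Θ] {D : Measure Θ} [IsProbabilityMeasure D]
  {f : Vec d → ℝ} {G : Vec d → Θ → Vec d} {σ : ℝ}

/-- The coupled chain starts with both copies at `s`. -/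
def coupledStart (s : Vec d × Vec d) : CoupledState d := ((s, s), (0, 0))

theorem markovOp_iterate_coupled_fst (hk : k ≤ d)
    (hG : Measurable (Function.uncurry G)) (r η : ℝ) (v : Vec d)
    (lam : ℝ) (s : Vec d × Vec d) {h : Vec d × Vec d → ℝ≥0∞} (hh : Measurable h) (n : ℕ) :
    (markovOp (innovationLaw d k D r) (coupledStep G η v lam s.1))^[n] (fun p => h p.1.1)
      (coupledStart s) = (markovOp (innovationLaw d k D r) (sgdStep G η))^[n] h s := by
  have := isProbabilityMeasure_innovationLaw hk D r
  exact markovOp_iterate_comp (measurable_sgdStep hG η)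
    (pr := fun p : CoupledState d => p.1.1) (MeasurePreserving.id _) (fun _ _ => rfl) hh n _

/-- The second copy is compressed SGD driven by the reflected innovations, which have the same law.
-/
theorem markovOp_iterate_coupled_snd (hk : k ≤ d)
    (hG : Measurable (Function.uncurry G)) (r η : ℝ) {v : Vec d} (hv : ‖v‖ = 1)
    (lam : ℝ) (s : Vec d × Vec d) {h : Vec d × Vec d → ℝ≥0∞} (hh : Measurable h) (n : ℕ) :
    (markovOp (innovationLaw d k D r) (coupledStep G η v lam s.1))^[n] (fun p => h p.1.2)
      (coupledStart s) = (markovOp (innovationLaw d k D r) (sgdStep G η))^[n] h s := by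
  have := isProbabilityMeasure_innovationLaw hk D r
  exact markovOp_iterate_comp (measurable_sgdStep hG η)
    (pr := fun p : CoupledState d => p.1.2) (measurePreserving_reflectNoise hk D r hv)
    (fun _ _ => rfl) hh n _

theorem markovOp_iterate_coupled_model (hk : k ≤ d) (r η : ℝ) {v : Vec d} (hv : ‖v‖ = 1)
    (lam : ℝ) (s : Vec d × Vec d) {h : ℝ → ℝ≥0∞} (hh : Measurable h) (n : ℕ) :
    (markovOp (innovationLaw d k D r) (coupledStep G η v lam s.1))^[n] (fun p => h p.2.1)
      (coupledStart s) = ∫⁻ b, h b ∂gaussianReal 0 (Real.toNNReal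
        (4 * η ^ 2 * (r ^ 2 / d) * ∑ i ∈ Finset.range n, (lam ^ 2) ^ i)) := by
  have := isProbabilityMeasure_innovationLaw hk D r
  rw [← markovOp_iterate_linearModel hk D r η hv lam hh n]
  exact markovOp_iterate_comp (pr := fun p : CoupledState d => p.2.1)
    (by simp only [Function.uncurry_def]; fun_prop) (MeasurePreserving.id _) (fun _ _ => rfl) hh n _

/-- The mean of the accumulated squared distances. -/
theorem markovOp_iterate_coupled_dist (hk : k ≤ d)
    (hG : Measurable (Function.uncurry G)) (r η : ℝ) {v : Vec d} (hv : ‖v‖ = 1)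
    (lam : ℝ) (s : Vec d × Vec d) (n : ℕ) :
    (markovOp (innovationLaw d k D r) (coupledStep G η v lam s.1))^[n]
        (fun p => (p.2.2 : ℝ≥0∞)) (coupledStart s) ≤
      2 * ∑ i ∈ Finset.range n, (markovOp (innovationLaw d k D r) (sgdStep G η))^[i]
        (fun s' => ENNReal.ofReal (‖s'.1 - s.1‖ ^ 2)) s := by
  have := isProbabilityMeasure_innovationLaw hk D r
  have hΦ := measurable_coupledStep hG η v lam s.1
  have hh : Measurable fun s' : Vec d × Vec d => ENNReal.ofReal (‖s'.1 - s.1‖ ^ 2) := by fun_prop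
  induction n with
  | zero => simp [coupledStart]
  | succ n ih =>
    have hle : ∀ p, markovOp (innovationLaw d k D r) (coupledStep G η v lam s.1)
        (fun p => (p.2.2 : ℝ≥0∞)) p ≤ 1 * (p.2.2 : ℝ≥0∞) +
          (ENNReal.ofReal (‖p.1.1.1 - s.1‖ ^ 2) + ENNReal.ofReal (‖p.1.2.1 - s.1‖ ^ 2)) := by
      intro p
      have h2 : ∀ x : Vec d, ENNReal.ofReal (‖x‖ ^ 2) = ((‖x‖₊ ^ 2 : NNReal) : ℝ≥0∞) := by
        intro x
        rw [ENNReal.ofReal_pow (norm_nonneg _), ofReal_norm]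
        simp [enorm_eq_nnnorm]
      simp only [markovOp, coupledStep, lintegral_const, measure_univ, mul_one, one_mul, h2,
        ENNReal.coe_add, le_refl]
    refine (markovOp_iterate_succ_le hΦ (by fun_prop) hle n _).trans ?_
    rw [markovOp_iterate_add hΦ (by fun_prop),
      markovOp_iterate_coupled_fst hk hG r η v lam s hh,
      markovOp_iterate_coupled_snd hk hG r η hv lam s hh, Finset.sum_range_succ, mul_add, one_mul,
      two_mul ((markovOp _ _)^[n] _ s)]
    gcongr

/-- The mean squared difference of the corrected iterates. -/
theorem markovOp_iterate_coupled_diff (hk : k ≤ d)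
    (hG : Measurable (Function.uncurry G)) (r η : ℝ) {v : Vec d} (hv : ‖v‖ = 1)
    (lam : ℝ) (s : Vec d × Vec d) (n : ℕ) :
    (markovOp (innovationLaw d k D r) (coupledStep G η v lam s.1))^[n]
        (fun p => ENNReal.ofReal (‖correctedDiff η p‖ ^ 2)) (coupledStart s) ≤
      4 * (markovOp (innovationLaw d k D r) (sgdStep G η))^[n]
        (fun s' => ENNReal.ofReal (‖corrected η s' - corrected η s‖ ^ 2)) s := by
  have := isProbabilityMeasure_innovationLaw hk D r
  have hΦ := measurable_coupledStep hG η v lam s.1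
  have hcm := measurable_corrected (d := d) η
  have hh : Measurable fun s' : Vec d × Vec d =>
      2 * ENNReal.ofReal (‖corrected η s' - corrected η s‖ ^ 2) := by fun_prop
  have hle : ∀ p : CoupledState d, ENNReal.ofReal (‖correctedDiff η p‖ ^ 2) ≤
      2 * ENNReal.ofReal (‖corrected η p.1.1 - corrected η s‖ ^ 2) +
        2 * ENNReal.ofReal (‖corrected η p.1.2 - corrected η s‖ ^ 2) := by
    intro p
    have h2 : ∀ x : ℝ, 2 * ENNReal.ofReal x = ENNReal.ofReal (2 * x) := fun x => by
      rw [ENNReal.ofReal_mul (by norm_num), ENNReal.ofReal_ofNat]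
    rw [h2, h2, ← ENNReal.ofReal_add (by positivity) (by positivity)]
    refine ENNReal.ofReal_le_ofReal ?_
    have h3 : correctedDiff η p =
        (corrected η p.1.1 - corrected η s) - (corrected η p.1.2 - corrected η s) := by
      simp only [correctedDiff]; abel
    rw [h3]
    have h4 := norm_sub_le (corrected η p.1.1 - corrected η s) (corrected η p.1.2 - corrected η s)
    nlinarith [norm_nonneg ((corrected η p.1.1 - corrected η s) -
      (corrected η p.1.2 - corrected η s)), sq_nonneg (‖corrected η p.1.1 - corrected η s‖ -
      ‖corrected η p.1.2 - corrected η s‖)]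
  refine (markovOp_iterate_mono hle n _).trans (le_of_eq ?_)
  have hm : Measurable fun p : CoupledState d =>
      2 * ENNReal.ofReal (‖corrected η p.1.1 - corrected η s‖ ^ 2) := by fun_prop
  rw [markovOp_iterate_add hΦ hm,
    markovOp_iterate_coupled_fst hk hG r η v lam s hh,
    markovOp_iterate_coupled_snd hk hG r η hv lam s hh,
    markovOp_iterate_const_mul (measurable_sgdStep hG η) (by fun_prop), ← add_mul]
  norm_num

/-- Either the coupled copies have moved or separated, or the linear model is small, or it
deviates from the difference of the copies. -/
theorem one_le_escape_alternatives {C η M s₂ : ℝ} (hC : 0 ≤ C) (hM : 0 < M)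
    (hs : 0 < s₂) {v : Vec d} (hv : ‖v‖ = 1) (p : CoupledState d) :
    1 ≤ ENNReal.ofReal C * p.2.2 +
      (ENNReal.ofReal (64 / s₂) * ENNReal.ofReal (‖correctedDiff η p‖ ^ 2) +
      (Set.indicator {b : ℝ | |b| < √s₂ / 4} (fun _ => 1) p.2.1 +
      ENNReal.ofReal (64 * Real.exp 1 / (s₂ * M)) * coupledPotential C η M v p)) := by
  by_cases h1 : 1 ≤ C * p.2.2
  · refine le_add_right ?_
    rw [← ENNReal.ofReal_coe_nnreal, ← ENNReal.ofReal_mul hC]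
    simpa using h1
  refine le_add_left ?_
  by_cases h2 : s₂ / 64 ≤ ‖correctedDiff η p‖ ^ 2
  · refine le_add_right ?_
    rw [← ENNReal.ofReal_mul (by positivity)]
    rw [ENNReal.one_le_ofReal]
    rw [div_mul_eq_mul_div, le_div_iff₀ hs]
    linarith
  refine le_add_left ?_
  by_cases h3 : |p.2.1| < √s₂ / 4
  · refine le_add_right ?_
    rw [Set.indicator_of_mem (by exact h3)]
  refine le_add_left ?_
  push Not at h1 h2 h3
  have hsq : 0 < √s₂ := Real.sqrt_pos.2 hs
  have hss : √s₂ ^ 2 = s₂ := Real.sq_sqrt hs.le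
  have h4 : ‖correctedDiff η p‖ < √s₂ / 8 := by
    refine lt_of_pow_lt_pow_left₀ 2 (by positivity) ?_
    rw [div_pow, hss]
    linarith
  have h5 : |inner ℝ v (correctedDiff η p)| ≤ ‖correctedDiff η p‖ := by
    simpa [hv] using abs_real_inner_le_norm v (correctedDiff η p)
  have h6 : √s₂ / 8 ≤ |modelDeviation η v p| := by
    -- The model is at least √s₂/4 and the actual difference less than √s₂/8 in absolute value, so
    -- the deviation is at least √s₂/8.
    have := abs_sub_abs_le_abs_sub p.2.1 (inner ℝ v (correctedDiff η p))
    rw [abs_sub_comm] at this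
    simp only [modelDeviation]
    linarith
  have h7 : s₂ / 64 ≤ modelDeviation η v p ^ 2 := by
    rw [← sq_abs]
    calc s₂ / 64 = (√s₂ / 8) ^ 2 := by rw [div_pow, hss]; norm_num
      _ ≤ _ := by gcongr
  -- The first alternative has been excluded, so Cq < 1 and the weight is at least 1/e.
  have h8 : ENNReal.ofReal (Real.exp (-1) * (M * (s₂ / 64))) ≤ coupledPotential C η M v p := by
    rw [coupledPotential, ENNReal.ofReal_mul (Real.exp_nonneg _), ENNReal.ofReal_mul hM.le]
    refine mul_le_mul' (ENNReal.ofReal_le_ofReal (Real.exp_le_exp.2 (by linarith))) ?_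
    exact le_add_left (mul_le_mul_right (ENNReal.ofReal_le_ofReal h7) _)
  refine le_trans ?_ (mul_le_mul_right h8 _)
  rw [← ENNReal.ofReal_mul (by positivity), ENNReal.one_le_ofReal]
  have h9 : Real.exp 1 * Real.exp (-1) = 1 := by rw [← Real.exp_add]; simp
  refine le_of_eq ?_
  calc (1 : ℝ) = Real.exp 1 * Real.exp (-1) := h9.symm
    _ = _ := by field_simp

/-- The probability that the linear model is small. -/
theorem lintegral_indicator_gaussianReal_le {s₂ : ℝ} (hs : 0 < s₂) :
    ∫⁻ b, Set.indicator {b : ℝ | |b| < √s₂ / 4} (fun _ => 1) b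
      ∂gaussianReal 0 (Real.toNNReal s₂) ≤ ENNReal.ofReal (1 / 4) := by
  have hm : MeasurableSet {b : ℝ | |b| < √s₂ / 4} := by measurability
  rw [lintegral_indicator hm, setLIntegral_one]
  exact gaussianReal_abs_lt_le hs

/-- If Ψ < R, the four alternatives contribute at most 1/8, 1/8, 1/4 and 1/8, a total below 1. The
bound M ≥ 100000 is what makes the last one, 64e · 61/M, at most 1/8. -/
theorem ofReal_le_of_one_le_escape {C R s₂ M : ℝ} {I : ℕ} {Ψ : ℝ≥0∞} (hC : 0 ≤ C) (hR : 0 < R)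
    (hs : 0 < s₂) (hM : 100000 ≤ M) (hCR : C * (2 * (I * R)) = 1 / 8) (hsR : 2048 * R ≤ s₂)
    (hone : 1 ≤ ENNReal.ofReal C * (2 * (I * Ψ)) +
      (ENNReal.ofReal (64 / s₂) * (4 * Ψ) + (ENNReal.ofReal (1 / 4) +
      ENNReal.ofReal (64 * Real.exp 1 / (s₂ * M)) * ENNReal.ofReal (61 * s₂)))) :
    ENNReal.ofReal R ≤ Ψ := by
  by_contra! hlt
  have hM0 : 0 < M := by linarith
  have hΨt : Ψ ≠ ∞ := (hlt.trans ENNReal.ofReal_lt_top).ne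
  lift Ψ to NNReal using hΨt
  obtain ⟨y, hy⟩ : ∃ y : ℝ, y = Ψ := ⟨_, rfl⟩
  have hy0 : 0 ≤ y := hy ▸ Ψ.coe_nonneg
  have hΨy : (Ψ : ℝ≥0∞) = ENNReal.ofReal y := by rw [hy, ENNReal.ofReal_coe_nnreal]
  rw [hΨy] at hlt hone
  have hyR : y < R := (ENNReal.ofReal_lt_ofReal_iff hR).1 hlt
  have f1 : ENNReal.ofReal C * (2 * ((I : ℝ≥0∞) * ENNReal.ofReal y)) =
      ENNReal.ofReal (C * (2 * (I * y))) := by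
    rw [ENNReal.ofReal_mul hC, ENNReal.ofReal_mul (by norm_num), ENNReal.ofReal_mul (by positivity),
      ENNReal.ofReal_ofNat, ENNReal.ofReal_natCast]
  have f2 : ENNReal.ofReal (64 / s₂) * (4 * ENNReal.ofReal y) =
      ENNReal.ofReal (64 / s₂ * (4 * y)) := by
    rw [ENNReal.ofReal_mul (by positivity), ENNReal.ofReal_mul (by norm_num),
      ENNReal.ofReal_ofNat]
  rw [f1, f2, ← ENNReal.ofReal_mul (by positivity), ← ENNReal.ofReal_add (by positivity)
    (by positivity), ← ENNReal.ofReal_add (by positivity) (by positivity),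
    ← ENNReal.ofReal_add (by positivity) (by positivity), ENNReal.one_le_ofReal] at hone
  have g1 : C * (2 * (I * y)) ≤ 1 / 8 := by
    rw [← hCR]
    gcongr
  have g2 : 64 / s₂ * (4 * y) ≤ 1 / 8 := by
    rw [div_mul_eq_mul_div, div_le_iff₀ hs]
    linarith
  have g3 : 64 * Real.exp 1 / (s₂ * M) * (61 * s₂) ≤ 1 / 8 := by
    have : 64 * Real.exp 1 / (s₂ * M) * (61 * s₂) = 3904 * Real.exp 1 / M := by
      field_simp; norm_num
    rw [this, div_le_iff₀ hM0]
    linarith [Real.exp_one_lt_d9]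
  linarith

/-- From a point with a sufficiently negative curvature, compressed SGD moves. -/
theorem StochasticGradient.le_blockDisplacement (hG : StochasticGradient D f G σ)
    {fmax L ρ : ℝ} (hf : SmoothObjective f fmax L ρ) (hL : 0 < L) (hρ : 0 < ρ) (hd : 1 ≤ d)
    (hk : k ≤ d) {ℓ τ : ℝ} (hτ : 0 ≤ τ) (hvar : GradientDiffVariance D f G ℓ τ) {r : ℝ}
    (hr : 0 < r) {η μ : ℝ} (hη : 0 < η) (hμ : μ = k / d) (hμ0 : 0 < μ) (hηL : η * L ≤ 1)
    {I : ℕ} (hI : 1 ≤ I) {M : ℝ} (hM : 100000 ≤ M)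
    (h1 : 8 * (M + 1) * I * η ^ 2 * L ^ 2 ≤ μ) (h2 : 2 * (M + 2) * η ^ 2 * ℓ ^ 2 * I ≤ 1)
    (h3 : (M + 2) * τ ≤ r ^ 2 / d) {g : ℝ} (hg : 0 ≤ g)
    (h4 : 4 / ((M + 1) * (I * η * ρ) ^ 2) ≤ η ^ 2 * (r ^ 2 / d) * (1 + η * g) ^ (2 * (I - 1)))
    (s : Vec d × Vec d) {lam : ℝ}
    (hlam : Module.End.HasEigenvalue (fderiv ℝ (∇ f) s.1 : Vec d →ₗ[ℝ] Vec d) lam)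
    (hlg : lam < -g) :
    ENNReal.ofReal (1 / (128 * (M + 1) * (I * η * ρ) ^ 2)) ≤
      blockDisplacement (innovationLaw d k D r) G η I s := by
  obtain ⟨γ, v, hgγ, -, hv, hHv, hexp⟩ := hf.exists_min_eigenvector hL.le hlam hg hlg
  have hprob := isProbabilityMeasure_innovationLaw hk D r
  have hI0 : (0 : ℝ) < I := by exact_mod_cast hI
  have hd0 : (0 : ℝ) < d := by exact_mod_cast hd
  have hγ : 0 ≤ γ := hg.trans hgγ.le
  have hM0 : 0 < M := by linarith
  -- Chosen so that C · 2I · R₂ = 1/8. Hypothesis `h4` then gives s₂ ≥ 2048 R₂ from the last term of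
  -- the geometric sum in s₂ alone.
  set R₂ : ℝ := 1 / (128 * (M + 1) * (I * η * ρ) ^ 2) with hR
  have hR0 : 0 < R₂ := by positivity
  set C : ℝ := 8 * (M + 1) * I * η ^ 2 * ρ ^ 2 with hC
  have hC0 : 0 ≤ C := by positivity
  set l : ℝ := 1 + η * γ with hl
  have hl1 : 0 < l := by positivity
  set s₂ : ℝ := 4 * η ^ 2 * (r ^ 2 / d) * ∑ i ∈ Finset.range I, (l ^ 2) ^ i with hs₂
  have hsum : (1 + η * g) ^ (2 * (I - 1)) ≤ ∑ i ∈ Finset.range I, (l ^ 2) ^ i := by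
    have hlg : 1 + η * g ≤ l := by rw [hl]; gcongr
    calc (1 + η * g) ^ (2 * (I - 1)) ≤ l ^ (2 * (I - 1)) := by gcongr
      _ = (l ^ 2) ^ (I - 1) := pow_mul _ _ _
      _ ≤ _ := Finset.single_le_sum (f := fun i => (l ^ 2) ^ i) (fun i _ => by positivity)
          (Finset.mem_range.2 (by omega))
  have hs₂R : 2048 * R₂ ≤ s₂ := by
    have e1 : 2048 * R₂ = 4 * (4 / ((M + 1) * (I * η * ρ) ^ 2)) := by
      rw [hR]; field_simp; norm_num
    have e2 : η ^ 2 * (r ^ 2 / d) * (1 + η * g) ^ (2 * (I - 1)) ≤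
        η ^ 2 * (r ^ 2 / d) * ∑ i ∈ Finset.range I, (l ^ 2) ^ i := by gcongr
    rw [e1, hs₂]
    linarith
  have hs0 : 0 < s₂ := by linarith
  set Q := markovOp (innovationLaw d k D r) (coupledStep G η v l s.1) with hQ
  set Ψ := blockDisplacement (innovationLaw d k D r) G η I s with hΨ
  have hΦ := measurable_coupledStep hG.measurable η v l s.1
  have hVm := measurable_coupledPotential C η M v
  have hwm : Measurable fun p : CoupledState d => ENNReal.ofReal (‖correctedDiff η p‖ ^ 2) := by
    have := measurable_correctedDiff (d := d) η
    fun_prop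
  have hqm : Measurable fun p : CoupledState d => (p.2.2 : ℝ≥0∞) := by fun_prop
  have hset : MeasurableSet {b : ℝ | |b| < √s₂ / 4} := by measurability
  have him : Measurable (Set.indicator {b : ℝ | |b| < √s₂ / 4} (fun _ => (1 : ℝ≥0∞))) :=
    measurable_const.indicator hset
  have q1 : Q^[I] (fun p => (p.2.2 : ℝ≥0∞)) (coupledStart s) ≤ 2 * (I * Ψ) := by
    refine (markovOp_iterate_coupled_dist hk hG.measurable r η hv l s I).trans ?_
    refine mul_le_mul_right ?_ _
    have hI1 : (I : ℝ≥0∞) ≠ 0 := by exact_mod_cast (by omega : I ≠ 0)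
    have hle : (I : ℝ≥0∞)⁻¹ * ∑ i ∈ Finset.range I,
        (markovOp (innovationLaw d k D r) (sgdStep G η))^[i]
          (fun s' => ENNReal.ofReal (‖s'.1 - s.1‖ ^ 2)) s ≤ Ψ := le_self_add
    calc _ = (I : ℝ≥0∞) * ((I : ℝ≥0∞)⁻¹ * ∑ i ∈ Finset.range I,
        (markovOp (innovationLaw d k D r) (sgdStep G η))^[i]
          (fun s' => ENNReal.ofReal (‖s'.1 - s.1‖ ^ 2)) s) := by
          rw [← mul_assoc, ENNReal.mul_inv_cancel hI1 (ENNReal.natCast_ne_top I), one_mul]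
      _ ≤ _ := mul_le_mul_right hle _
  have q2 : Q^[I] (fun p => ENNReal.ofReal (‖correctedDiff η p‖ ^ 2)) (coupledStart s) ≤ 4 * Ψ :=
    (markovOp_iterate_coupled_diff hk hG.measurable r η hv l s I).trans
      (mul_le_mul_right le_add_self _)
  have q3 : Q^[I] (fun p => Set.indicator {b : ℝ | |b| < √s₂ / 4} (fun _ => 1) p.2.1)
      (coupledStart s) ≤ ENNReal.ofReal (1 / 4) := by
    rw [hQ, markovOp_iterate_coupled_model hk r η hv l s him, ← hs₂]
    exact lintegral_indicator_gaussianReal_le hs0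
  have q4 : Q^[I] (coupledPotential C η M v) (coupledStart s) ≤ ENNReal.ofReal (61 * s₂) := by
    refine (markovOp_iterate_le_geom_sum hΦ hVm (by positivity) (by positivity)
      (fun p => hG.markovOp_coupledPotential_le hf hL hρ.le hd hk hτ hvar r hη hμ hμ0 hηL hI
        hM0.le h1 h2 h3 hγ hv hHv hexp hC p) ?_ I).trans (ENNReal.ofReal_le_ofReal ?_)
    · simp [coupledPotential, coupledStart, correctedDiff, errorDiff, modelDeviation]
    -- The factor (1 + 3/I) costs at most 27 over the block. Thus the noise 9 becomes 243, compared
    -- with the 4 in s₂: 243/4 ≤ 61.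
    · have e1 : ∀ i ∈ Finset.range I, ((1 + 3 / (I : ℝ)) * l ^ 2) ^ i ≤ 27 * (l ^ 2) ^ i := by
        intro i hi
        rw [mul_pow]
        refine mul_le_mul_of_nonneg_right ?_ (by positivity)
        have e2 : 1 + 3 / (I : ℝ) ≤ (1 + 1 / (I : ℝ)) ^ 3 := by
          have e3 : 0 ≤ 1 / (I : ℝ) := by positivity
          have e4 : 3 / (I : ℝ) = 3 * (1 / I) := by ring
          rw [e4]
          nlinarith [pow_nonneg e3 3, pow_nonneg e3 2]
        calc (1 + 3 / (I : ℝ)) ^ i ≤ ((1 + 1 / (I : ℝ)) ^ 3) ^ i := by gcongr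
          _ = ((1 + 1 / (I : ℝ)) ^ i) ^ 3 := by rw [← pow_mul, ← pow_mul, mul_comm]
          _ ≤ 3 ^ 3 := by
              gcongr
              exact one_add_inv_pow_le_three hI (Finset.mem_range.1 hi).le
          _ = 27 := by norm_num
      calc 9 * η ^ 2 * (r ^ 2 / d) * ∑ i ∈ Finset.range I, ((1 + 3 / (I : ℝ)) * l ^ 2) ^ i
          ≤ 9 * η ^ 2 * (r ^ 2 / d) * ∑ i ∈ Finset.range I, 27 * (l ^ 2) ^ i := by
            gcongr with i hi
            exact e1 i hi
        _ = 243 / 4 * s₂ := by rw [hs₂, ← Finset.mul_sum]; ring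
        _ ≤ 61 * s₂ := by linarith
  have hone : (1 : ℝ≥0∞) ≤ ENNReal.ofReal C * (2 * (I * Ψ)) +
      (ENNReal.ofReal (64 / s₂) * (4 * Ψ) + (ENNReal.ofReal (1 / 4) +
      ENNReal.ofReal (64 * Real.exp 1 / (s₂ * M)) * ENNReal.ofReal (61 * s₂))) := by
    have e1 := markovOp_iterate_mono (ν := innovationLaw d k D r)
      (Φ := coupledStep G η v l s.1) (one_le_escape_alternatives (η := η) hC0 hM0 hs0 hv) I
      (coupledStart s)
    rw [markovOp_iterate_const] at e1
    refine e1.trans ?_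
    have hind : Measurable fun p : CoupledState d =>
        Set.indicator {b : ℝ | |b| < √s₂ / 4} (fun _ => (1 : ℝ≥0∞)) p.2.1 :=
      him.comp (by fun_prop)
    rw [markovOp_iterate_add hΦ (hqm.const_mul _), markovOp_iterate_add hΦ (hwm.const_mul _),
      markovOp_iterate_add hΦ hind, markovOp_iterate_const_mul hΦ hqm,
      markovOp_iterate_const_mul hΦ hwm, markovOp_iterate_const_mul hΦ hVm]
    gcongr
  exact ofReal_le_of_one_le_escape hC0 hR0 hs0 hM (by rw [hC, hR]; field_simp; norm_num) hs₂R hone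

end Escape

/-! ### Variance of differences of stochastic gradients. -/

section GradientDiffVariance

variable {d : ℕ} {Θ : Type u} [MeasurableSpace Θ] {D : Measure Θ} [IsProbabilityMeasure D]
  {f : Vec d → ℝ} {G : Vec d → Θ → Vec d} {σ : ℝ}

/-- The difference of two Lipschitz stochastic gradients has a small variance. -/
theorem StochasticGradient.gradientDiffVariance_of_lipschitz (hG : StochasticGradient D f G σ)
    {ℓ : ℝ≥0∞} (hℓ : ℓ ≠ ∞) (hlip : LipschitzStochasticGradient G ℓ) :
    GradientDiffVariance D f G ℓ.toReal 0 := by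
  intro x x'
  obtain ⟨h1, h2⟩ := integral_norm_const_add_sq (hG.memLp_sub x x') (hG.integral_sub x x') 0
  simp only [zero_add] at h1 h2
  have h3 : ∫ θ, ‖G x θ - G x' θ‖ ^ 2 ∂D ≤ (ℓ.toReal * ‖x - x'‖) ^ 2 := by
    have h4 : ∀ θ, ‖G x θ - G x' θ‖ ^ 2 ≤ (ℓ.toReal * ‖x - x'‖) ^ 2 := by
      intro θ
      refine pow_le_pow_left₀ (norm_nonneg _) ?_ 2
      have h5 := ENNReal.toReal_mono (ENNReal.mul_ne_top hℓ (edist_ne_top _ _)) (hlip x x' θ)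
      rwa [ENNReal.toReal_mul, edist_dist, edist_dist, ENNReal.toReal_ofReal dist_nonneg,
        ENNReal.toReal_ofReal dist_nonneg, dist_eq_norm, dist_eq_norm] at h5
    calc ∫ θ, ‖G x θ - G x' θ‖ ^ 2 ∂D ≤ ∫ _, (ℓ.toReal * ‖x - x'‖) ^ 2 ∂D :=
          integral_mono h1 (integrable_const _) h4
      _ = _ := by simp
  rw [mul_pow] at h3
  linarith [sq_nonneg ‖∇ f x - ∇ f x'‖]

/-- The difference of two stochastic gradients has a bounded variance. -/
theorem StochasticGradient.gradientDiffVariance (hG : StochasticGradient D f G σ) :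
    GradientDiffVariance D f G 0 (4 * σ ^ 2) := by
  intro x x'
  have h1 := (hG.memLp_sub x x').sub (memLp_const (p := 2) (μ := D) (∇ f x - ∇ f x'))
  have h2 : Integrable (fun θ => ‖G x θ - G x' θ - (∇ f x - ∇ f x')‖ ^ 2) D :=
    (memLp_two_iff_integrable_sq_norm h1.1).1 h1
  have h3 : ∀ θ, ‖G x θ - G x' θ - (∇ f x - ∇ f x')‖ ^ 2 ≤
      2 * ‖G x θ - ∇ f x‖ ^ 2 + 2 * ‖G x' θ - ∇ f x'‖ ^ 2 := by
    intro θ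
    have h4 : G x θ - G x' θ - (∇ f x - ∇ f x') = (G x θ - ∇ f x) - (G x' θ - ∇ f x') := by abel
    rw [h4]
    have h5 := norm_sub_le (G x θ - ∇ f x) (G x' θ - ∇ f x')
    nlinarith [norm_nonneg ((G x θ - ∇ f x) - (G x' θ - ∇ f x')),
      sq_nonneg (‖G x θ - ∇ f x‖ - ‖G x' θ - ∇ f x'‖)]
  have h6 := integral_mono h2 (((hG.integrable_sq x).const_mul 2).add
    ((hG.integrable_sq x').const_mul 2)) h3
  simp only [Pi.add_apply] at h6
  rw [integral_add ((hG.integrable_sq x).const_mul 2) ((hG.integrable_sq x').const_mul 2),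
    integral_const_mul, integral_const_mul] at h6
  linarith [hG.variance_le x, hG.variance_le x']

end GradientDiffVariance

/-! ### Counting second-order stationary points. -/

section Counting

variable {d : ℕ} {f : Vec d → ℝ} {ρ ε : ℝ}

theorem le_sospCount_add_sum {Y : ℕ → ℝ≥0∞} {x : ℕ → Vec d}
    (hY : ∀ t, ¬ IsSOSP f ρ ε (x t) → 1 ≤ Y t) (T : ℕ) :
    (T : ℝ≥0∞) ≤ sospCount f ρ ε x T + ∑ t ∈ Finset.range T, Y t := by
  classical
  have h1 : sospCount f ρ ε x T =
      ((Finset.range T).filter fun t => IsSOSP f ρ ε (x t)).card := by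
    rw [sospCount, ← Set.ncard_coe_finset]
    congr 1
    ext t
    simp
  have h2 := Finset.card_filter_add_card_filter_not (s := Finset.range T)
    (fun t => IsSOSP f ρ ε (x t))
  rw [Finset.card_range] at h2
  have h3 : (((Finset.range T).filter fun t => ¬ IsSOSP f ρ ε (x t)).card : ℝ≥0∞) ≤
      ∑ t ∈ Finset.range T, Y t := by
    calc (((Finset.range T).filter fun t => ¬ IsSOSP f ρ ε (x t)).card : ℝ≥0∞)
        = ∑ t ∈ (Finset.range T).filter fun t => ¬ IsSOSP f ρ ε (x t), 1 := by simp
      _ ≤ ∑ t ∈ (Finset.range T).filter fun t => ¬ IsSOSP f ρ ε (x t), Y t :=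
          Finset.sum_le_sum fun t ht => hY t (Finset.mem_filter.1 ht).2
      _ ≤ _ := Finset.sum_le_sum_of_subset (Finset.filter_subset _ _)
  rw [h1]
  calc (T : ℝ≥0∞) = (((Finset.range T).filter fun t => IsSOSP f ρ ε (x t)).card : ℝ≥0∞) +
        ((Finset.range T).filter fun t => ¬ IsSOSP f ρ ε (x t)).card := by exact_mod_cast h2.symm
    _ ≤ _ := by gcongr

end Counting

/-! ### From mean bounds to a high-probability bound; communication. -/

section Probability

variable {d k : ℕ} {Θ : Type u} [MeasurableSpace Θ] {D : Measure Θ} [IsProbabilityMeasure D]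
  {f : Vec d → ℝ} {G : Vec d → Θ → Vec d} {σ : ℝ}

theorem measurable_blockBound (hk : k ≤ d) (hG : Measurable (Function.uncurry G))
    (hf : Measurable (∇ f)) (r η n : ℝ) (I : ℕ) :
    Measurable (blockBound (innovationLaw d k D r) f G η n I) := by
  have := isProbabilityMeasure_innovationLaw hk D r
  unfold blockBound
  refine Measurable.add (Finset.measurable_sum _ fun j _ => ?_) (by fun_prop)
  exact measurable_markovOp_iterate (measurable_sgdStep hG η) (by fun_prop) j

/-- If the bound on the mean number of points that are not second-order stationary is small,
then most points are second-order stationary with high probability. -/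
theorem StochasticGradient.one_sub_le_sospCount (hG : StochasticGradient D f G σ)
    {fmax L ρ : ℝ} (hf : SmoothObjective f fmax L ρ) (hL : 0 < L) (hρ : 0 < ρ) (hd : 1 ≤ d)
    (hk : k ≤ d) {ℓ τ : ℝ} (hτ : 0 ≤ τ) (hvar : GradientDiffVariance D f G ℓ τ) {r : ℝ}
    (hr : 0 < r) {η μ : ℝ} (hη : 0 < η) (hμ : μ = k / d) (hμ0 : 0 < μ) (hημ : η * L ≤ μ / 8)
    {I : ℕ} (hI : 1 ≤ I) {M : ℝ} (hM : 100000 ≤ M)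
    (h1 : 8 * (M + 1) * I * η ^ 2 * L ^ 2 ≤ μ) (h2 : 2 * (M + 2) * η ^ 2 * ℓ ^ 2 * I ≤ 1)
    (h3 : (M + 2) * τ ≤ r ^ 2 / d) {ε : ℝ} (hε : 0 < ε)
    (h4 : 4 / ((M + 1) * (I * η * ρ) ^ 2) ≤
      η ^ 2 * (r ^ 2 / d) * (1 + η * √(ρ * ε)) ^ (2 * (I - 1)))
    {δ : ℝ} (hδ : 0 < δ) {T : ℕ} (hT : 1 ≤ T)
    (h5 : 4 / (η * ε ^ 2) * (fmax + T * (L * η ^ 2 * (σ ^ 2 + r ^ 2))) +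
      128 * (M + 1) * (I * η * ρ) ^ 2 * ((12 / (η * L ^ 2) + 96 * I ^ 2 * η) *
        (fmax + (T + I) * (L * η ^ 2 * (σ ^ 2 + r ^ 2))) +
        T * (12 * I * η ^ 2 * (σ ^ 2 + r ^ 2))) ≤ δ ^ 2 * T)
    {Ω : Type v} [MeasurableSpace Ω] {P : Measure Ω} [IsProbabilityMeasure P]
    {ξ : ℕ → Ω → Vec d} {θ : ℕ → Ω → Θ} {S : ℕ → Ω → Finset (Fin d)}
    (hS : IsSampling P D k r ξ θ S) (x₀ : Vec d) :
    1 - δ ≤ P.real {ω | (1 - δ) * T ≤ sospCount f ρ ε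
      (fun t => (compressedSGD keepCoords G η x₀
        (fun s => ξ s ω) (fun s => θ s ω) (fun s => S s ω) t).1) T} := by
  have hprob := isProbabilityMeasure_innovationLaw hk D r
  have hI0 : (0 : ℝ) < I := by exact_mod_cast hI
  have hT0 : (0 : ℝ) < T := by exact_mod_cast hT
  have hfmax : 0 ≤ fmax := (abs_nonneg _).trans (hf.bounded x₀ x₀)
  have hd0 : (0 : ℝ) < d := by exact_mod_cast hd
  have hμ1 : μ ≤ 1 := by
    rw [hμ, div_le_one hd0]
    exact_mod_cast hk
  have hgm : Measurable (∇ f) := hf.continuous_gradient.measurable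
  set ν := innovationLaw d k D r with hν
  set R₂ : ℝ := 128 * (M + 1) * (I * η * ρ) ^ 2 with hR
  have hR0 : 0 < R₂ := by positivity
  set B := blockBound ν f G η (σ ^ 2 + r ^ 2) I with hB
  have hBm : Measurable B := measurable_blockBound hk hG.measurable hgm r η _ I
  -- This function is at least 1 off the ε-SOSPs. The first term detects a large gradient, as
  -- 4/(ηε²) · η/4 · ε² = 1; the second detects negative curvature, since R₂ is the inverse of the
  -- lower bound for the displacement.
  set h : Vec d × Vec d → ℝ≥0∞ := fun s =>
    ENNReal.ofReal (4 / (η * ε ^ 2)) * ENNReal.ofReal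
      (η / 4 * ‖∇ f s.1‖ ^ 2 + η ^ 3 * L ^ 2 / 2 * ‖s.2‖ ^ 2) + ENNReal.ofReal R₂ * B s with hh
  have hφm : Measurable fun s : Vec d × Vec d => ENNReal.ofReal
      (η / 4 * ‖∇ f s.1‖ ^ 2 + η ^ 3 * L ^ 2 / 2 * ‖s.2‖ ^ 2) := by fun_prop
  have hhm : Measurable h := (hφm.const_mul _).add (hBm.const_mul _)
  have hpt : ∀ s : Vec d × Vec d, ¬ IsSOSP f ρ ε s.1 → 1 ≤ h s := by
    intro s hs
    rw [IsSOSP, not_and_or] at hs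
    rcases hs with hs | hs
    · refine le_add_right ?_
      rw [← ENNReal.ofReal_mul (by positivity), ENNReal.one_le_ofReal]
      have e1 : ε ^ 2 ≤ ‖∇ f s.1‖ ^ 2 := by
        push Not at hs
        gcongr
      have e2 : 0 ≤ η ^ 3 * L ^ 2 / 2 * ‖s.2‖ ^ 2 := by positivity
      rw [div_mul_eq_mul_div, le_div_iff₀ (by positivity)]
      nlinarith
    · push Not at hs
      obtain ⟨lam, hlam, hlt⟩ := hs
      refine le_add_left ?_
      have e1 := hG.le_blockDisplacement hf hL hρ hd hk hτ hvar hr hη hμ hμ0 (by linarith) hI hM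
        h1 h2 h3 (Real.sqrt_nonneg _) h4 s hlam hlt
      have e2 := e1.trans (hG.blockDisplacement_le hgm hd hk r η hI s)
      refine le_trans ?_ (mul_le_mul_right e2 _)
      rw [← ENNReal.ofReal_mul hR0.le, ← hR, mul_one_div_cancel hR0.ne', ENNReal.ofReal_one]
  set x : ℕ → Ω → Vec d × Vec d := fun t ω => compressedSGD keepCoords G η x₀
        (fun s => ξ s ω) (fun s => θ s ω) (fun s => S s ω) t with hx
  have hchain := fun t => lintegral_chain_eq (ν := ν) (measurable_sgdStep hG.measurable η)
    (fun t => (hS.measurable_noise t).prodMk ((hS.measurable_seed t).prodMk (hS.measurable_coords t)))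
    hS.indep hS.law (x := x) (s₀ := (x₀, 0)) (fun _ => rfl) (fun _ _ => rfl) hhm t
  have hxm : ∀ t, Measurable fun ω => h (x t ω) := fun t => hhm.comp (hchain t).1
  have hYm : Measurable fun ω => ∑ t ∈ Finset.range T, h (x t ω) :=
    Finset.measurable_sum _ fun t _ => hxm t
  have hmean : ∫⁻ ω, ∑ t ∈ Finset.range T, h (x t ω) ∂P ≤ ENNReal.ofReal (δ ^ 2 * T) := by
    rw [lintegral_finsetSum _ fun t _ => hxm t]
    simp only [(hchain _).2]
    have e1 : ∀ t, (markovOp ν (sgdStep G η))^[t] h (x₀, 0) =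
        ENNReal.ofReal (4 / (η * ε ^ 2)) * (markovOp ν (sgdStep G η))^[t] (fun s => ENNReal.ofReal
          (η / 4 * ‖∇ f s.1‖ ^ 2 + η ^ 3 * L ^ 2 / 2 * ‖s.2‖ ^ 2)) (x₀, 0) +
        ENNReal.ofReal R₂ * (markovOp ν (sgdStep G η))^[t] B (x₀, 0) := by
      intro t
      have hΦ := measurable_sgdStep hG.measurable η
      rw [hh, markovOp_iterate_add hΦ (hφm.const_mul _), markovOp_iterate_const_mul hΦ hφm,
        markovOp_iterate_const_mul hΦ hBm]
    simp only [e1]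
    rw [Finset.sum_add_distrib, ← Finset.mul_sum, ← Finset.mul_sum]
    refine (add_le_add (mul_le_mul_right (hG.sum_gradient_sq_add_error_sq_le hf hL hd hk r hη hμ hμ0
      hημ x₀ T) _) (mul_le_mul_right (hG.sum_blockBound_le hf hL hd hk r hη hμ hμ0
      hημ x₀ hI T) _)).trans ?_
    rw [← ENNReal.ofReal_mul (by positivity), ← ENNReal.ofReal_mul hR0.le,
      ← ENNReal.ofReal_add (by positivity) (by positivity)]
    exact ENNReal.ofReal_le_ofReal h5
  have hsub : {ω | (1 - δ) * T ≤ sospCount f ρ ε (fun t => (x t ω).1) T}ᶜ ⊆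
      {ω | ENNReal.ofReal (δ * T) ≤ ∑ t ∈ Finset.range T, h (x t ω)} := by
    intro ω hω
    simp only [Set.mem_compl_iff, Set.mem_ofPred_eq, not_le] at hω ⊢
    have e1 := le_sospCount_add_sum (f := f) (ρ := ρ) (ε := ε) (Y := fun t => h (x t ω))
      (x := fun t => (x t ω).1) (fun t ht => hpt _ ht) T
    by_contra! hlt
    have e2 : (T : ℝ≥0∞) < ENNReal.ofReal T := by
      calc (T : ℝ≥0∞) ≤ _ := e1
        _ < ENNReal.ofReal (sospCount f ρ ε (fun t => (x t ω).1) T) + ENNReal.ofReal (δ * T) := by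
            rw [ENNReal.ofReal_natCast]
            exact ENNReal.add_lt_add_left (ENNReal.natCast_ne_top _) hlt
        _ = ENNReal.ofReal (sospCount f ρ ε (fun t => (x t ω).1) T + δ * T) :=
            (ENNReal.ofReal_add (by positivity) (by positivity)).symm
        _ ≤ ENNReal.ofReal T := ENNReal.ofReal_le_ofReal (by linarith)
    rw [ENNReal.ofReal_natCast] at e2
    exact lt_irrefl _ e2
  -- Markov's inequality at level δT, for a sum with mean at most δ²T.
  have hbad : P {ω | (1 - δ) * T ≤ sospCount f ρ ε (fun t => (x t ω).1) T}ᶜ ≤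
      ENNReal.ofReal δ := by
    refine (measure_mono hsub).trans ?_
    have e1 := (mul_meas_ge_le_lintegral (μ := P) hYm (ENNReal.ofReal (δ * T))).trans hmean
    have e2 : ENNReal.ofReal (δ ^ 2 * T) = ENNReal.ofReal (δ * T) * ENNReal.ofReal δ := by
      rw [← ENNReal.ofReal_mul (by positivity)]
      congr 1
      ring
    rw [e2] at e1
    exact (ENNReal.mul_le_mul_iff_right (by simpa using mul_pos hδ hT0) ENNReal.ofReal_ne_top).1 e1
  set A := {ω | (1 - δ) * T ≤ sospCount f ρ ε (fun t => (x t ω).1) T} with hA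
  have e1 : P.real Aᶜ ≤ δ := ENNReal.toReal_le_of_le_ofReal hδ.le hbad
  have e2 : 1 ≤ P.real A + P.real Aᶜ := by
    have := measureReal_union_le (μ := P) A Aᶜ
    rwa [Set.union_compl_self, probReal_univ] at this
  linarith

/-- The communication with the RandomK compressor. -/
theorem IsSampling.ae_commPerWorker_eq {D : Measure Θ} [IsProbabilityMeasure D] (hk : k ≤ d) {r : ℝ}
    {Ω : Type v} [MeasurableSpace Ω]
    {P : Measure Ω} {ξ : ℕ → Ω → Vec d} {θ : ℕ → Ω → Θ} {S : ℕ → Ω → Finset (Fin d)}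
    (hS : IsSampling P D k r ξ θ S) (T : ℕ) :
    ∀ᵐ ω ∂P, commPerWorker (fun s => S s ω) T = T * (2 * k) := by
  have hprob := isProbabilityMeasure_innovationLaw hk D r
  have := isProbabilityMeasure_randomKLaw hk
  have h1 : ∀ t, ∀ᵐ ω ∂P, (S t ω).card = k := by
    intro t
    have hz : Measurable fun ω => (ξ t ω, θ t ω, S t ω) :=
      (hS.measurable_noise t).prodMk ((hS.measurable_seed t).prodMk (hS.measurable_coords t))
    have e1 : P.map (S t) = randomKLaw d k := by
      have : S t = (fun z : Vec d × Θ × Finset (Fin d) => z.2.2) ∘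
          fun ω => (ξ t ω, θ t ω, S t ω) := rfl
      have hn : IsProbabilityMeasure (noiseLaw d r) := by
        unfold noiseLaw
        exact Measure.isProbabilityMeasure_map (by fun_prop)
      rw [this, ← Measure.map_map (by fun_prop) hz, hS.law]
      have e2 : (fun z : Vec d × Θ × Finset (Fin d) => z.2.2) = Prod.snd ∘ Prod.snd := rfl
      rw [e2, ← Measure.map_map measurable_snd measurable_snd]
      simp [Measure.map_snd_prod]
    have e2 := ae_card_eq_of_randomKLaw hk
    rw [← e1] at e2
    exact ae_of_ae_map (hS.measurable_coords t).aemeasurable e2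
  filter_upwards [ae_all_iff.2 h1] with ω hω
  simp [commPerWorker, hω]

end Probability

/-! ### Choice of the parameters. -/

section Parameters

/-- The bound on the mean number of points that are not second-order stationary. -/
theorem count_bound {δ a c X ε u ρ α η N I T : ℝ} (hδ : 0 < δ) (ha : 1 ≤ a) (hX : 1 ≤ X)
    (hu : 0 < u) (hu1 : u ≤ 1) (hε : ε = u ^ 2) (hρ : 0 < ρ) (hρX : ρ ≤ X)
    (hη : 0 < η) (hη' : α * η * (c * X ^ 13) = ε ^ 2) (hI0 : 0 ≤ I)
    (hI : I * η ≤ 3 * a * X ^ 2 / u) (hIT : I ≤ T) (hT : c * X ^ 11 ≤ T * (η * ε ^ 2))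
    (hN0 : 0 ≤ N) (hN : N ≤ 2 * α * 400008 * X ^ 2) (hc : c = 10 ^ 18 * a ^ 4 / δ ^ 2) :
    4 / (η * ε ^ 2) * (X + T * (X * η ^ 2 * N)) +
      128 * (100000 + 1) * (I * η * ρ) ^ 2 * ((12 / (η * X ^ 2) + 96 * I ^ 2 * η) *
        (X + (T + I) * (X * η ^ 2 * N)) + T * (12 * I * η ^ 2 * N)) ≤ δ ^ 2 * T := by
  have ha0 : 0 < a := by linarith
  have hX0 : 0 < X := by linarith
  have hε0 : 0 < ε := by rw [hε]; positivity
  have hε1 : ε ≤ 1 := by rw [hε]; exact pow_le_one₀ hu.le hu1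
  have hc0 : 0 < c := by rw [hc]; positivity
  have hT0 : 0 ≤ T := hI0.trans hIT
  have hαη : α * η = ε ^ 2 / (c * X ^ 13) := by
    rw [eq_div_iff (by positivity), hη']
  have hE : X + (T + I) * (X * η ^ 2 * N) ≤ 1600033 * (T * (η * ε ^ 2)) / (c * X ^ 10) := by
    have e1 : X ≤ T * (η * ε ^ 2) / (c * X ^ 10) := by
      rw [le_div_iff₀ (by positivity)]
      linarith [hT]
    have e2 : (T + I) * (X * η ^ 2 * N) ≤ 1600032 * (T * (η * ε ^ 2)) / (c * X ^ 10) := by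
      calc (T + I) * (X * η ^ 2 * N) ≤ (T + T) * (X * η ^ 2 * (2 * α * 400008 * X ^ 2)) := by
            gcongr
        _ = 1600032 * T * η * X ^ 3 * (α * η) := by ring
        _ = _ := by rw [hαη]; field_simp
    calc _ ≤ T * (η * ε ^ 2) / (c * X ^ 10) + 1600032 * (T * (η * ε ^ 2)) / (c * X ^ 10) :=
          add_le_add e1 e2
      _ = _ := by ring
  have hE1 : X + T * (X * η ^ 2 * N) ≤ 1600033 * (T * (η * ε ^ 2)) / (c * X ^ 10) := by
    refine le_trans ?_ hE
    gcongr
    linarith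
  have hI2 : (I * η) ^ 2 ≤ 9 * a ^ 2 * X ^ 4 / ε := by
    calc (I * η) ^ 2 ≤ (3 * a * X ^ 2 / u) ^ 2 := by gcongr
      _ = _ := by rw [hε]; field_simp; norm_num
  have hW : 128 * (100000 + 1) * (I * η * ρ) ^ 2 ≤ 115201152 * a ^ 2 * X ^ 6 / ε := by
    calc 128 * (100000 + 1) * (I * η * ρ) ^ 2 = 12800128 * ((I * η) ^ 2 * ρ ^ 2) := by ring
      _ ≤ 12800128 * (9 * a ^ 2 * X ^ 4 / ε * X ^ 2) := by gcongr
      _ = _ := by ring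
  have hP : 12 / (η * X ^ 2) + 96 * I ^ 2 * η ≤ 876 * a ^ 2 * X ^ 4 / (ε * η) := by
    have e1 : 12 / (η * X ^ 2) ≤ 12 * a ^ 2 * X ^ 4 / (ε * η) := by
      rw [div_le_div_iff₀ (by positivity) (by positivity)]
      have : ε * 1 ≤ 1 * (a ^ 2 * X ^ 6) := by
        gcongr
        exact one_le_mul_of_one_le_of_one_le (one_le_pow₀ ha) (one_le_pow₀ hX)
      nlinarith
    have e2 : 96 * I ^ 2 * η ≤ 864 * a ^ 2 * X ^ 4 / (ε * η) := by
      calc 96 * I ^ 2 * η = 96 * (I * η) ^ 2 / η := by field_simp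
        _ ≤ 96 * (9 * a ^ 2 * X ^ 4 / ε) / η := by gcongr
        _ = _ := by field_simp; norm_num
    calc _ ≤ 12 * a ^ 2 * X ^ 4 / (ε * η) + 864 * a ^ 2 * X ^ 4 / (ε * η) := add_le_add e1 e2
      _ = _ := by ring
  have hQ : 12 * I * η ^ 2 * N ≤ 28800576 * a * ε / (c * X ^ 9) := by
    calc 12 * I * η ^ 2 * N = 12 * (I * η) * η * N := by ring
      _ ≤ 12 * (3 * a * X ^ 2 / u) * η * (2 * α * 400008 * X ^ 2) := by gcongr
      _ = 28800576 * a * X ^ 4 * (α * η) / u := by ring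
      _ = 28800576 * a * u ^ 3 / (c * X ^ 9) := by rw [hαη, hε]; field_simp
      _ ≤ 28800576 * a * ε / (c * X ^ 9) := by
          gcongr
          rw [hε]
          exact pow_le_pow_of_le_one hu.le hu1 (by norm_num)
  have hX10 : 1 / X ^ 10 ≤ a ^ 4 := by
    rw [div_le_iff₀ (by positivity)]
    exact one_le_mul_of_one_le_of_one_le (one_le_pow₀ ha) (one_le_pow₀ hX)
  have hX3 : a ^ 3 / X ^ 3 ≤ a ^ 4 := by
    rw [div_le_iff₀ (by positivity)]
    calc a ^ 3 ≤ a ^ 4 := pow_le_pow_right₀ ha (by norm_num)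
      _ ≤ _ := le_mul_of_one_le_right (by positivity) (one_le_pow₀ hX)
  -- All powers of ε and η cancel, and every summand is T/c times at most a constant times a⁴. The
  -- dominant numerical constant is below 10¹⁸, which together with a⁴/δ² determines c.
  calc _ ≤ 4 / (η * ε ^ 2) * (1600033 * (T * (η * ε ^ 2)) / (c * X ^ 10)) +
        115201152 * a ^ 2 * X ^ 6 / ε * (876 * a ^ 2 * X ^ 4 / (ε * η) *
          (1600033 * (T * (η * ε ^ 2)) / (c * X ^ 10)) +
          T * (28800576 * a * ε / (c * X ^ 9))) := by gcongr
    _ = T / c * (6400132 * (1 / X ^ 10) + 115201152 * 876 * 1600033 * a ^ 4 +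
          115201152 * 28800576 * (a ^ 3 / X ^ 3)) := by field_simp; ring
    _ ≤ T / c * (6400132 * a ^ 4 + 115201152 * 876 * 1600033 * a ^ 4 +
          115201152 * 28800576 * a ^ 4) := by gcongr
    _ ≤ T / c * (10 ^ 18 * a ^ 4) := by
        gcongr
        nlinarith [pow_pos ha0 4]
    _ = δ ^ 2 * T := by rw [hc]; field_simp

/-- The amplified noise dominates the squared radius of the trapping region. -/
theorem amplification_bound {a c X ε ρ α d η g r : ℝ} {I : ℕ} (ha : 1 ≤ a) (hX : 1 ≤ X)
    (hε : 0 < ε) (hε1 : ε ≤ 1) (hρ : 0 < ρ) (hρX : ρ⁻¹ ≤ X) (hα : 1 ≤ α) (hαd : α ≤ d)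
    (hc : 0 < c) (hη : 0 < η) (hη' : α * η * (c * X ^ 13) = ε ^ 2) (hg : 0 ≤ g)
    (hg1 : η * g ≤ 1) (hI1 : 1 ≤ I) (hI : a * X ≤ ((I : ℝ) - 1) * (η * g))
    (hI2 : (a * X) ^ 2 * ρ / ε ≤ (I * η * ρ) ^ 2) (hr : r ^ 2 = 400008 * α * X ^ 2)
    (hexp : c ^ 2 * X ^ 27 * (d ^ 3 / ε ^ 4) ≤ Real.exp (a * X)) :
    4 / ((100000 + 1) * (I * η * ρ) ^ 2) ≤
      η ^ 2 * (r ^ 2 / d) * (1 + η * g) ^ (2 * (I - 1)) := by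
  have hX0 : 0 < X := by linarith
  have hα0 : 0 < α := by linarith
  have hd0 : 0 < d := by linarith
  have hηg : 0 ≤ η * g := by positivity
  have e1 : 1 / X ≤ (I * η * ρ) ^ 2 := by
    refine le_trans ?_ hI2
    have : 1 / X ≤ ρ := by
      rw [inv_le_comm₀ hρ hX0] at hρX
      simpa using hρX
    refine this.trans ?_
    rw [le_div_iff₀ hε]
    have h1 : 1 ≤ a * X := one_le_mul_of_one_le_of_one_le ha hX
    calc ρ * ε ≤ ρ * 1 := by gcongr
      _ = 1 ^ 2 * ρ := by ring
      _ ≤ (a * X) ^ 2 * ρ := by gcongr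
  have e2 : 4 / ((100000 + 1) * (I * η * ρ) ^ 2) ≤ X := by
    calc 4 / ((100000 + 1) * (I * η * ρ) ^ 2) ≤ 4 / ((100000 + 1) * (1 / X)) := by gcongr
      _ = 4 / 100001 * X := by field_simp; norm_num
      _ ≤ X := by linarith
  have e3 : Real.exp (a * X) ≤ (1 + η * g) ^ (2 * (I - 1)) := by
    -- On [0, 1] one has exp x ≤ 1 + x + x² ≤ (1 + x)².
    have h1 : Real.exp (η * g) ≤ (1 + η * g) ^ 2 := by
      have := Real.abs_exp_sub_one_sub_id_le (x := η * g) (by rwa [abs_of_nonneg hηg])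
      have := (abs_le.1 this).2
      nlinarith
    calc Real.exp (a * X) ≤ Real.exp (((I - 1 : ℕ) : ℝ) * (η * g)) := by
          rw [Real.exp_le_exp, Nat.cast_sub hI1]
          simpa using hI
      _ = Real.exp (η * g) ^ (I - 1) := Real.exp_nat_mul _ _
      _ ≤ ((1 + η * g) ^ 2) ^ (I - 1) := by gcongr
      _ = _ := (pow_mul _ _ _).symm
  have hηe : η = ε ^ 2 / (α * (c * X ^ 13)) := by
    rw [eq_div_iff (by positivity)]
    linarith
  refine e2.trans ?_
  -- Inserting η² = ε⁴/(α²c²X²⁶) produces the factor c²X²⁷d³/ε⁴ that the exponential growth has to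
  -- beat.
  calc X ≤ X * (d ^ 2 / α ^ 2) := by
        refine le_mul_of_one_le_right hX0.le ?_
        rw [one_le_div (by positivity)]
        gcongr
    _ = η ^ 2 * (1 / d) * (c ^ 2 * X ^ 27 * (d ^ 3 / ε ^ 4)) := by
        rw [hηe]; field_simp
    _ ≤ η ^ 2 * (r ^ 2 / d) * (1 + η * g) ^ (2 * (I - 1)) := by
        have h1 : 1 ≤ r ^ 2 := by
          rw [hr]
          have := one_le_mul_of_one_le_of_one_le hα (one_le_pow₀ hX (n := 2))
          linarith
        have h2 := hexp.trans e3
        gcongr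

/-- The length of the blocks. -/
theorem block_length_bounds {a X ε u ρ η g : ℝ} {I : ℕ} (ha : 1 ≤ a) (hX : 1 ≤ X) (hu : 0 < u)
    (hu1 : u ≤ 1) (hε : ε = u ^ 2) (hρ : 0 < ρ) (hρX : ρ ≤ X) (hρX' : ρ⁻¹ ≤ X) (hη : 0 < η)
    (hηX : η * X ≤ 1) (hg : 0 < g) (hg2 : g ^ 2 = ρ * ε) (hI : I = ⌈a * X / (η * g)⌉₊ + 1) :
    η * g ≤ 1 ∧ I * η ≤ 3 * a * X ^ 2 / u ∧ a * X ≤ ((I : ℝ) - 1) * (η * g) ∧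
      (a * X) ^ 2 * ρ / ε ≤ (I * η * ρ) ^ 2 := by
  have hX0 : 0 < X := by linarith
  have ha0 : 0 < a := by linarith
  have hε0 : 0 < ε := by rw [hε]; positivity
  have hε1 : ε ≤ 1 := by rw [hε]; exact pow_le_one₀ hu.le hu1
  have h1 : 1 ≤ a * X := one_le_mul_of_one_le_of_one_le ha hX
  have hgX : g ≤ X := by
    refine le_of_sq_le_sq ?_ hX0.le
    rw [hg2]
    calc ρ * ε ≤ X * 1 := by gcongr
      _ ≤ X ^ 2 := by nlinarith
  have hgu : u / X ≤ g := by
    refine le_of_sq_le_sq ?_ hg.le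
    rw [hg2, div_pow, ← hε, div_le_iff₀ (by positivity)]
    have : 1 ≤ ρ * X := by
      rw [inv_le_iff_one_le_mul₀ hρ] at hρX'
      linarith
    have : 1 ≤ ρ * X ^ 2 := by nlinarith
    nlinarith
  have hηg : η * g ≤ 1 := le_trans (by gcongr) hηX
  have hηg0 : 0 < η * g := by positivity
  have hq0 : 0 ≤ a * X / (η * g) := by positivity
  have hc1 := Nat.le_ceil (a * X / (η * g))
  have hc2 := Nat.ceil_lt_add_one hq0
  have hI1 : (I : ℝ) = ⌈a * X / (η * g)⌉₊ + 1 := by rw [hI]; push_cast; ring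
  have hI2 : a * X ≤ ((I : ℝ) - 1) * (η * g) := by
    rw [div_le_iff₀ hηg0] at hc1
    rw [hI1]
    linarith
  have hq1 : 1 ≤ a * X / (η * g) := by
    rw [one_le_div hηg0]
    linarith
  refine ⟨hηg, ?_, hI2, ?_⟩
  · have h3 : (I : ℝ) ≤ 3 * (a * X / (η * g)) := by linarith
    calc I * η ≤ 3 * (a * X / (η * g)) * η := by gcongr
      _ = 3 * (a * X) / g := by field_simp
      _ ≤ 3 * (a * X) / (u / X) := by gcongr
      _ = _ := by field_simp
  · have h4 : a * X ≤ I * η * g := by nlinarith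
    rw [div_le_iff₀ hε0]
    calc (a * X) ^ 2 * ρ ≤ (I * η * g) ^ 2 * ρ := by gcongr
      _ = (I * η) ^ 2 * g ^ 2 * ρ := by ring
      _ = _ := by rw [hg2]; ring

/-- The exponential growth beats all the polynomial factors. -/
theorem exists_growth_rate (δ : ℝ) (hδ : 0 < δ) :
    ∃ a : ℝ, 32 ≤ a ∧ (10 ^ 18 * a ^ 4 / δ ^ 2) ^ 2 ≤ Real.exp (a - 31) := by
  -- The constant c itself contains a⁴, so c² grows like a⁸ and loses against the exponential. The
  -- 31 reserves room for the exponents 27 and 4 in `growth_bound`.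
  have h1 := Real.tendsto_pow_mul_exp_neg_atTop_nhds_zero 8
  have h2 : 0 < δ ^ 4 * Real.exp (-31) / (10 ^ 18) ^ 2 := by positivity
  obtain ⟨a, ha, ha'⟩ := ((h1.eventually_lt_const h2).and (Filter.eventually_ge_atTop 32)).exists
  refine ⟨a, ha', ?_⟩
  rw [lt_div_iff₀ (by positivity), Real.exp_neg, Real.exp_neg] at ha
  rw [div_pow, div_le_iff₀ (by positivity), Real.exp_sub]
  have e1 := Real.exp_pos a
  have e2 := Real.exp_pos 31
  have e3 : a ^ 8 * (10 ^ 18) ^ 2 * Real.exp 31 ≤ δ ^ 4 * Real.exp a := by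
    have := mul_le_mul_of_nonneg_right ha.le (mul_pos e1 e2).le
    calc a ^ 8 * (10 ^ 18) ^ 2 * Real.exp 31 =
        a ^ 8 * (Real.exp a)⁻¹ * (10 ^ 18) ^ 2 * (Real.exp a * Real.exp 31) := by field_simp
      _ ≤ δ ^ 4 * (Real.exp 31)⁻¹ * (Real.exp a * Real.exp 31) := this
      _ = _ := by field_simp
  rw [div_mul_eq_mul_div, le_div_iff₀ e2]
  nlinarith

/-- Both X ≤ exp X and d/ε ≤ exp X hold, so the powers cost exp(27X) and exp(4X). Since X ≥ 1, the
remaining a - 31 is at most (a - 31)X. -/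
theorem growth_bound {a c X d ε : ℝ} (ha : 32 ≤ a) (hca : c ^ 2 ≤ Real.exp (a - 31))
    (hX : 1 ≤ X) (hd : 1 ≤ d) (hε : 0 < ε) (hlog : Real.log (2 + d / ε) ≤ X) :
    c ^ 2 * X ^ 27 * (d ^ 3 / ε ^ 4) ≤ Real.exp (a * X) := by
  have e1 : X ^ 27 ≤ Real.exp (27 * X) := by
    have : X ≤ Real.exp X := by linarith [Real.add_one_le_exp X]
    calc X ^ 27 ≤ Real.exp X ^ 27 := by gcongr
      _ = Real.exp (27 * X) := by rw [← Real.exp_nat_mul]; norm_num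
  have hd0 : 0 < d := by linarith
  have hp : 0 < 2 + d / ε := by positivity
  have e2 : d ^ 3 / ε ^ 4 ≤ Real.exp (4 * X) := by
    have h1 : 2 + d / ε ≤ Real.exp X := (Real.log_le_iff_le_exp hp).1 hlog
    calc d ^ 3 / ε ^ 4 ≤ d ^ 4 / ε ^ 4 := by
          gcongr
          norm_num
      _ = (d / ε) ^ 4 := (div_pow _ _ _).symm
      _ ≤ Real.exp X ^ 4 := by
          gcongr
          linarith
      _ = Real.exp (4 * X) := by rw [← Real.exp_nat_mul]; norm_num
  calc c ^ 2 * X ^ 27 * (d ^ 3 / ε ^ 4) ≤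
      Real.exp (a - 31) * Real.exp (27 * X) * Real.exp (4 * X) := by
        have := Real.exp_pos (27 * X)
        gcongr
    _ = Real.exp (a - 31 + 27 * X + 4 * X) := by rw [Real.exp_add, Real.exp_add]
    _ ≤ Real.exp (a * X) := by
        rw [Real.exp_le_exp]
        nlinarith

end Parameters

/-! ### Assembly of the parameters and the main theorem. -/

section Main

/-- Lets a single number X replace `fmax` and L in all estimates. The constant ρ is kept, because it
occurs in the definition of an ε-SOSP. -/
theorem SmoothObjective.mono {d : ℕ} {f : Vec d → ℝ} {fmax fmax' L L' ρ : ℝ}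
    (hf : SmoothObjective f fmax L ρ) (hfmax : fmax ≤ fmax') (hL : L ≤ L') :
    SmoothObjective f fmax' L' ρ where
  differentiable := hf.differentiable
  differentiable_gradient := hf.differentiable_gradient
  bounded x y := (hf.bounded x y).trans hfmax
  smooth x y := (hf.smooth x y).trans (by gcongr)
  hessian_lipschitz := hf.hessian_lipschitz

theorem alphaParam_mem {d : ℕ} (hd : 1 ≤ d) (ℓ : ℝ≥0∞) :
    1 ≤ alphaParam d ℓ ∧ alphaParam d ℓ ≤ d := by
  have : (1 : ℝ) ≤ d := by exact_mod_cast hd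
  unfold alphaParam
  split_ifs
  · exact ⟨this, le_rfl⟩
  · exact ⟨le_rfl, this⟩

/-- In both cases the variance of gradient differences is controlled. -/
theorem StochasticGradient.exists_gradientDiffVariance {d : ℕ} {Θ : Type u} [MeasurableSpace Θ]
    {D : Measure Θ} [IsProbabilityMeasure D] {f : Vec d → ℝ} {G : Vec d → Θ → Vec d} {σ : ℝ}
    (hG : StochasticGradient D f G σ) {ℓ : ℝ≥0∞} (hlip : LipschitzStochasticGradient G ℓ)
    (hd : 1 ≤ d) :
    ∃ ℓ' τ : ℝ, 0 ≤ τ ∧ 0 ≤ ℓ' ∧ ℓ' ≤ ℓ.toReal ∧ τ * d ≤ 4 * alphaParam d ℓ * σ ^ 2 ∧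
      GradientDiffVariance D f G ℓ' τ := by
  by_cases hℓ : ℓ = ∞
  · refine ⟨0, 4 * σ ^ 2, by positivity, le_rfl, ENNReal.toReal_nonneg, ?_, hG.gradientDiffVariance⟩
    simp only [alphaParam, hℓ, if_true]
    linarith
  · refine ⟨ℓ.toReal, 0, le_rfl, ENNReal.toReal_nonneg, le_rfl, ?_,
      hG.gradientDiffVariance_of_lipschitz hℓ hlip⟩
    have := (alphaParam_mem hd ℓ).1
    rw [zero_mul]
    positivity

/-- The compression rate. -/
theorem randomKSize_bounds {d : ℕ} (hd : 1 ≤ d) {ε α : ℝ} (hε : 0 < ε) (hε1 : ε ≤ 1)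
    (hα : 1 ≤ α) :
    randomKSize d ε α ≤ d ∧ ε / α ≤ (randomKSize d ε α : ℝ) / d := by
  have hd0 : (0 : ℝ) < d := by exact_mod_cast hd
  have hs : 1 ≤ √α := Real.one_le_sqrt.2 hα
  have hp : ε ^ (3 / 4 : ℝ) ≤ 1 := Real.rpow_le_one hε.le hε1 (by norm_num)
  have hp0 : 0 < ε ^ (3 / 4 : ℝ) := Real.rpow_pos_of_pos hε _
  constructor
  · refine Nat.ceil_le.2 ?_
    rw [div_le_iff₀ (by linarith)]
    gcongr
    linarith
  · rw [le_div_iff₀ hd0]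
    refine le_trans ?_ (Nat.le_ceil _)
    have h1 : ε ≤ ε ^ (3 / 4 : ℝ) := by
      simpa using Real.rpow_le_rpow_of_exponent_ge hε hε1 (by norm_num : (3 / 4 : ℝ) ≤ 1)
    have h2 : √α ≤ α := by
      rw [Real.sqrt_le_left (by linarith)]
      nlinarith
    rw [mul_comm, ← mul_div_assoc]
    gcongr

/-- The problem constants are at most `X`. -/
theorem problemSize_bounds {fmax L ρ σ X l : ℝ} {ℓ : ℝ≥0∞} (hfmax : 0 ≤ fmax) (hL : 0 < L)
    (hρ : 0 < ρ) (hσ : 0 ≤ σ) (hl : 1 ≤ l) (hX : X = problemSize fmax L ρ σ ℓ * l) :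
    1 ≤ X ∧ fmax ≤ X ∧ L ≤ X ∧ ρ ≤ X ∧ ρ⁻¹ ≤ X ∧ σ ≤ X ∧ ℓ.toReal ≤ X ∧ l ≤ X := by
  have h1 : 0 ≤ ℓ.toReal := ENNReal.toReal_nonneg
  have h2 : 0 < ρ⁻¹ := inv_pos.2 hρ
  have h3 : 1 ≤ problemSize fmax L ρ σ ℓ := by
    unfold problemSize
    linarith
  have h4 : problemSize fmax L ρ σ ℓ ≤ X := by
    rw [hX]
    exact le_mul_of_one_le_right (by linarith) hl
  have h5 : l ≤ X := by
    rw [hX]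
    exact le_mul_of_one_le_left (by linarith) h3
  unfold problemSize at h4
  refine ⟨?_, ?_, ?_, ?_, ?_, ?_, ?_, h5⟩ <;> linarith

theorem step_size_bounds {a c X ε α η : ℝ} (ha : 1 ≤ a) (hX : 1 ≤ X) (hε : 0 < ε) (hε1 : ε ≤ 1)
    (hα : 1 ≤ α) (hc : 10 ^ 18 * a ≤ c) (hη : 0 < η) (hη' : α * η * (c * X ^ 13) = ε ^ 2) :
    η * X ^ 2 * (10 ^ 18 * (a * X ^ 2)) ≤ ε ^ 2 / α ∧ η * X * 10 ^ 18 ≤ ε / α ∧ ε / α ≤ 1 := by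
  have hα0 : 0 < α := by linarith
  have hX0 : 0 < X := by linarith
  have hc0 : 0 < c := by linarith
  have haX2 : 1 ≤ a * X ^ 2 := one_le_mul_of_one_le_of_one_le ha (one_le_pow₀ hX)
  have hηX : η * X ^ 2 * (10 ^ 18 * (a * X ^ 2)) ≤ ε ^ 2 / α := by
    rw [le_div_iff₀ hα0, ← hη']
    calc η * X ^ 2 * (10 ^ 18 * (a * X ^ 2)) * α = α * η * (10 ^ 18 * a * X ^ 4) := by ring
      _ ≤ α * η * (c * X ^ 13) := by
          gcongr
          norm_num
  have hεα : ε ^ 2 / α ≤ ε / α := by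
    gcongr
    nlinarith
  refine ⟨hηX, ?_, (div_le_one hα0).2 (by linarith)⟩
  refine le_trans ?_ (hηX.trans hεα)
  have h1 : X ≤ X ^ 2 := le_self_pow₀ hX (by norm_num)
  have h2 : (10 : ℝ) ^ 18 ≤ 10 ^ 18 * (a * X ^ 2) := by linarith
  gcongr

/-- Up to powers of X, Iη is of order 1/√ε and η at most of order ε²/α. The product is of order
ε^{3/2}/α, below ε/α and hence below the compression rate. -/
theorem block_drift_bound {a X ε u α η I : ℝ} (ha : 1 ≤ a) (hX : 1 ≤ X)
    (hu0 : 0 < u) (hu1 : u ≤ 1) (hεu : ε = u ^ 2) (hα0 : 0 < α) (hη : 0 < η)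
    (hηX : η * X ^ 2 * (10 ^ 18 * (a * X ^ 2)) ≤ ε ^ 2 / α) (hIη : I * η ≤ 3 * a * X ^ 2 / u) :
    2400024 * (I * η) * (η * X ^ 2) ≤ ε / α := by
  have hX0 : 0 < X := by linarith
  have ha0 : 0 < a := by linarith
  calc 2400024 * (I * η) * (η * X ^ 2) ≤ 2400024 * (3 * a * X ^ 2 / u) * (η * X ^ 2) := by gcongr
    _ = η * X ^ 2 * (7200072 * (a * X ^ 2)) / u := by ring
    _ ≤ η * X ^ 2 * (10 ^ 18 * (a * X ^ 2)) / u := by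
        gcongr
        norm_num
    _ ≤ ε ^ 2 / α / u := by gcongr
    _ = u ^ 3 / α := by rw [hεu]; field_simp
    _ ≤ ε / α := by
        rw [hεu]
        exact div_le_div_of_nonneg_right (pow_le_pow_of_le_one hu0.le hu1 (by norm_num)) hα0.le

/-- T is of order 1/(ηε²), the time the energy bound needs to make the average squared gradient
small compared with ε². With η of order ε²/α this gives α/ε⁴. -/
theorem horizon_bounds {a c X ε u α η I : ℝ} {T : ℕ} (ha : 1 ≤ a) (hX1 : 1 ≤ X)
    (hu0 : 0 < u) (hu1 : u ≤ 1) (hεu : ε = u ^ 2) (hα1 : 1 ≤ α) (hc : 10 ^ 18 * a ≤ c)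
    (hη0 : 0 < η) (hη' : α * η * (c * X ^ 13) = ε ^ 2) (hIη : I * η ≤ 3 * a * X ^ 2 / u)
    (hT : T = ⌈c * X ^ 11 / (η * ε ^ 2)⌉₊) :
    (1 : ℝ) ≤ T ∧ (T : ℝ) ≤ 2 * c ^ 2 * X ^ 24 * (α / ε ^ 4) ∧ c * X ^ 11 ≤ T * (η * ε ^ 2) ∧
      I ≤ T := by
  have hX0 : 0 < X := by linarith
  have hα0 : 0 < α := by linarith
  have hc0 : 0 < c := by linarith
  have hε : 0 < ε := by rw [hεu]; positivity
  have hε1 : ε ≤ 1 := by rw [hεu]; exact pow_le_one₀ hu0.le hu1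
  have hη : η = ε ^ 2 / (α * (c * X ^ 13)) := by
    rw [eq_div_iff (by positivity)]
    linarith
  have hq1 : 1 ≤ c * X ^ 11 / (η * ε ^ 2) := by
    rw [one_le_div (by positivity)]
    have h1 : η ≤ 1 := by
      rw [hη, div_le_one (by positivity)]
      have e1 : ε ^ 2 ≤ 1 := pow_le_one₀ hε.le hε1
      have e2 : 1 ≤ α * (c * X ^ 13) := one_le_mul_of_one_le_of_one_le hα1
        (one_le_mul_of_one_le_of_one_le (by linarith) (one_le_pow₀ hX1))
      linarith
    have h2 : ε ^ 2 ≤ 1 := pow_le_one₀ hε.le hε1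
    have h3 : η * ε ^ 2 ≤ 1 := mul_le_one₀ h1 (by positivity) h2
    have h4 : 1 ≤ c * X ^ 11 := one_le_mul_of_one_le_of_one_le (by linarith) (one_le_pow₀ hX1)
    linarith
  have hTle : (T : ℝ) ≤ 2 * c ^ 2 * X ^ 24 * (α / ε ^ 4) := by
    have h1 := Nat.ceil_lt_add_one (zero_le_one.trans hq1)
    rw [← hT] at h1
    calc (T : ℝ) ≤ 2 * (c * X ^ 11 / (η * ε ^ 2)) := by linarith
      _ = _ := by rw [hη]; field_simp
  have hTge : c * X ^ 11 / (η * ε ^ 2) ≤ T := hT ▸ Nat.le_ceil _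
  have hT1 : (1 : ℝ) ≤ T := hq1.trans hTge
  have hTc : c * X ^ 11 ≤ T * (η * ε ^ 2) := by
    rwa [div_le_iff₀ (by positivity)] at hTge
  have hIT : I ≤ T := by
    refine le_trans ?_ hTge
    rw [le_div_iff₀ (by positivity)]
    calc I * (η * ε ^ 2) = I * η * ε ^ 2 := by ring
      _ ≤ 3 * a * X ^ 2 / u * ε ^ 2 := by gcongr
      _ = 3 * a * X ^ 2 * u ^ 3 := by rw [hεu]; field_simp
      _ ≤ c * X ^ 11 * 1 := by
          gcongr
          · linarith
          · norm_num
          · exact pow_le_one₀ hu0.le hu1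
      _ = _ := mul_one _
  exact ⟨hT1, hTle, hTc, hIT⟩

/-- The step is η = ε²/(αcX¹³), small enough for the noise floor of the energy bound. The block
length I is about aX/(η√(ρε)), so that the linear model is amplified by exp(aX), which beats every
polynomial factor. Of the compression rate μ only ε/α ≤ μ is needed. -/
theorem exists_parameters (δ : ℝ) (hδ : 0 < δ) (hδ' : δ ≤ 1 / 2) :
    ∃ c : ℝ, 0 < c ∧ ∀ X ε d ρ σ α μ : ℝ, 1 ≤ X → 0 < ε → ε ≤ 1 → 1 ≤ d → 0 < ρ → ρ ≤ X →
      ρ⁻¹ ≤ X → 0 ≤ σ → σ ≤ X → 1 ≤ α → α ≤ d → ε / α ≤ μ → Real.log (2 + d / ε) ≤ X →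
      ∃ (η r : ℝ) (T I : ℕ), 0 < η ∧ 0 < r ∧ 1 ≤ T ∧ 1 ≤ I ∧
        (T : ℝ) ≤ 2 * c ^ 2 * X ^ 24 * (α / ε ^ 4) ∧ η * X ≤ μ / 8 ∧
        8 * (100000 + 1) * I * η ^ 2 * X ^ 2 ≤ μ ∧ 2 * (100000 + 2) * η ^ 2 * X ^ 2 * I ≤ 1 ∧
        r ^ 2 = 400008 * α * X ^ 2 ∧
        4 / ((100000 + 1) * (I * η * ρ) ^ 2) ≤
          η ^ 2 * (r ^ 2 / d) * (1 + η * √(ρ * ε)) ^ (2 * (I - 1)) ∧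
        4 / (η * ε ^ 2) * (X + T * (X * η ^ 2 * (σ ^ 2 + r ^ 2))) +
          128 * (100000 + 1) * (I * η * ρ) ^ 2 * ((12 / (η * X ^ 2) + 96 * I ^ 2 * η) *
            (X + (T + I) * (X * η ^ 2 * (σ ^ 2 + r ^ 2))) +
            T * (12 * I * η ^ 2 * (σ ^ 2 + r ^ 2))) ≤ δ ^ 2 * T := by
  obtain ⟨a, ha, hca⟩ := exists_growth_rate δ hδ
  obtain ⟨c, hc⟩ : ∃ c, c = 10 ^ 18 * a ^ 4 / δ ^ 2 := ⟨_, rfl⟩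
  rw [← hc] at hca
  have ha1 : 1 ≤ a := by linarith
  have hc18 : 10 ^ 18 * a ≤ c := by
    rw [hc, le_div_iff₀ (by positivity)]
    have h1 : δ ^ 2 ≤ 1 := by nlinarith
    have h2 : a ≤ a ^ 4 := le_self_pow₀ ha1 (by norm_num)
    calc 10 ^ 18 * a * δ ^ 2 ≤ 10 ^ 18 * a ^ 4 * 1 := by gcongr
      _ = _ := mul_one _
  have hc1 : 10 ^ 18 ≤ c := by linarith
  have hc0 : 0 < c := by linarith
  refine ⟨c, hc0, ?_⟩
  intro X ε d ρ σ α μ hX1 hε hε1 hd1 hρ hρX hρX' hσ hσX hα1 hαd hμ hlogX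
  have hα0 : 0 < α := by linarith
  have hX0 : 0 < X := by linarith
  obtain ⟨u, hu⟩ : ∃ u, u = √ε := ⟨_, rfl⟩
  have hu0 : 0 < u := hu ▸ Real.sqrt_pos.2 hε
  have hεu : ε = u ^ 2 := by rw [hu, Real.sq_sqrt hε.le]
  have hu1 : u ≤ 1 := by
    rw [hu]
    exact Real.sqrt_le_one.2 hε1
  obtain ⟨g, hg⟩ : ∃ g, g = √(ρ * ε) := ⟨_, rfl⟩
  have hg0 : 0 < g := hg ▸ Real.sqrt_pos.2 (mul_pos hρ hε)
  have hg2 : g ^ 2 = ρ * ε := by rw [hg, Real.sq_sqrt (mul_pos hρ hε).le]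
  obtain ⟨η, hη⟩ : ∃ η, η = ε ^ 2 / (α * (c * X ^ 13)) := ⟨_, rfl⟩
  have hη0 : 0 < η := by rw [hη]; positivity
  have hη' : α * η * (c * X ^ 13) = ε ^ 2 := by rw [hη]; field_simp
  -- 400008 = 4(M + 2) with M = 100000. As τd ≤ 4ασ², this choice yields (M + 2)τ ≤ r²/d.
  obtain ⟨r, hr⟩ : ∃ r, r = √(400008 * α * X ^ 2) := ⟨_, rfl⟩
  have hr0 : 0 < r := hr ▸ Real.sqrt_pos.2 (by positivity)
  have hr2 : r ^ 2 = 400008 * α * X ^ 2 := by rw [hr, Real.sq_sqrt (by positivity)]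
  obtain ⟨I, hI⟩ : ∃ I, I = ⌈a * X / (η * g)⌉₊ + 1 := ⟨_, rfl⟩
  obtain ⟨T, hT⟩ : ∃ T, T = ⌈c * X ^ 11 / (η * ε ^ 2)⌉₊ := ⟨_, rfl⟩
  have hI1 : 1 ≤ I := by omega
  obtain ⟨hηX, hηX1, hεα1⟩ := step_size_bounds ha1 hX1 hε hε1 hα1 hc18 hη0 hη'
  have hηX0 : 0 < η * X := by positivity
  obtain ⟨hηg, hIη, hIg, hIρ⟩ := block_length_bounds ha1 hX1 hu0 hu1 hεu hρ hρX hρX' hη0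
    (by linarith only [hηX1, hεα1, hηX0]) hg0 hg2 hI
  have hkey := block_drift_bound ha1 hX1 hu0 hu1 hεu hα0 hη0 hηX hIη
  obtain ⟨hT1, hTle, hTc, hIT⟩ := horizon_bounds ha1 hX1 hu0 hu1 hεu hα1 hc18 hη0 hη' hIη hT
  have hN : σ ^ 2 + r ^ 2 ≤ 2 * α * 400008 * X ^ 2 := by
    have h1 : σ ^ 2 ≤ X ^ 2 := by gcongr
    have h2 : 1 * X ^ 2 ≤ α * X ^ 2 := by gcongr
    have h3 : 0 ≤ α * X ^ 2 := by positivity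
    rw [hr2]
    linarith only [h1, h2, h3]
  have hcount := count_bound hδ ha1 hX1 hu0 hu1 hεu hρ hρX hη0 hη' (Nat.cast_nonneg I) hIη hIT
    hTc (by positivity : 0 ≤ σ ^ 2 + r ^ 2) hN hc
  have hamp := amplification_bound ha1 hX1 hε hε1 hρ hρX' hα1 hαd hc0 hη0 hη' hg0.le hηg hI1 hIg
    hIρ hr2 (growth_bound ha hca hX1 hd1 hε hlogX)
  refine ⟨η, r, T, I, hη0, hr0, by exact_mod_cast hT1, hI1, hTle, ?_, ?_, ?_, hr2, hg ▸ hamp, hcount⟩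
  · linarith only [hηX1, hμ, hηX0]
  · refine le_trans ?_ (hkey.trans hμ)
    calc 8 * (100000 + 1) * I * η ^ 2 * X ^ 2 = 800008 * (I * η) * (η * X ^ 2) := by ring
      _ ≤ 2400024 * (I * η) * (η * X ^ 2) := by
          gcongr
          norm_num
  · refine le_trans ?_ (hkey.trans hεα1)
    calc 2 * (100000 + 2) * η ^ 2 * X ^ 2 * I = 200004 * (I * η) * (η * X ^ 2) := by ring
      _ ≤ 2400024 * (I * η) * (η * X ^ 2) := by
          gcongr
          norm_num

/-- The product of α/ε⁴ and dε^{3/4}/√α. The factor 2 in `hk` leaves room for rounding up a number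
that is at least 1. -/
theorem communication_bound {c X ε α d k T : ℝ} (hε : 0 < ε) (hα : 0 < α)
    (hT : T ≤ 2 * c ^ 2 * X ^ 24 * (α / ε ^ 4)) (hk0 : 0 ≤ k)
    (hk : k ≤ 2 * (d * ε ^ (3 / 4 : ℝ) / √α)) :
    T * (2 * k) ≤ 8 * c ^ 2 * X ^ 24 * (d * √α / ε ^ (3 + 1 / 4 : ℝ)) := by
  have hpow : ε ^ 4 = ε ^ (3 / 4 : ℝ) * ε ^ (3 + 1 / 4 : ℝ) := by
    rw [← Real.rpow_add hε, ← Real.rpow_natCast]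
    norm_num
  have hp1 : 0 < ε ^ (3 / 4 : ℝ) := Real.rpow_pos_of_pos hε _
  have hp2 : 0 < ε ^ (3 + 1 / 4 : ℝ) := Real.rpow_pos_of_pos hε _
  have hs0 : 0 < √α := Real.sqrt_pos.2 hα
  have hs2 : √α ^ 2 = α := Real.sq_sqrt hα.le
  calc T * (2 * k) ≤
        2 * c ^ 2 * X ^ 24 * (α / ε ^ 4) * (2 * (2 * (d * ε ^ (3 / 4 : ℝ) / √α))) := by gcongr
    _ = 2 * c ^ 2 * X ^ 24 * (√α ^ 2 / (ε ^ (3 / 4 : ℝ) * ε ^ (3 + 1 / 4 : ℝ))) *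
        (2 * (2 * (d * ε ^ (3 / 4 : ℝ) / √α))) := by rw [hpow, hs2]
    _ = 8 * c ^ 2 * X ^ 24 * (d * √α / ε ^ (3 + 1 / 4 : ℝ)) := by
        generalize ε ^ (3 / 4 : ℝ) = e1 at *
        generalize ε ^ (3 + 1 / 4 : ℝ) = e2 at *
        field_simp
        ring

end Main

theorem mainTheorem3 (δ : ℝ) (hδ : 0 < δ) (hδ' : δ ≤ 1 / 2) :
    ∃ (A : ℝ) (p : ℕ), 0 < A ∧
      ∀ (d : ℕ) (ε fmax L ρ σ : ℝ) (ℓ : ℝ≥0∞),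
        1 ≤ d → 0 < ε → ε ≤ 1 → 0 ≤ fmax → 0 < L → 0 < ρ → 0 ≤ σ →
        ∃ (η r : ℝ) (T : ℕ), 0 < η ∧ 0 < r ∧ 1 ≤ T ∧
          (T : ℝ) ≤ hiddenFactor A p d ε fmax L ρ σ ℓ * (alphaParam d ℓ / ε ^ 4) ∧
          ∀ (Θ : Type u) (_ : MeasurableSpace Θ) (D : Measure Θ) (_ : IsProbabilityMeasure D)
            (f : Vec d → ℝ) (G : Vec d → Θ → Vec d),
            SmoothObjective f fmax L ρ →
            StochasticGradient D f G σ →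
            LipschitzStochasticGradient G ℓ →
            ∀ (Ω : Type v) (_ : MeasurableSpace Ω) (P : Measure Ω) (_ : IsProbabilityMeasure P)
              (ξ : ℕ → Ω → Vec d) (θ : ℕ → Ω → Θ) (S : ℕ → Ω → Finset (Fin d)) (x₀ : Vec d),
              IsSampling P D (randomKSize d ε (alphaParam d ℓ)) r ξ θ S →
              1 - δ ≤ P.real {ω | (1 - δ) * T ≤ sospCount f ρ ε
                (fun t => (compressedSGD keepCoords G η x₀
                  (fun s => ξ s ω) (fun s => θ s ω) (fun s => S s ω) t).1) T} ∧
              (1 ≤ d * ε ^ (3 / 4 : ℝ) / √(alphaParam d ℓ) →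
                ∀ᵐ ω ∂P, (commPerWorker (fun s => S s ω) T : ℝ) ≤
                  hiddenFactor A p d ε fmax L ρ σ ℓ *
                    (d * √(alphaParam d ℓ) / ε ^ (3 + 1 / 4 : ℝ))) := by
  obtain ⟨c, hc0, hpar⟩ := exists_parameters δ hδ hδ'
  -- The horizon needs only 2c²; the communication bound needs 8c², with the same power of X.
  refine ⟨8 * c ^ 2, 24, by positivity, ?_⟩
  intro d ε fmax L ρ σ ℓ hd hε hε1 hfmax hL hρ hσ
  have hd1 : (1 : ℝ) ≤ d := by exact_mod_cast hd
  obtain ⟨hα1, hαd⟩ := alphaParam_mem hd ℓ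
  have hvar0 : ∀ (Θ : Type u) (_ : MeasurableSpace Θ) (D : Measure Θ) (_ : IsProbabilityMeasure D)
      (f : Vec d → ℝ) (G : Vec d → Θ → Vec d), StochasticGradient D f G σ →
      LipschitzStochasticGradient G ℓ → ∃ ℓ' τ : ℝ, 0 ≤ τ ∧ 0 ≤ ℓ' ∧ ℓ' ≤ ℓ.toReal ∧
        τ * d ≤ 4 * alphaParam d ℓ * σ ^ 2 ∧ GradientDiffVariance D f G ℓ' τ :=
    fun Θ _ D _ f G hG hlip => hG.exists_gradientDiffVariance hlip hd
  obtain ⟨hk, hμ⟩ := randomKSize_bounds hd hε hε1 hα1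
  generalize alphaParam d ℓ = α at *
  have hα0 : 0 < α := by linarith
  obtain ⟨X, hX⟩ : ∃ X, X = problemSize fmax L ρ σ ℓ * Real.log (2 + d / ε) := ⟨_, rfl⟩
  have hlog : 1 ≤ Real.log (2 + d / ε) := by
    have h1 : 1 ≤ d / ε := by
      rw [one_le_div hε]
      linarith
    rw [Real.le_log_iff_exp_le (by positivity)]
    linarith [Real.exp_one_lt_d9]
  obtain ⟨hX1, hfX, hLX, hρX, hρX', hσX, hℓX, hlogX⟩ :=
    problemSize_bounds hfmax hL hρ hσ hlog hX
  have hX0 : 0 < X := by linarith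
  have hhid : hiddenFactor (8 * c ^ 2) 24 d ε fmax L ρ σ ℓ = 8 * c ^ 2 * X ^ 24 := by
    rw [hiddenFactor, hX, mul_pow, mul_assoc]
  obtain ⟨η, r, T, I, hη0, hr0, hT1, hI1, hT, hημ, h1, h2, hr2, hamp, hcount⟩ :=
    hpar X ε d ρ σ α _ hX1 hε hε1 hd1 hρ hρX hρX' hσ hσX hα1 hαd hμ hlogX
  refine ⟨η, r, T, hη0, hr0, hT1, ?_, ?_⟩
  · rw [hhid]
    refine hT.trans ?_
    gcongr
    norm_num
  intro Θ mΘ D hD f G hf hG hlip Ω _ P _ ξ θ S x₀ hS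
  constructor
  · obtain ⟨ℓ', τ, hτ, hℓ'0, hℓ', hτd, hvar⟩ := hvar0 Θ mΘ D hD f G hG hlip
    have hμ0 : 0 < (randomKSize d ε α : ℝ) / d := lt_of_lt_of_le (by positivity) hμ
    refine hG.one_sub_le_sospCount (hf.mono hfX hLX) hX0 hρ hd hk hτ hvar hr0 hη0 rfl hμ0
      hημ hI1 (M := 100000) le_rfl h1 ?_ ?_ hε hamp hδ hT1 hcount hS x₀
    · refine le_trans ?_ h2
      gcongr
      exact hℓ'.trans hℓX
    · rw [le_div_iff₀ (by linarith), hr2]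
      have h1 : α * σ ^ 2 ≤ α * X ^ 2 := by gcongr
      linarith
  · intro hlarge
    filter_upwards [hS.ae_commPerWorker_eq hk T] with ω hω
    rw [hω, hhid]
    push_cast
    refine communication_bound hε (by linarith) hT (by positivity) ?_
    have := Nat.ceil_lt_add_one (zero_le_one.trans hlarge)
    rw [randomKSize]
    linarith
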